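/- Theorem 3. Setting. Constraints are atoms over first-order terms, either built-in or user-defined (CHR); the built-in ones contain $=$, $\mathtt{true}$, $\mathtt{false}$, and their meaning is given by a first-order theory $\mathcal{CT}$ that contains Clark's equality theory for all function symbols. An identified CHR constraint is $h\#i$ with $i$ a positive integer, $chr(h\#i)=h$, $id(h\#i)=i$; a token is $r@i_1,\dots,i_l$ with distinct identifiers $i_j$. An annotated rule has the form $r@H_1\backslash H_2\Leftrightarrow D\,|\,B;T$, where the head $H_1,H_2$ is a non-empty sequence of CHR constraints, the guard $D$ is a conjunction of built-in constraints, the body $B$ consists of built-in constraints and of identified CHR constraints with pairwise different identifiers, and $T$ is a finite set of tokens. An annotated program is a set of annotated rules (rule names need not be unique). Conjunctions are treated as multisets. $inst(B,T,n)=(B',T',m)$ adds $n$ to all identifiers in $(B,T)$, and $m$ is the greatest identifier in $(B',T')$ ($m=n$ if there is none); $clean(B,T)$ is the set of the tokens of $T$ all of whose identifiers occur in $B$. Semantics. Configurations are tuples $\langle S,C,T\rangle_n$ with $S$ a multiset of identified CHR constraints (with different identifiers) and built-in constraints, $C$ a conjunction of built-in constraints, $T$ a finite set of tokens and $n$ an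 upper bound of the identifiers used in $S$ and $T$. A configuration is failed if $\mathcal{CT}\models C\leftrightarrow\mathtt{false}$; failed configurations have no transitions. From the others there are the transitions (Solve') $\langle\{c\}\uplus S,C,T\rangle_n\to\langle S,c\wedge C,T\rangle_n$ for $c$ built-in, and (Apply') $\langle K_1\uplus K_2\uplus S,C,T\rangle_n\to\langle B'\uplus K_1\uplus S,\ (chr(K_1,K_2)=(H_1,H_2))\wedge D\wedge C,\ T\cup\{r@id(K_1,K_2)\}\cup T_r'\rangle_m$, where $r@H_1\backslash H_2\Leftrightarrow D\,|\,B;T_r$ is a variant of a rule of $P$ with variables that do not occur in the configuration, $\mathcal{CT}\models C\to\exists_{r}((chr(K_1,K_2)=(H_1,H_2))\wedge D)$ (with $\exists_r$ over the variables of the rule), $(B',T_r',m)=inst(B,T_r,n)$ and $r@id(K_1,K_2)\notin T$. A derivation is normal if Apply' is used only on configurations without built-in constraints in $S$; $P$ is normally terminating if it has no infinite normal derivation. For a set $V$ of variables, $\equiv_V$ is the smallest equivalence on configurations $\langle G,C,T\rangle_n$ such that: $\langle d\wedge G,C,T\rangle_n\equiv_V\langle G,d\wedge C,T\rangle_n$;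 $\langle G,X=t\wedge C,T\rangle_n\equiv_V\langle G[X/t],X=t\wedge C,T\rangle_n$; $\langle G,C,T\rangle_n\equiv_V\langle G[X/Y],C[X/Y],T\rangle_n$ if $X,Y\notin V$ and $Y$ does not occur in $G,C$; $\langle G,C,T\rangle_n\equiv_V\langle G,C',T\rangle_n$ if $\mathcal{CT}\models\exists_WC\leftrightarrow\exists_UC'$ with $W=Fv(C)\setminus(Fv(G)\cup V)$, $U=Fv(C')\setminus(Fv(G)\cup V)$; $\langle G,\mathtt{false},T\rangle_n\equiv_V\langle G',\mathtt{false},T'\rangle_m$; $\langle G,C,T\rangle_n\equiv_V\langle G\rho,C,T\rho\rangle_m$ for each renaming $\rho$ of identifiers such that all identifiers in $G\rho,T\rho$ are $\le m$; $\langle G,C,T\rangle_n\equiv_V\langle G,C,clean(G,T)\rangle_n$. $P$ is confluent if, for each configuration $\sigma$, whenever $\sigma\to^*\sigma_1$ and $\sigma\to^*\sigma_2$ there are $\sigma_1\to^*\tau_1$ and $\sigma_2\to^*\tau_2$ with $\tau_1\equiv_{Fv(\sigma)}\tau_2$. For a goal $G$ (a multiset of built-in and CHR constraints), let $I(G)$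 be $G$ with its CHR constraints numbered $1,\dots,m$. The set of qualified answers is $$\mathcal{QA}'_P(G)=\{\exists_{-Fv(G)}(chr(K)\wedge D)\mid \langle I(G),\mathtt{true},\emptyset\rangle_m\to^*\langle K,D,T\rangle_n\not\to,\ \mathcal{CT}\not\models D\leftrightarrow\mathtt{false}\},$$ where answers $\exists_{-V}(K\wedge D)$, $\exists_{-V}(K'\wedge D')$ ($V=Fv(G)$, local variables of the two renamed apart) are identified if they are equivalent modulo $\mathcal{CT}$ as follows: there is a bijection between the multisets $K$ and $K'$ that preserves predicate symbols and such that, with $K=K'$ denoting the corresponding equations, $\mathcal{CT}\models D\to\exists_{-V\cup Fv(K,D)}(K=K'\wedge D')$ and $\mathcal{CT}\models D'\to\exists_{-V\cup Fv(K',D')}(K=K'\wedge D)$. Unfolding. Let $cl_r=r@H_1\backslash H_2\Leftrightarrow D\,|\,K,S_1,S_2,C;T$, where $C$ is the conjunction of all built-in constraints of the body, and let $cl_v=v@H_1'\backslash H_2'\Leftrightarrow D'\,|\,B;T'$ be a variant, renamed apart from $cl_r$, of a rule of $P$. Let $\theta$ be an idempotent substitution with $dom(\theta)\subseteq Fv(H_1',H_2')$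 and $\mathcal{CT}\models(C\wedge D)\to chr(S_1,S_2)=(H_1',H_2')\theta$ (same predicate symbols). Let $m$ be the greatest identifier in $cl_r$, $(B_1,T_1,m_1)=inst(B,T',m)$, and let $D''$ consist of the $d\in D'$ with $\mathcal{CT}\not\models C\wedge D\to d\theta$. If $v@id(S_1,S_2)\notin T$, $Fv(D''\theta)\cap Fv((H_1',H_2')\theta)\subseteq Fv(H_1,H_2)$ and $D\wedge D''\theta$ is satisfiable, then $$r@H_1\backslash H_2\Leftrightarrow D,D''\theta\,|\,K,S_1,B_1,C,chr(S_1,S_2)=(H_1',H_2');T''$$ is an unfolding of $cl_r$, where $T''=T\cup T_1\cup\{v@id(S_1)\}$ if $H_2'$ is empty and $T''=clean((K,S_1),T)\cup T_1$ otherwise. $Unf_P(cl)$ is the set of the unfoldings of $cl$ with the rules of $P$, for all possible choices of the rule and of $S_1,S_2$; for each of them the choice of the renaming and of $\theta$ (one or several) is arbitrary. The rule $cl\in P$ can be weakly safely replaced in $P$ if there is an unfolding of $cl$ with a rule of $P$ whose guard $\tilde D$ satisfies $\mathcal{CT}\models D\leftrightarrow\tilde D$, where $D$ is the guard of $cl$.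 Statement. Let $P$ be a normally terminating and confluent annotated program, let $cl\in P$ be a rule that can be weakly safely replaced in $P$, and let $P'=(P\setminus\{cl\})\cup Unf_P(cl)$. Then $\mathcal{QA}'_P(G)=\mathcal{QA}'_{P'}(G)$ for every goal $G$. -/

import Mathlib

universe u v w

namespace CHR

/-! Basic notions.  The function symbols are those of the first-order language `L`, the built-in
predicate symbols are its relation symbols together with equality, `true` and `false`, and the
user-defined (CHR) predicate symbols of arity `n` form the type `Q n`.  Variables are natural
numbers. -/

/-- Atomic built-in constraints. -/
inductive Builtin (L : FirstOrder.Language.{u, v}) : Type (max u v)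
  | tt : Builtin L
  | ff : Builtin L
  | eq (s t : L.Term ℕ) : Builtin L
  | rel {n : ℕ} (R : L.Relations n) (ts : Fin n → L.Term ℕ) : Builtin L

/-- User-defined (CHR) constraints `p(t₁, …, tₙ)`. -/
structure UAtom (L : FirstOrder.Language.{u, v}) (Q : ℕ → Type w) where
  arity : ℕ
  pred : Q arity
  args : Fin arity → L.Term ℕ

/-- Identified CHR constraints `h#i`. -/
structure IdAtom (L : FirstOrder.Language.{u, v}) (Q : ℕ → Type w) where
  atom : UAtom L Q
  id : ℕ

/-- Tokens `r@i₁, …, iₗ`. -/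
structure Token where
  rule : ℕ
  ids : List ℕ
deriving DecidableEq

/-- Annotated rules `r@ H₁ \ H₂ ⇔ D | B ; T`.  The body `B` is split into its identified CHR
constraints `body` and its built-in constraints `bodyB`; conjunctions are multisets. -/
structure AnnRule (L : FirstOrder.Language.{u, v}) (Q : ℕ → Type w) where
  name : ℕ
  H1 : List (UAtom L Q)
  H2 : List (UAtom L Q)
  guard : Multiset (Builtin L)
  body : Multiset (IdAtom L Q)
  bodyB : Multiset (Builtin L)
  tokens : Finset Token

section Basic

variable {L : FirstOrder.Language.{u, v}} {Q : ℕ → Type w}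

/-- The variables of a term. -/
def termVars (t : L.Term ℕ) : Set ℕ := {x | x ∈ t.varFinset}

namespace Builtin

def vars : Builtin L → Set ℕ
  | tt => ∅
  | ff => ∅
  | eq s t => termVars s ∪ termVars t
  | rel _ ts => {x | ∃ i, x ∈ termVars (ts i)}

def subst (θ : ℕ → L.Term ℕ) : Builtin L → Builtin L
  | tt => tt
  | ff => ff
  | eq s t => eq (s.subst θ) (t.subst θ)
  | rel R ts => rel R (fun i => (ts i).subst θ)

/-- Truth of a built-in constraint in a structure under a valuation of the variables. -/
def Holds {M : Type*} [L.Structure M] (ν : ℕ → M) : Builtin L → Prop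
  | tt => True
  | ff => False
  | eq s t => s.realize ν = t.realize ν
  | rel R ts => FirstOrder.Language.Structure.RelMap R (fun i => (ts i).realize ν)

end Builtin

/-- The free variables of a conjunction of built-in constraints. -/
def conjVars (C : Multiset (Builtin L)) : Set ℕ := {x | ∃ c ∈ C, x ∈ c.vars}

/-- Application of a substitution to a conjunction of built-in constraints. -/
def conjSubst (θ : ℕ → L.Term ℕ) (C : Multiset (Builtin L)) : Multiset (Builtin L) :=
  C.map (Builtin.subst θ)

/-- Truth of a conjunction of built-in constraints. -/
def Sat {M : Type*} [L.Structure M] (C : Multiset (Builtin L)) (ν : ℕ → M) : Prop :=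
  ∀ c ∈ C, c.Holds ν

namespace UAtom

/-- The predicate symbol, with its arity. -/
def sym (h : UAtom L Q) : Σ n, Q n := ⟨h.arity, h.pred⟩

/-- The list of arguments. -/
def argList (h : UAtom L Q) : List (L.Term ℕ) := List.ofFn h.args

def vars (h : UAtom L Q) : Set ℕ := {x | ∃ i, x ∈ termVars (h.args i)}

def subst (θ : ℕ → L.Term ℕ) (h : UAtom L Q) : UAtom L Q :=
  ⟨h.arity, h.pred, fun i => (h.args i).subst θ⟩

/-- The values of the arguments under a valuation. -/
def eval {M : Type*} [L.Structure M] (ν : ℕ → M) (h : UAtom L Q) : List M :=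
  h.argList.map (fun t => t.realize ν)

end UAtom

/-- The equations `s₁ = t₁, …, sₙ = tₙ` abbreviated by `p(s₁, …, sₙ) = p(t₁, …, tₙ)`, for two
sequences of CHR constraints.  It is only used for sequences with the same predicate symbols. -/
def matchEqs (hs hs' : List (UAtom L Q)) : Multiset (Builtin L) :=
  ↑(List.zipWith (fun h h' => List.zipWith Builtin.eq h.argList h'.argList) hs hs').flatten

/-- The variables of a sequence of CHR constraints. -/
def atomsVars (hs : List (UAtom L Q)) : Set ℕ := {x | ∃ h ∈ hs, x ∈ h.vars}

/-- The variables of a multiset of identified CHR constraints. -/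
def idAtomsVars (B : Multiset (IdAtom L Q)) : Set ℕ := {x | ∃ k ∈ B, x ∈ k.atom.vars}

/-- `chr` on sequences of identified atoms. -/
def chrOf (S : List (IdAtom L Q)) : List (UAtom L Q) := S.map IdAtom.atom

/-- `id` on sequences of identified atoms. -/
def idsOf (S : List (IdAtom L Q)) : List ℕ := S.map IdAtom.id

namespace IdAtom

def subst (θ : ℕ → L.Term ℕ) (k : IdAtom L Q) : IdAtom L Q := ⟨k.atom.subst θ, k.id⟩

/-- Replacing the identifier `i` by `f i`. -/
def mapId (f : ℕ → ℕ) (k : IdAtom L Q) : IdAtom L Q := ⟨k.atom, f k.id⟩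

end IdAtom

/-- Replacing every identifier `i` in a token by `f i`. -/
def Token.mapId (f : ℕ → ℕ) (t : Token) : Token := ⟨t.rule, t.ids.map f⟩

/-- A proper token: its identifiers are distinct positive integers. -/
def Token.WF (t : Token) : Prop := t.ids.Nodup ∧ ∀ i ∈ t.ids, 0 < i

/-- The greatest identifier occurring in `(B, T)`, and `0` if there is none. -/
def maxId (B : Multiset (IdAtom L Q)) (T : Finset Token) : ℕ :=
  max (B.map IdAtom.id).sup (T.sup (fun t => t.ids.foldr max 0))

/-- The function `inst`: every identifier in `(B, T)` is incremented by `n`; the third component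
is the greatest resulting identifier, and it is `n` if there is none. -/
def inst (B : Multiset (IdAtom L Q)) (T : Finset Token) (n : ℕ) :
    Multiset (IdAtom L Q) × Finset Token × ℕ :=
  (B.map (IdAtom.mapId (fun i => i + n)), T.image (Token.mapId (fun i => i + n)), maxId B T + n)

open Classical in
/-- `clean(B, T)` deletes from `T` the tokens with an identifier that does not occur in `B`. -/
noncomputable def clean (B : Multiset (IdAtom L Q)) (T : Finset Token) : Finset Token :=
  T.filter (fun t => ∀ i ∈ t.ids, i ∈ B.map IdAtom.id)

namespace AnnRule

/-- The variables of the head. -/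
def headVars (r : AnnRule L Q) : Set ℕ := atomsVars (r.H1 ++ r.H2)

/-- The variables of a rule. -/
def vars (r : AnnRule L Q) : Set ℕ :=
  r.headVars ∪ conjVars r.guard ∪ idAtomsVars r.body ∪ conjVars r.bodyB

/-- The variant of a rule under a renaming of the variables. -/
def rename (ρ : Equiv.Perm ℕ) (r : AnnRule L Q) : AnnRule L Q where
  name := r.name
  H1 := r.H1.map (UAtom.subst (fun x => FirstOrder.Language.Term.var (ρ x)))
  H2 := r.H2.map (UAtom.subst (fun x => FirstOrder.Language.Term.var (ρ x)))
  guard := conjSubst (fun x => FirstOrder.Language.Term.var (ρ x)) r.guard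
  body := r.body.map (IdAtom.subst (fun x => FirstOrder.Language.Term.var (ρ x)))
  bodyB := conjSubst (fun x => FirstOrder.Language.Term.var (ρ x)) r.bodyB
  tokens := r.tokens

/-- The conditions on an annotated rule: non-empty head; different occurrences of CHR constraints
in the body have different identifiers; identifiers are positive; tokens are proper. -/
def WF (r : AnnRule L Q) : Prop :=
  r.H1 ++ r.H2 ≠ [] ∧ (r.body.map IdAtom.id).Nodup ∧ (∀ k ∈ r.body, 0 < k.id) ∧
    ∀ t ∈ r.tokens, t.WF

end AnnRule

end Basic

/-- Configurations `⟨S, C, T⟩ₙ`.  The store `S` is split into its identified CHR constraints `chr`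
and its (not yet solved) built-in constraints `pend`. -/
structure Config (L : FirstOrder.Language.{u, v}) (Q : ℕ → Type w) where
  chr : Multiset (IdAtom L Q)
  pend : Multiset (Builtin L)
  store : Multiset (Builtin L)
  tokens : Finset Token
  counter : ℕ

namespace Config

variable {L : FirstOrder.Language.{u, v}} {Q : ℕ → Type w}

/-- The variables of the first component of a configuration. -/
def goalVars (σ : Config L Q) : Set ℕ := idAtomsVars σ.chr ∪ conjVars σ.pend

/-- The variables of a configuration. -/
def vars (σ : Config L Q) : Set ℕ := σ.goalVars ∪ conjVars σ.store

/-- Proper configurations: different constraints have different identifiers, and the counter is an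
upper bound of all the (positive) identifiers in use. -/
def WF (σ : Config L Q) : Prop :=
  (σ.chr.map IdAtom.id).Nodup ∧ (∀ k ∈ σ.chr, 0 < k.id ∧ k.id ≤ σ.counter) ∧
    ∀ t ∈ σ.tokens, t.WF ∧ ∀ i ∈ t.ids, i ≤ σ.counter

end Config

/-! Entailment.  The models of the theory `CT` are taken in the universe of the language, which by
the Löwenheim–Skolem theorem does not change the consequence relation. -/

section Logic

variable {L : FirstOrder.Language.{u, v}}

/-- `CT` contains Clark's equality theory: function symbols are injective, different function
symbols have disjoint ranges, and no variable equals a term that properly contains it. -/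
def ContainsClarkEquality (CT : L.Theory) : Prop :=
  ∀ M : FirstOrder.Language.Theory.ModelType.{u, v, max u v} CT,
    (∀ (n : ℕ) (f : L.Functions n) (x y : Fin n → M),
      FirstOrder.Language.Structure.funMap f x = FirstOrder.Language.Structure.funMap f y → x = y) ∧
    (∀ (n m : ℕ) (f : L.Functions n) (g : L.Functions m) (x : Fin n → M) (y : Fin m → M),
      (⟨n, f⟩ : Σ k, L.Functions k) ≠ ⟨m, g⟩ →
        FirstOrder.Language.Structure.funMap f x ≠ FirstOrder.Language.Structure.funMap g y) ∧
    (∀ (t : L.Term ℕ) (x : ℕ) (ν : ℕ → M),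
      x ∈ termVars t → t ≠ FirstOrder.Language.Term.var x → t.realize ν ≠ ν x)

/-- `CT ⊨ C → D`. -/
def Entails (CT : L.Theory) (C D : Multiset (Builtin L)) : Prop :=
  ∀ (M : FirstOrder.Language.Theory.ModelType.{u, v, max u v} CT) (ν : ℕ → M), Sat C ν → Sat D ν

/-- `CT ⊨ C → ∃_X D`. -/
def EntailsEx (CT : L.Theory) (C : Multiset (Builtin L)) (X : Set ℕ)
    (D : Multiset (Builtin L)) : Prop :=
  ∀ (M : FirstOrder.Language.Theory.ModelType.{u, v, max u v} CT) (ν : ℕ → M), Sat C ν →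
    ∃ ν' : ℕ → M, (∀ x, x ∉ X → ν' x = ν x) ∧ Sat D ν'

/-- `CT ⊨ ∃_X C ↔ ∃_Y D`. -/
def EquivEx (CT : L.Theory) (X : Set ℕ) (C : Multiset (Builtin L)) (Y : Set ℕ)
    (D : Multiset (Builtin L)) : Prop :=
  ∀ (M : FirstOrder.Language.Theory.ModelType.{u, v, max u v} CT) (ν : ℕ → M),
    (∃ ν' : ℕ → M, (∀ x, x ∉ X → ν' x = ν x) ∧ Sat C ν') ↔
      ∃ ν' : ℕ → M, (∀ x, x ∉ Y → ν' x = ν x) ∧ Sat D ν'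

/-- Satisfiability of a conjunction of built-in constraints: not `CT ⊨ C ↔ false`. -/
def Satisfiable (CT : L.Theory) (C : Multiset (Builtin L)) : Prop :=
  ∃ (M : FirstOrder.Language.Theory.ModelType.{u, v, max u v} CT) (ν : ℕ → M), Sat C ν

end Logic

/-! Operational semantics of annotated programs. -/

section Semantics

variable {L : FirstOrder.Language.{u, v}} {Q : ℕ → Type w}

/-- The transition **Solve'**.  Failed configurations are final. -/
inductive Solve (CT : L.Theory) : Config L Q → Config L Q → Prop
  | mk (c : Builtin L) (S : Multiset (IdAtom L Q)) (B C : Multiset (Builtin L))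
      (T : Finset Token) (n : ℕ) (nonfailed : Satisfiable CT C) :
      Solve CT ⟨S, c ::ₘ B, C, T, n⟩ ⟨S, B, c ::ₘ C, T, n⟩

/-- The transition **Apply'**, with a rule `r` of `P` whose variables have been renamed by `ρ` to
variables that do not occur in the configuration.  Failed configurations are final. -/
inductive Apply (CT : L.Theory) (P : Set (AnnRule L Q)) : Config L Q → Config L Q → Prop
  | mk (r₀ r : AnnRule L Q) (ρ : Equiv.Perm ℕ) (K1 K2 : List (IdAtom L Q))
      (S : Multiset (IdAtom L Q)) (B C : Multiset (Builtin L)) (T : Finset Token) (n : ℕ)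
      (nonfailed : Satisfiable CT C)
      (mem : r₀ ∈ P) (variant : r = r₀.rename ρ)
      (fresh : Disjoint r.vars
        (Config.mk ((K1 : Multiset (IdAtom L Q)) + (K2 : Multiset (IdAtom L Q)) + S) B C T n).vars)
      (sym1 : (chrOf K1).map UAtom.sym = r.H1.map UAtom.sym)
      (sym2 : (chrOf K2).map UAtom.sym = r.H2.map UAtom.sym)
      (guard : EntailsEx CT C r.vars (matchEqs (chrOf (K1 ++ K2)) (r.H1 ++ r.H2) + r.guard))
      (token : (⟨r.name, idsOf (K1 ++ K2)⟩ : Token) ∉ T) :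
      Apply CT P ⟨↑K1 + ↑K2 + S, B, C, T, n⟩
        ⟨(inst r.body r.tokens n).1 + ↑K1 + S,
          r.bodyB + B,
          matchEqs (chrOf (K1 ++ K2)) (r.H1 ++ r.H2) + r.guard + C,
          T ∪ {⟨r.name, idsOf (K1 ++ K2)⟩} ∪ (inst r.body r.tokens n).2.1,
          (inst r.body r.tokens n).2.2⟩

/-- The transition relation. -/
def Step (CT : L.Theory) (P : Set (AnnRule L Q)) (σ τ : Config L Q) : Prop :=
  Solve CT σ τ ∨ Apply CT P σ τ

/-- A transition that may occur in a normal derivation: **Apply'** is used only on built-in free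
configurations. -/
def NormalStep (CT : L.Theory) (P : Set (AnnRule L Q)) (σ τ : Config L Q) : Prop :=
  Solve CT σ τ ∨ (σ.pend = 0 ∧ Apply CT P σ τ)

/-- Normal termination: there are no infinite normal derivations. -/
def NormallyTerminating (CT : L.Theory) (P : Set (AnnRule L Q)) : Prop :=
  ¬ ∃ f : ℕ → Config L Q, (f 0).WF ∧ ∀ k, NormalStep CT P (f k) (f (k + 1))

/-- The substitution `[X/t]`. -/
def single (X : ℕ) (t : L.Term ℕ) : ℕ → L.Term ℕ := Function.update FirstOrder.Language.Term.var X t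

/-- The generators of the equivalence `≡_V` between configurations. -/
inductive EqvGenerator (CT : L.Theory) (V : Set ℕ) : Config L Q → Config L Q → Prop
  | solve (d : Builtin L) (S : Multiset (IdAtom L Q)) (B C : Multiset (Builtin L))
      (T : Finset Token) (n : ℕ) :
      EqvGenerator CT V ⟨S, d ::ₘ B, C, T, n⟩ ⟨S, B, d ::ₘ C, T, n⟩
  | bind (X : ℕ) (t : L.Term ℕ) (S : Multiset (IdAtom L Q)) (B C : Multiset (Builtin L))
      (T : Finset Token) (n : ℕ) :
      EqvGenerator CT V
        ⟨S, B, Builtin.eq (FirstOrder.Language.Term.var X) t ::ₘ C, T, n⟩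
        ⟨S.map (IdAtom.subst (single X t)), conjSubst (single X t) B,
          Builtin.eq (FirstOrder.Language.Term.var X) t ::ₘ C, T, n⟩
  | renameVar (X Y : ℕ) (σ : Config L Q) (hX : X ∉ V) (hY : Y ∉ V) (hYσ : Y ∉ σ.vars) :
      EqvGenerator CT V σ
        ⟨σ.chr.map (IdAtom.subst (single X (FirstOrder.Language.Term.var Y))),
          conjSubst (single X (FirstOrder.Language.Term.var Y)) σ.pend,
          conjSubst (single X (FirstOrder.Language.Term.var Y)) σ.store, σ.tokens, σ.counter⟩
  | store (σ : Config L Q) (C' : Multiset (Builtin L))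
      (h : EquivEx CT (conjVars σ.store \ (σ.goalVars ∪ V)) σ.store
        (conjVars C' \ (σ.goalVars ∪ V)) C') :
      EqvGenerator CT V σ ⟨σ.chr, σ.pend, C', σ.tokens, σ.counter⟩
  | failed (S S' : Multiset (IdAtom L Q)) (B B' : Multiset (Builtin L)) (T T' : Finset Token)
      (n m : ℕ) :
      EqvGenerator CT V ⟨S, B, {Builtin.ff}, T, n⟩ ⟨S', B', {Builtin.ff}, T', m⟩
  | renameId (σ : Config L Q) (ρ : Equiv.Perm ℕ) (m : ℕ) (hS : ∀ k ∈ σ.chr, ρ k.id ≤ m)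
      (hT : ∀ t ∈ σ.tokens, ∀ i ∈ t.ids, ρ i ≤ m) :
      EqvGenerator CT V σ
        ⟨σ.chr.map (IdAtom.mapId ρ), σ.pend, σ.store, σ.tokens.image (Token.mapId ρ), m⟩
  | clean (σ : Config L Q) :
      EqvGenerator CT V σ
        ⟨σ.chr, σ.pend, σ.store, CHR.clean σ.chr σ.tokens, σ.counter⟩

/-- The equivalence `≡_V` between configurations. -/
def Eqv (CT : L.Theory) (V : Set ℕ) : Config L Q → Config L Q → Prop :=
  Relation.EqvGen (EqvGenerator CT V)

/-- Confluence. -/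
def Confluent (CT : L.Theory) (P : Set (AnnRule L Q)) : Prop :=
  ∀ σ σ₁ σ₂ : Config L Q, σ.WF →
    Relation.ReflTransGen (Step CT P) σ σ₁ → Relation.ReflTransGen (Step CT P) σ σ₂ →
      ∃ τ₁ τ₂ : Config L Q, Relation.ReflTransGen (Step CT P) σ₁ τ₁ ∧
        Relation.ReflTransGen (Step CT P) σ₂ τ₂ ∧ Eqv CT σ.vars τ₁ τ₂

end Semantics

/-! Qualified answers. -/

section Answers

variable {L : FirstOrder.Language.{u, v}} {Q : ℕ → Type w}

/-- A goal: built-in constraints and (not identified) CHR constraints, the latter in the order in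
which the function `I` numbers them. -/
structure Goal (L : FirstOrder.Language.{u, v}) (Q : ℕ → Type w) where
  chr : List (UAtom L Q)
  builtin : Multiset (Builtin L)

/-- The free variables of a goal. -/
def Goal.vars (G : Goal L Q) : Set ℕ := atomsVars G.chr ∪ conjVars G.builtin

/-- The initial configuration `⟨I(G), true, ∅⟩ₘ`. -/
def Goal.init (G : Goal L Q) : Config L Q where
  chr := ↑(G.chr.zipIdx.map (fun p => (⟨p.1, p.2 + 1⟩ : IdAtom L Q)))
  pend := G.builtin
  store := {Builtin.tt}
  tokens := ∅
  counter := G.chr.length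

/-- The formula `∃_{-V} (chr ∧ store)`, where the set `V` is given by the context. -/
structure Answer (L : FirstOrder.Language.{u, v}) (Q : ℕ → Type w) where
  chr : Multiset (UAtom L Q)
  store : Multiset (Builtin L)

/-- Equivalence modulo `CT` of `∃_{-V} (K ∧ D)` and `∃_{-V} (K' ∧ D')`, where `K` and `K'` are
multisets: `K` and `K'` can be paired by a bijection such that paired constraints have the same
predicate symbol and `CT ⊨ D → ∃_{-V} (K = K' ∧ D')` and `CT ⊨ D' → ∃_{-V} (K = K' ∧ D)`,
where the quantifiers bind (renamed apart copies of) the variables of the second answer. -/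
def Answer.Equiv (CT : L.Theory) (V : Set ℕ) (a b : Answer L Q) : Prop :=
  ∃ l : Multiset (UAtom L Q × UAtom L Q), l.map Prod.fst = a.chr ∧ l.map Prod.snd = b.chr ∧
    (∀ p ∈ l, p.1.sym = p.2.sym) ∧
    ∀ M : FirstOrder.Language.Theory.ModelType.{u, v, max u v} CT,
      (∀ ν : ℕ → M, Sat a.store ν → ∃ ν' : ℕ → M, (∀ x ∈ V, ν' x = ν x) ∧ Sat b.store ν' ∧
        ∀ p ∈ l, p.1.eval ν = p.2.eval ν') ∧
      (∀ ν' : ℕ → M, Sat b.store ν' → ∃ ν : ℕ → M, (∀ x ∈ V, ν x = ν' x) ∧ Sat a.store ν ∧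
        ∀ p ∈ l, p.1.eval ν = p.2.eval ν')

theorem exists_glue {α β γ : Type*} (l : Multiset (α × β)) :
    ∀ l' : Multiset (β × γ), l.map Prod.snd = l'.map Prod.fst →
      ∃ t : Multiset (α × β × γ), t.map (fun p => (p.1, p.2.1)) = l ∧ t.map Prod.snd = l' := by
  classical
  induction l using Multiset.induction_on with
  | empty =>
    intro l' h
    have h0 : l' = 0 := by simpa using h.symm
    exact ⟨0, by simp, by simp [h0]⟩
  | cons p l ih =>
    intro l' h
    rw [Multiset.map_cons] at h
    have hm : p.2 ∈ l'.map Prod.fst := h ▸ Multiset.mem_cons_self _ _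
    obtain ⟨q, hq, hqp⟩ := Multiset.mem_map.1 hm
    obtain ⟨l'', rfl⟩ := Multiset.exists_cons_of_mem hq
    rw [Multiset.map_cons, hqp] at h
    obtain ⟨t, h1, h2⟩ := ih l'' ((Multiset.cons_inj_right _).1 h)
    refine ⟨(p.1, q) ::ₘ t, ?_, ?_⟩
    · simp [h1, hqp]
    · simp [h2]

theorem Answer.Equiv.refl (CT : L.Theory) (V : Set ℕ) (a : Answer L Q) :
    Answer.Equiv CT V a a := by
  refine ⟨a.chr.map (fun h => (h, h)), by simp, by simp, ?_, fun M => ⟨?_, ?_⟩⟩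
  · intro p hp
    obtain ⟨h, _, rfl⟩ := Multiset.mem_map.1 hp
    rfl
  · intro ν hν
    refine ⟨ν, fun _ _ => rfl, hν, fun p hp => ?_⟩
    obtain ⟨h, _, rfl⟩ := Multiset.mem_map.1 hp
    rfl
  · intro ν hν
    refine ⟨ν, fun _ _ => rfl, hν, fun p hp => ?_⟩
    obtain ⟨h, _, rfl⟩ := Multiset.mem_map.1 hp
    rfl

theorem Answer.Equiv.symm {CT : L.Theory} {V : Set ℕ} {a b : Answer L Q}
    (h : Answer.Equiv CT V a b) : Answer.Equiv CT V b a := by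
  obtain ⟨l, h1, h2, h3, h4⟩ := h
  refine ⟨l.map Prod.swap, by simp [Multiset.map_map, h2], by simp [Multiset.map_map, h1],
    ?_, fun M => ⟨?_, ?_⟩⟩
  · intro p hp
    obtain ⟨q, hq, rfl⟩ := Multiset.mem_map.1 hp
    exact (h3 q hq).symm
  · intro ν hν
    obtain ⟨ν', e1, e2, e3⟩ := (h4 M).2 ν hν
    refine ⟨ν', e1, e2, fun p hp => ?_⟩
    obtain ⟨q, hq, rfl⟩ := Multiset.mem_map.1 hp
    exact (e3 q hq).symm
  · intro ν hν
    obtain ⟨ν', e1, e2, e3⟩ := (h4 M).1 ν hν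
    refine ⟨ν', e1, e2, fun p hp => ?_⟩
    obtain ⟨q, hq, rfl⟩ := Multiset.mem_map.1 hp
    exact (e3 q hq).symm

theorem Answer.Equiv.trans {CT : L.Theory} {V : Set ℕ} {a b c : Answer L Q}
    (h : Answer.Equiv CT V a b) (h' : Answer.Equiv CT V b c) : Answer.Equiv CT V a c := by
  obtain ⟨l, h1, h2, h3, h4⟩ := h
  obtain ⟨l', h1', h2', h3', h4'⟩ := h'
  obtain ⟨t, rfl, rfl⟩ := exists_glue l l' (h2.trans h1'.symm)
  rw [Multiset.map_map] at h1 h2'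
  refine ⟨t.map (fun p => (p.1, p.2.2)), ?_, ?_, ?_, fun M => ⟨?_, ?_⟩⟩
  · rw [Multiset.map_map]; exact h1
  · rw [Multiset.map_map]; exact h2'
  · intro p hp
    obtain ⟨q, hq, rfl⟩ := Multiset.mem_map.1 hp
    exact (h3 _ (Multiset.mem_map_of_mem _ hq)).trans (h3' _ (Multiset.mem_map_of_mem _ hq))
  · intro ν hν
    obtain ⟨ν₁, e1, e2, e3⟩ := (h4 M).1 ν hν
    obtain ⟨ν₂, f1, f2, f3⟩ := (h4' M).1 ν₁ e2
    refine ⟨ν₂, fun x hx => (f1 x hx).trans (e1 x hx), f2, fun p hp => ?_⟩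
    obtain ⟨q, hq, rfl⟩ := Multiset.mem_map.1 hp
    exact (e3 _ (Multiset.mem_map_of_mem _ hq)).trans (f3 _ (Multiset.mem_map_of_mem _ hq))
  · intro ν hν
    obtain ⟨ν₁, e1, e2, e3⟩ := (h4' M).2 ν hν
    obtain ⟨ν₂, f1, f2, f3⟩ := (h4 M).2 ν₁ e2
    refine ⟨ν₂, fun x hx => (f1 x hx).trans (e1 x hx), f2, fun p hp => ?_⟩
    obtain ⟨q, hq, rfl⟩ := Multiset.mem_map.1 hp
    exact (f3 _ (Multiset.mem_map_of_mem _ hq)).trans (e3 _ (Multiset.mem_map_of_mem _ hq))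

/-- Answers up to equivalence modulo `CT`. -/
def answerSetoid (CT : L.Theory) (Q : ℕ → Type w) (V : Set ℕ) : Setoid (Answer L Q) where
  r := Answer.Equiv CT V
  iseqv := ⟨Answer.Equiv.refl CT V, Answer.Equiv.symm, Answer.Equiv.trans⟩

/-- The set of qualified answers of the goal `G` in the annotated program `P`. -/
def QualifiedAnswers (CT : L.Theory) (P : Set (AnnRule L Q)) (G : Goal L Q) :
    Set (Quotient (answerSetoid CT Q G.vars)) :=
  {q | ∃ τ : Config L Q, Relation.ReflTransGen (Step CT P) G.init τ ∧
    (∀ τ', ¬ Step CT P τ τ') ∧ Satisfiable CT τ.store ∧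
    q = Quotient.mk (answerSetoid CT Q G.vars) ⟨τ.chr.map IdAtom.atom, τ.store⟩}

end Answers

/-! Unfolding. -/

section Unfolding

variable {L : FirstOrder.Language.{u, v}} {Q : ℕ → Type w}

open Classical in
/-- The part of the guard `D'` which, after application of `θ`, is not entailed by `E`. -/
noncomputable def residualGuard (CT : L.Theory) (E : Multiset (Builtin L)) (θ : ℕ → L.Term ℕ)
    (D' : Multiset (Builtin L)) : Multiset (Builtin L) :=
  D'.filter (fun d => ¬ Entails CT E {d.subst θ})

/-- The rule obtained by unfolding `r`, with body `K, S1, S2` and built-in constraints, with `v`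
(renamed apart), where `θ` is the matching substitution. -/
noncomputable def unfoldedRule (CT : L.Theory) (r v : AnnRule L Q) (θ : ℕ → L.Term ℕ)
    (K : Multiset (IdAtom L Q)) (S1 S2 : List (IdAtom L Q)) : AnnRule L Q where
  name := r.name
  H1 := r.H1
  H2 := r.H2
  guard := r.guard + conjSubst θ (residualGuard CT (r.bodyB + r.guard) θ v.guard)
  body := K + ↑S1 + (inst v.body v.tokens (maxId r.body r.tokens)).1
  bodyB := v.bodyB + r.bodyB + matchEqs (chrOf (S1 ++ S2)) (v.H1 ++ v.H2)
  tokens :=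
    if v.H2.isEmpty then
      r.tokens ∪ (inst v.body v.tokens (maxId r.body r.tokens)).2.1 ∪ {⟨v.name, idsOf S1⟩}
    else
      clean (K + ↑S1) r.tokens ∪ (inst v.body v.tokens (maxId r.body r.tokens)).2.1

/-- `r'` is an unfolding of `r` with (a variant `v` of) `v₀`, using the identified atoms `S1, S2`
of the body of `r`. -/
def IsUnfolding (CT : L.Theory) (r v₀ : AnnRule L Q) (S1 S2 : List (IdAtom L Q))
    (r' : AnnRule L Q) : Prop :=
  ∃ (ρ : Equiv.Perm ℕ) (v : AnnRule L Q) (θ : ℕ → L.Term ℕ) (K : Multiset (IdAtom L Q)),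
    v = v₀.rename ρ ∧ Disjoint r.vars v.vars ∧
    r.body = K + ↑S1 + ↑S2 ∧
    (chrOf S1).map UAtom.sym = v.H1.map UAtom.sym ∧
    (chrOf S2).map UAtom.sym = v.H2.map UAtom.sym ∧
    (∀ x, (θ x).subst θ = θ x) ∧
    (∀ x, θ x ≠ FirstOrder.Language.Term.var x → x ∈ v.headVars) ∧
    Entails CT (r.bodyB + r.guard)
      (matchEqs (chrOf (S1 ++ S2)) ((v.H1 ++ v.H2).map (UAtom.subst θ))) ∧
    (⟨v.name, idsOf (S1 ++ S2)⟩ : Token) ∉ r.tokens ∧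
    conjVars (conjSubst θ (residualGuard CT (r.bodyB + r.guard) θ v.guard)) ∩
      atomsVars ((v.H1 ++ v.H2).map (UAtom.subst θ)) ⊆ r.headVars ∧
    Satisfiable CT
      (r.guard + conjSubst θ (residualGuard CT (r.bodyB + r.guard) θ v.guard)) ∧
    r' = unfoldedRule CT r v θ K S1 S2

/-- `U` is a set `Unf_P(cl)`: it consists of unfoldings of `cl` with rules of `P`, and for every
rule `v` of `P` and all identified atoms in the body of `cl` such that `cl` can be unfolded with
`v` by using these atoms, it contains a corresponding unfolded rule (at least one: the choice of
the renaming and of the matching substitution is arbitrary). -/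
def IsUnf (CT : L.Theory) (P : Set (AnnRule L Q)) (cl : AnnRule L Q)
    (U : Set (AnnRule L Q)) : Prop :=
  (∀ r ∈ U, ∃ v ∈ P, ∃ S1 S2, IsUnfolding CT cl v S1 S2 r) ∧
  ∀ v ∈ P, ∀ S1 S2 r, IsUnfolding CT cl v S1 S2 r → ∃ r' ∈ U, IsUnfolding CT cl v S1 S2 r'

/-- `cl` can be weakly safely replaced in `P`: some unfolding of `cl` in `P` has a guard that is
equivalent to that of `cl`. -/
def WeaklySafelyReplaceable (CT : L.Theory) (P : Set (AnnRule L Q)) (cl : AnnRule L Q) : Prop :=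
  cl ∈ P ∧ ∃ v ∈ P, ∃ S1 S2 r, IsUnfolding CT cl v S1 S2 r ∧
    Entails CT cl.guard r.guard ∧ Entails CT r.guard cl.guard

end Unfolding

end CHR

/-! The proof simulates each non-failing derivation of the new program by a derivation of `P` in
which all built-in constraints are solved before the next rule is applied. Two configurations are
similar (`Sim`) if their CHR constraints can be paired so that tokens of live constraints correspond
and every solution of the built-in constraints of one side gives a solution of the other with the
same values on `V` and on the paired constraints. Solving is invisible to this relation, and a rule
applicable on one side is applicable on the other as soon as the latter is solved and satisfiable
(`Sim.fire`).

An application of an unfolded rule is matched by applying `cl`, solving, and applying `v₀`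
(`UnfoldingData.exists_normal`). This works for two reasons. By Clark's axioms the equations put
into the unfolded body force the matching substitution to act as the identity on values, so the
built-in constraints on both sides say the same (`sat_unfoldedRule`). By the variable condition on
unfoldings, the residual guard meets the variables of `cl` only in its head, where the values are
fixed by the matched constraints, so the guard tested in advance still holds after `cl` has been
applied (`exists_sat_guard`). Differences between the token sets concern only constraints that have
been consumed.

Final configurations also correspond (`Simulates.final`). If a rule of `P` were applicable to the
simulating configuration, it would be applicable to the simulated one; if that rule is `cl`, weak
safeness supplies an unfolding with an equivalent guard. Its residual guard is then empty for every
choice of variant and matching substitution (`residualGuard_eq_zero`), so the corresponding rule in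
the new program has the same name, head and guard as `cl`.

Hence every answer of the new program is an answer of `P`. Conversely, suppose that `P` has an
answer for `G`. By confluence no derivation of `P` from `G` fails. Each rule application in the new
program costs at least one normal step of `P`, so normal termination yields a final configuration of
the new program together with a final one of `P` that simulates it (`Simulates.exists_final`).
Confluence identifies the latter with the given answer, because the equivalence of configurations
preserves answers (`Eqv.answerEqv`). -/

namespace CHR

/-! ### Variables, substitutions and valuations -/

section Valuations

variable {L : FirstOrder.Language.{u, v}} {Q : ℕ → Type w}

theorem mem_termVars_var {x y : ℕ} :
    x ∈ termVars (FirstOrder.Language.Term.var y : L.Term ℕ) ↔ x = y := by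
  simp [termVars, FirstOrder.Language.Term.varFinset]

theorem mem_termVars_func {n : ℕ} {f : L.Functions n} {ts : Fin n → L.Term ℕ} {x : ℕ} :
    x ∈ termVars (FirstOrder.Language.Term.func f ts) ↔ ∃ i, x ∈ termVars (ts i) := by
  simp [termVars, FirstOrder.Language.Term.varFinset]

theorem mem_termVars_subst {θ : ℕ → L.Term ℕ} {t : L.Term ℕ} {z : ℕ} :
    z ∈ termVars (t.subst θ) ↔ ∃ x ∈ termVars t, z ∈ termVars (θ x) := by
  induction t with
  | var y => simp [FirstOrder.Language.Term.subst, mem_termVars_var]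
  | func f ts ih =>
    simp only [FirstOrder.Language.Term.subst, mem_termVars_func, ih]
    constructor
    · rintro ⟨i, x, h, h'⟩; exact ⟨x, ⟨i, h⟩, h'⟩
    · rintro ⟨x, ⟨i, h⟩, h'⟩; exact ⟨i, x, h, h'⟩

theorem Builtin.mem_vars_subst {θ : ℕ → L.Term ℕ} {c : Builtin L} {z : ℕ} :
    z ∈ (c.subst θ).vars ↔ ∃ x ∈ c.vars, z ∈ termVars (θ x) := by
  cases c with
  | tt => simp [Builtin.subst, Builtin.vars]
  | ff => simp [Builtin.subst, Builtin.vars]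
  | eq s t =>
    simp only [Builtin.subst, Builtin.vars, Set.mem_union, mem_termVars_subst]
    grind
  | rel R ts =>
    simp only [Builtin.subst, Builtin.vars, Set.mem_ofPred_eq, mem_termVars_subst]
    grind

theorem UAtom.mem_vars_subst {θ : ℕ → L.Term ℕ} {h : UAtom L Q} {z : ℕ} :
    z ∈ (h.subst θ).vars ↔ ∃ x ∈ h.vars, z ∈ termVars (θ x) := by
  simp only [UAtom.subst, UAtom.vars, Set.mem_ofPred_eq, mem_termVars_subst]
  grind

theorem mem_conjVars_subst {θ : ℕ → L.Term ℕ} {C : Multiset (Builtin L)} {z : ℕ} :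
    z ∈ conjVars (conjSubst θ C) ↔ ∃ x ∈ conjVars C, z ∈ termVars (θ x) := by
  simp only [conjVars, conjSubst, Set.mem_ofPred_eq, Multiset.mem_map]
  constructor
  · rintro ⟨c, ⟨d, hd, rfl⟩, hz⟩
    obtain ⟨x, hx, hz⟩ := Builtin.mem_vars_subst.1 hz
    exact ⟨x, ⟨d, hd, hx⟩, hz⟩
  · rintro ⟨x, ⟨d, hd, hx⟩, hz⟩
    exact ⟨_, ⟨d, hd, rfl⟩, Builtin.mem_vars_subst.2 ⟨x, hx, hz⟩⟩

theorem mem_atomsVars_subst {θ : ℕ → L.Term ℕ} {hs : List (UAtom L Q)} {z : ℕ} :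
    z ∈ atomsVars (hs.map (UAtom.subst θ)) ↔ ∃ x ∈ atomsVars hs, z ∈ termVars (θ x) := by
  simp only [atomsVars, Set.mem_ofPred_eq, List.mem_map]
  constructor
  · rintro ⟨c, ⟨d, hd, rfl⟩, hz⟩
    obtain ⟨x, hx, hz⟩ := UAtom.mem_vars_subst.1 hz
    exact ⟨x, ⟨d, hd, hx⟩, hz⟩
  · rintro ⟨x, ⟨d, hd, hx⟩, hz⟩
    exact ⟨_, ⟨d, hd, rfl⟩, UAtom.mem_vars_subst.2 ⟨x, hx, hz⟩⟩

theorem mem_idAtomsVars_subst {θ : ℕ → L.Term ℕ} {B : Multiset (IdAtom L Q)} {z : ℕ} :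
    z ∈ idAtomsVars (B.map (IdAtom.subst θ)) ↔ ∃ x ∈ idAtomsVars B, z ∈ termVars (θ x) := by
  simp only [idAtomsVars, Set.mem_ofPred_eq, Multiset.mem_map]
  constructor
  · rintro ⟨c, ⟨d, hd, rfl⟩, hz⟩
    obtain ⟨x, hx, hz⟩ := UAtom.mem_vars_subst.1 hz
    exact ⟨x, ⟨d, hd, hx⟩, hz⟩
  · rintro ⟨x, ⟨d, hd, hx⟩, hz⟩
    exact ⟨_, ⟨d, hd, rfl⟩, UAtom.mem_vars_subst.2 ⟨x, hx, hz⟩⟩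

/-- The variables of a variant. -/
theorem AnnRule.vars_rename (ρ : Equiv.Perm ℕ) (r : AnnRule L Q) :
    (r.rename ρ).vars = ρ '' r.vars := by
  ext z
  simp only [AnnRule.vars, AnnRule.headVars, AnnRule.rename, ← List.map_append, Set.mem_union,
    mem_atomsVars_subst, mem_conjVars_subst, mem_idAtomsVars_subst, mem_termVars_var, Set.mem_image]
  grind

theorem AnnRule.headVars_rename (ρ : Equiv.Perm ℕ) (r : AnnRule L Q) :
    (r.rename ρ).headVars = ρ '' r.headVars := by
  ext z
  simp only [AnnRule.headVars, AnnRule.rename, ← List.map_append,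
    mem_atomsVars_subst, mem_termVars_var, Set.mem_image]
  grind

/-! Finiteness of the sets of variables. -/

theorem finite_termVars (t : L.Term ℕ) : (termVars t).Finite :=
  t.varFinset.finite_toSet

theorem Builtin.finite_vars (c : Builtin L) : c.vars.Finite := by
  cases c with
  | tt => exact Set.finite_empty
  | ff => exact Set.finite_empty
  | eq s t => exact (finite_termVars s).union (finite_termVars t)
  | rel R ts =>
    have : (Builtin.rel R ts).vars = ⋃ i, termVars (ts i) := by ext; simp [Builtin.vars]
    rw [this]
    exact Set.finite_iUnion fun i => finite_termVars _

theorem UAtom.finite_vars (h : UAtom L Q) : h.vars.Finite := by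
  have : h.vars = ⋃ i, termVars (h.args i) := by ext; simp [UAtom.vars]
  rw [this]
  exact Set.finite_iUnion fun i => finite_termVars _

theorem finite_conjVars (C : Multiset (Builtin L)) : (conjVars C).Finite := by
  classical
  refine (C.toFinset.finite_toSet.biUnion fun c _ => c.finite_vars).subset fun x hx => ?_
  obtain ⟨c, hc, hx⟩ := hx
  exact Set.mem_biUnion (by simpa using hc) hx

theorem finite_atomsVars (hs : List (UAtom L Q)) : (atomsVars hs).Finite := by
  classical
  refine (hs.toFinset.finite_toSet.biUnion fun c _ => c.finite_vars).subset fun x hx => ?_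
  obtain ⟨c, hc, hx⟩ := hx
  exact Set.mem_biUnion (by simpa using hc) hx

theorem finite_idAtomsVars (B : Multiset (IdAtom L Q)) : (idAtomsVars B).Finite := by
  classical
  refine (B.toFinset.finite_toSet.biUnion fun c _ => c.atom.finite_vars).subset fun x hx => ?_
  obtain ⟨c, hc, hx⟩ := hx
  exact Set.mem_biUnion (by simpa using hc) hx

theorem AnnRule.finite_vars (r : AnnRule L Q) : r.vars.Finite :=
  (((finite_atomsVars _).union (finite_conjVars _)).union (finite_idAtomsVars _)).union
    (finite_conjVars _)

theorem Config.finite_vars (σ : Config L Q) : σ.vars.Finite :=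
  ((finite_idAtomsVars _).union (finite_conjVars _)).union (finite_conjVars _)

theorem exists_perm_disjoint {A B : Set ℕ} (hA : A.Finite) (hB : B.Finite) :
    ∃ ρ : Equiv.Perm ℕ, Disjoint (ρ '' A) B := by
  obtain ⟨N, hN⟩ := (hA.union hB).bddAbove
  -- An involution exchanging the intervals `[0, N]` and `[N + 1, 2N + 1]`: it moves every element
  -- of `A` above the common bound `N`.
  let f : ℕ → ℕ := fun x => if x ≤ N then x + (N + 1) else if x ≤ 2 * N + 1 then x - (N + 1) else x
  have hf : Function.Involutive f := by
    intro x
    simp only [f]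
    split_ifs <;> omega
  refine ⟨hf.toPerm, Set.disjoint_left.2 ?_⟩
  rintro _ ⟨x, hx, rfl⟩ hB'
  have h1 : x ≤ N := hN (Or.inl hx)
  have h2 : f x ≤ N := hN (Or.inr hB')
  simp only [f, if_pos h1] at h2
  omega

/-- Every rule has a variant whose variables do not occur in a given configuration. -/
theorem AnnRule.exists_fresh (r : AnnRule L Q) (σ : Config L Q) :
    ∃ ρ : Equiv.Perm ℕ, Disjoint (r.rename ρ).vars σ.vars := by
  simp only [AnnRule.vars_rename]
  exact exists_perm_disjoint r.finite_vars σ.finite_vars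

/-! Evaluation. -/

variable {M : Type*} [L.Structure M]

theorem realize_congr {t : L.Term ℕ} {ν ν' : ℕ → M} (h : ∀ x ∈ termVars t, ν x = ν' x) :
    t.realize ν = t.realize ν' := by
  induction t with
  | var y => exact h y (mem_termVars_var.2 rfl)
  | func f ts ih =>
    simp only [FirstOrder.Language.Term.realize]
    congr 1
    funext i
    exact ih i fun x hx => h x (mem_termVars_func.2 ⟨i, hx⟩)

theorem Builtin.holds_congr {c : Builtin L} {ν ν' : ℕ → M} (h : ∀ x ∈ c.vars, ν x = ν' x) :
    c.Holds ν ↔ c.Holds ν' := by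
  cases c with
  | tt => rfl
  | ff => rfl
  | eq s t =>
    simp only [Builtin.Holds]
    rw [realize_congr (t := s) fun x hx => h x (Or.inl hx),
      realize_congr (t := t) fun x hx => h x (Or.inr hx)]
  | rel R ts =>
    simp only [Builtin.Holds]
    rw [funext fun i => realize_congr (t := ts i) fun x hx => h x ⟨i, hx⟩]

theorem sat_congr {C : Multiset (Builtin L)} {ν ν' : ℕ → M} (h : ∀ x ∈ conjVars C, ν x = ν' x) :
    Sat C ν ↔ Sat C ν' :=
  forall₂_congr fun c hc => Builtin.holds_congr fun x hx => h x ⟨c, hc, hx⟩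

theorem UAtom.eval_eq (h : UAtom L Q) (ν : ℕ → M) :
    h.eval ν = List.ofFn fun i => (h.args i).realize ν := by
  simp [UAtom.eval, UAtom.argList, List.map_ofFn, Function.comp_def]

theorem UAtom.eval_congr {h : UAtom L Q} {ν ν' : ℕ → M} (hν : ∀ x ∈ h.vars, ν x = ν' x) :
    h.eval ν = h.eval ν' := by
  rw [UAtom.eval_eq, UAtom.eval_eq]
  congr 1
  funext i
  exact realize_congr fun x hx => hν x ⟨i, hx⟩

theorem map_eval_congr {hs : List (UAtom L Q)} {ν ν' : ℕ → M}
    (hν : ∀ x ∈ atomsVars hs, ν x = ν' x) :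
    hs.map (UAtom.eval ν) = hs.map (UAtom.eval ν') :=
  List.map_congr_left fun h hh => UAtom.eval_congr fun x hx => hν x ⟨h, hh, hx⟩

theorem Builtin.holds_subst {θ : ℕ → L.Term ℕ} {c : Builtin L} {ν : ℕ → M} :
    (c.subst θ).Holds ν ↔ c.Holds fun x => (θ x).realize ν := by
  cases c <;> simp [Builtin.subst, Builtin.Holds]

theorem sat_subst {θ : ℕ → L.Term ℕ} {C : Multiset (Builtin L)} {ν : ℕ → M} :
    Sat (conjSubst θ C) ν ↔ Sat C fun x => (θ x).realize ν := by
  simp [Sat, conjSubst, Builtin.holds_subst]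

theorem UAtom.eval_subst {θ : ℕ → L.Term ℕ} {h : UAtom L Q} {ν : ℕ → M} :
    (h.subst θ).eval ν = h.eval fun x => (θ x).realize ν := by
  simp [UAtom.eval_eq, UAtom.subst]

theorem map_eval_subst {θ : ℕ → L.Term ℕ} {hs : List (UAtom L Q)} {ν : ℕ → M} :
    (hs.map (UAtom.subst θ)).map (UAtom.eval ν) =
      hs.map (UAtom.eval fun x => (θ x).realize ν) := by
  simp [UAtom.eval_subst]

@[simp] theorem UAtom.sym_subst (θ : ℕ → L.Term ℕ) (h : UAtom L Q) : (h.subst θ).sym = h.sym := rfl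

theorem map_sym_subst (θ : ℕ → L.Term ℕ) (hs : List (UAtom L Q)) :
    (hs.map (UAtom.subst θ)).map UAtom.sym = hs.map UAtom.sym := by simp

@[simp] theorem sat_add {C D : Multiset (Builtin L)} {ν : ℕ → M} :
    Sat (C + D) ν ↔ Sat C ν ∧ Sat D ν := by
  simp [Sat, or_imp, forall_and]

@[simp] theorem sat_cons {c : Builtin L} {C : Multiset (Builtin L)} {ν : ℕ → M} :
    Sat (c ::ₘ C) ν ↔ c.Holds ν ∧ Sat C ν := by
  simp [Sat]

@[simp] theorem sat_singleton {c : Builtin L} {ν : ℕ → M} :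
    Sat ({c} : Multiset (Builtin L)) ν ↔ c.Holds ν := by
  simp [Sat]

theorem forall_zipWith_eq_holds {s t : List (L.Term ℕ)} (h : s.length = t.length) {ν : ℕ → M} :
    (∀ c ∈ List.zipWith Builtin.eq s t, c.Holds ν) ↔
      s.map (fun t => t.realize ν) = t.map (fun t => t.realize ν) := by
  induction s generalizing t with
  | nil => cases t <;> simp_all
  | cons a s ih =>
    cases t with
    | nil => simp at h
    | cons b t =>
      simp only [List.length_cons, Nat.add_right_cancel_iff] at h
      rw [List.zipWith_cons_cons, List.forall_mem_cons, ih h]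
      simp [Builtin.Holds]

theorem sat_matchEqs {hs hs' : List (UAtom L Q)} (h : hs.map UAtom.sym = hs'.map UAtom.sym)
    {ν : ℕ → M} :
    Sat (matchEqs hs hs') ν ↔ hs.map (UAtom.eval ν) = hs'.map (UAtom.eval ν) := by
  induction hs generalizing hs' with
  | nil => cases hs' <;> simp_all [matchEqs, Sat]
  | cons a hs ih =>
    cases hs' with
    | nil => simp at h
    | cons b hs' =>
      simp only [List.map_cons, List.cons.injEq] at h
      have hlen : a.argList.length = b.argList.length := by
        have := congrArg Sigma.fst h.1
        simpa [UAtom.argList, UAtom.sym] using this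
      have := ih h.2
      simp only [Sat, matchEqs, Multiset.mem_coe] at this
      simp only [Sat, matchEqs, List.zipWith_cons_cons, List.flatten_cons, Multiset.mem_coe,
        List.mem_append, or_imp, forall_and, this, forall_zipWith_eq_holds hlen, List.map_cons,
        List.cons.injEq, UAtom.eval]

theorem mem_conjVars_zipWith_eq {s t : List (L.Term ℕ)} (h : s.length = t.length) {x : ℕ} :
    (∃ a ∈ s, x ∈ termVars a) → ∃ c ∈ List.zipWith Builtin.eq s t, x ∈ c.vars := by
  induction s generalizing t with
  | nil => simp
  | cons a s ih =>
    cases t with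
    | nil => simp at h
    | cons b t =>
      simp only [List.length_cons, Nat.add_right_cancel_iff] at h
      simp only [List.mem_cons, List.zipWith_cons_cons]
      rintro ⟨c, rfl | hc, hx⟩
      · exact ⟨_, Or.inl rfl, Or.inl hx⟩
      · obtain ⟨d, hd, hx⟩ := ih h ⟨c, hc, hx⟩
        exact ⟨d, Or.inr hd, hx⟩

/-- Constraints consumed by a rule leave their variables behind in the matching equations. This is
why no variable ever disappears from a configuration. -/
theorem atomsVars_subset_matchEqs {hs hs' : List (UAtom L Q)}
    (h : hs.map UAtom.sym = hs'.map UAtom.sym) : atomsVars hs ⊆ conjVars (matchEqs hs hs') := by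
  induction hs generalizing hs' with
  | nil => rintro x ⟨_, h, _⟩; simp at h
  | cons a hs ih =>
    cases hs' with
    | nil => simp at h
    | cons b hs' =>
      simp only [List.map_cons, List.cons.injEq] at h
      have hlen : a.argList.length = b.argList.length := by
        have := congrArg Sigma.fst h.1
        simpa [UAtom.argList, UAtom.sym] using this
      rintro x ⟨k, hk, hx⟩
      rcases List.mem_cons.1 hk with rfl | hk
      · obtain ⟨i, hi⟩ := hx
        obtain ⟨c, hc, hx⟩ := mem_conjVars_zipWith_eq hlen
          ⟨k.args i, by simp [UAtom.argList, List.mem_ofFn], hi⟩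
        exact ⟨c, by simp [matchEqs, hc], hx⟩
      · obtain ⟨c, hc, hx⟩ := ih h.2 ⟨k, hk, hx⟩
        refine ⟨c, ?_, hx⟩
        simp only [matchEqs, Multiset.mem_coe] at hc
        simp [matchEqs, hc]

/-- Under Clark's equality theory the value of a term determines the values of its variables. -/
theorem ContainsClarkEquality.eq_of_realize_eq {CT : L.Theory} (hCT : ContainsClarkEquality CT)
    (M : FirstOrder.Language.Theory.ModelType.{u, v, max u v} CT) {t : L.Term ℕ} {ν ν' : ℕ → M}
    (h : t.realize ν = t.realize ν') : ∀ x ∈ termVars t, ν x = ν' x := by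
  induction t with
  | var y =>
    intro x hx
    rw [mem_termVars_var.1 hx]
    exact h
  | func f ts ih =>
    intro x hx
    obtain ⟨i, hi⟩ := mem_termVars_func.1 hx
    exact ih i (congrFun ((hCT M).1 _ f _ _ h) i) x hi

/-- Matching a head therefore fixes the values of its variables: two valuations that match it with
the same constraints can differ only on variables that do not occur in the head. -/
theorem ContainsClarkEquality.eq_of_eval_eq {CT : L.Theory} (hCT : ContainsClarkEquality CT)
    (M : FirstOrder.Language.Theory.ModelType.{u, v, max u v} CT) {hs : List (UAtom L Q)}
    {ν ν' : ℕ → M} (h : hs.map (UAtom.eval ν) = hs.map (UAtom.eval ν')) :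
    ∀ x ∈ atomsVars hs, ν x = ν' x := by
  rintro x ⟨a, ha, i, hx⟩
  have h1 := List.map_inj_left.1 h a ha
  rw [UAtom.eval_eq, UAtom.eval_eq] at h1
  exact hCT.eq_of_realize_eq M (congrFun (List.ofFn_injective h1) i) x hx

/-- The valuation that equals `μ` on `A` and `ν` elsewhere. -/
noncomputable def merge (A : Set ℕ) (μ ν : ℕ → M) : ℕ → M :=
  open Classical in fun x => if x ∈ A then μ x else ν x

theorem merge_of_mem {A : Set ℕ} {μ ν : ℕ → M} {x : ℕ} (h : x ∈ A) : merge A μ ν x = μ x :=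
  if_pos h

theorem merge_of_notMem {A : Set ℕ} {μ ν : ℕ → M} {x : ℕ} (h : x ∉ A) : merge A μ ν x = ν x :=
  if_neg h

end Valuations
-- Rule application, expressed semantically and without variants
section Firing

variable {L : FirstOrder.Language.{u, v}} {Q : ℕ → Type w}

/-! Identifiers. -/

theorem id_le_maxId {B : Multiset (IdAtom L Q)} {T : Finset Token} {k : IdAtom L Q} (hk : k ∈ B) :
    k.id ≤ maxId B T :=
  le_max_of_le_left (Multiset.le_sup (Multiset.mem_map_of_mem _ hk))

theorem le_foldr_max {l : List ℕ} {i : ℕ} (h : i ∈ l) : i ≤ l.foldr max 0 := by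
  induction l with
  | nil => simp at h
  | cons a l ih =>
    rcases List.mem_cons.1 h with rfl | h
    · exact le_max_left _ _
    · exact (ih h).trans (le_max_right _ _)

theorem token_id_le_maxId {B : Multiset (IdAtom L Q)} {T : Finset Token} {t : Token} (ht : t ∈ T)
    {i : ℕ} (hi : i ∈ t.ids) : i ≤ maxId B T :=
  le_max_of_le_right ((le_foldr_max hi).trans (Finset.le_sup (f := fun t => t.ids.foldr max 0) ht))

@[simp] theorem AnnRule.maxId_rename (ρ : Equiv.Perm ℕ) (r : AnnRule L Q) :
    maxId (r.rename ρ).body (r.rename ρ).tokens = maxId r.body r.tokens := by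
  simp [maxId, AnnRule.rename, Multiset.map_map, Function.comp_def, IdAtom.subst]

theorem AnnRule.WF.rename {r : AnnRule L Q} (h : r.WF) (ρ : Equiv.Perm ℕ) : (r.rename ρ).WF := by
  obtain ⟨h1, h2, h3, h4⟩ := h
  refine ⟨?_, ?_, ?_, h4⟩
  · simpa [AnnRule.rename] using h1
  · simpa [AnnRule.rename, Multiset.map_map, Function.comp_def, IdAtom.subst] using h2
  · intro k hk
    obtain ⟨k', hk', rfl⟩ := Multiset.mem_map.1 hk
    exact h3 k' hk'

/-- All built-in constraints of a configuration. -/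
def Config.total (σ : Config L Q) : Multiset (Builtin L) := σ.store + σ.pend

/-- The configuration to which **Apply'** leads with the variant of `r` under `ρ`. -/
def fire (r : AnnRule L Q) (ρ : Equiv.Perm ℕ) (σ : Config L Q) (K1 K2 : List (IdAtom L Q))
    (S : Multiset (IdAtom L Q)) : Config L Q :=
  ⟨(inst (r.rename ρ).body (r.rename ρ).tokens σ.counter).1 + ↑K1 + S,
    (r.rename ρ).bodyB + σ.pend,
    matchEqs (chrOf (K1 ++ K2)) ((r.rename ρ).H1 ++ (r.rename ρ).H2) + (r.rename ρ).guard + σ.store,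
    σ.tokens ∪ {⟨(r.rename ρ).name, idsOf (K1 ++ K2)⟩} ∪
      (inst (r.rename ρ).body (r.rename ρ).tokens σ.counter).2.1,
    (inst (r.rename ρ).body (r.rename ρ).tokens σ.counter).2.2⟩

/-- The applicability of `r` to the constraints `K1`, `K2` of `σ`, expressed without a variant. -/
structure CanFire (CT : L.Theory) (r : AnnRule L Q) (σ : Config L Q) (K1 K2 : List (IdAtom L Q))
    (S : Multiset (IdAtom L Q)) : Prop where
  chr : σ.chr = ↑K1 + ↑K2 + S
  sat : Satisfiable CT σ.store
  sym1 : (chrOf K1).map UAtom.sym = r.H1.map UAtom.sym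
  sym2 : (chrOf K2).map UAtom.sym = r.H2.map UAtom.sym
  guard : ∀ (M : FirstOrder.Language.Theory.ModelType.{u, v, max u v} CT) (ν : ℕ → M),
    Sat σ.store ν → ∃ μ : ℕ → M,
      (chrOf (K1 ++ K2)).map (UAtom.eval ν) = (r.H1 ++ r.H2).map (UAtom.eval μ) ∧ Sat r.guard μ
  token : (⟨r.name, idsOf (K1 ++ K2)⟩ : Token) ∉ σ.tokens

theorem CanFire.sym {CT : L.Theory} {r : AnnRule L Q} {σ : Config L Q} {K1 K2 : List (IdAtom L Q)}
    {S : Multiset (IdAtom L Q)} (h : CanFire CT r σ K1 K2 S) :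
    (chrOf (K1 ++ K2)).map UAtom.sym = (r.H1 ++ r.H2).map UAtom.sym := by
  simp only [chrOf, List.map_append] at *
  rw [← h.sym1, ← h.sym2]
  rfl

theorem sym_rename_heads {r : AnnRule L Q} (ρ : Equiv.Perm ℕ) :
    ((r.rename ρ).H1 ++ (r.rename ρ).H2).map UAtom.sym = (r.H1 ++ r.H2).map UAtom.sym := by
  simp [AnnRule.rename, Function.comp_def]

section Valuation

variable {M : Type*} [L.Structure M]

theorem eval_rename_heads {r : AnnRule L Q} (ρ : Equiv.Perm ℕ) (ν : ℕ → M) :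
    ((r.rename ρ).H1 ++ (r.rename ρ).H2).map (UAtom.eval ν) =
      (r.H1 ++ r.H2).map (UAtom.eval (ν ∘ ρ)) := by
  simp [AnnRule.rename, UAtom.eval_subst, Function.comp_def]

theorem sat_rename_guard {r : AnnRule L Q} (ρ : Equiv.Perm ℕ) (ν : ℕ → M) :
    Sat (r.rename ρ).guard ν ↔ Sat r.guard (ν ∘ ρ) := by
  simp [AnnRule.rename, sat_subst, Function.comp_def]

theorem sat_rename_bodyB {r : AnnRule L Q} (ρ : Equiv.Perm ℕ) (ν : ℕ → M) :
    Sat (r.rename ρ).bodyB ν ↔ Sat r.bodyB (ν ∘ ρ) := by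
  simp [AnnRule.rename, sat_subst, Function.comp_def]

theorem eval_rename {ρ : Equiv.Perm ℕ} {h : UAtom L Q} {ν : ℕ → M} :
    (h.subst fun x => FirstOrder.Language.Term.var (ρ x)).eval ν = h.eval (ν ∘ ρ) := by
  simp [UAtom.eval_subst, Function.comp_def]

/-- The meaning of the built-in constraints after the application of a rule. -/
theorem sat_total_fire {r : AnnRule L Q} {ρ : Equiv.Perm ℕ} {σ : Config L Q}
    {K1 K2 : List (IdAtom L Q)} {S : Multiset (IdAtom L Q)}
    (h : (chrOf (K1 ++ K2)).map UAtom.sym = (r.H1 ++ r.H2).map UAtom.sym) {ν : ℕ → M} :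
    Sat (fire r ρ σ K1 K2 S).total ν ↔
      (chrOf (K1 ++ K2)).map (UAtom.eval ν) = (r.H1 ++ r.H2).map (UAtom.eval (ν ∘ ρ)) ∧
        Sat r.guard (ν ∘ ρ) ∧ Sat r.bodyB (ν ∘ ρ) ∧ Sat σ.total ν := by
  rw [← sym_rename_heads ρ] at h
  simp only [Config.total, fire, sat_add, sat_matchEqs h, eval_rename_heads, sat_rename_guard,
    sat_rename_bodyB]
  tauto

/-- The renamed variables are fresh, so the values prescribed by `μ` for a rule do not interfere
with those of `ν` on the configuration. The last clause serves the existential quantifier in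
`Apply`, which ranges over the variables of the variant only. -/
theorem exists_merge_rename {A B : Set ℕ} {ρ : Equiv.Perm ℕ} (h : Disjoint (ρ '' A) B)
    (ν μ : ℕ → M) : ∃ ν' : ℕ → M, (∀ x ∈ B, ν' x = ν x) ∧ (∀ x ∈ A, (ν' ∘ ρ) x = μ x) ∧
      ∀ x, x ∉ ρ '' A → ν' x = ν x := by
  refine ⟨merge (ρ '' A) (μ ∘ ρ.symm) ν, fun x hx => ?_, fun x hx => ?_, fun x hx => ?_⟩
  · exact merge_of_notMem fun hA => Set.disjoint_left.1 h hA hx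
  · rw [Function.comp, merge_of_mem (Set.mem_image_of_mem _ hx)]
    simp
  · exact merge_of_notMem hx

theorem AnnRule.conjVars_guard_subset (r : AnnRule L Q) : conjVars r.guard ⊆ r.vars :=
  fun _ h => Or.inl (Or.inl (Or.inr h))

theorem AnnRule.headVars_subset (r : AnnRule L Q) : r.headVars ⊆ r.vars :=
  fun _ h => Or.inl (Or.inl (Or.inl h))

theorem AnnRule.conjVars_bodyB_subset (r : AnnRule L Q) : conjVars r.bodyB ⊆ r.vars :=
  fun _ h => Or.inr h

theorem AnnRule.idAtomsVars_body_subset (r : AnnRule L Q) : idAtomsVars r.body ⊆ r.vars :=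
  fun _ h => Or.inl (Or.inr h)

theorem Config.idAtomsVars_chr_subset (σ : Config L Q) : idAtomsVars σ.chr ⊆ σ.vars :=
  fun _ h => Or.inl (Or.inl h)

theorem Config.conjVars_total_subset (σ : Config L Q) : conjVars σ.total ⊆ σ.vars := by
  rintro x ⟨c, hc, hx⟩
  rcases Multiset.mem_add.1 hc with hc | hc
  · exact Or.inr ⟨c, hc, hx⟩
  · exact Or.inl (Or.inr ⟨c, hc, hx⟩)

theorem Config.atomVars_subset {σ : Config L Q} {k : IdAtom L Q} (h : k ∈ σ.chr) :
    k.atom.vars ⊆ σ.vars :=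
  fun _ hx => σ.idAtomsVars_chr_subset ⟨k, h, hx⟩

theorem atomsVars_chrOf_subset {σ : Config L Q} {K : List (IdAtom L Q)} (h : ∀ k ∈ K, k ∈ σ.chr) :
    atomsVars (chrOf K) ⊆ σ.vars := by
  rintro x ⟨a, ha, hx⟩
  obtain ⟨k, hk, rfl⟩ := List.mem_map.1 ha
  exact Config.atomVars_subset (h k hk) hx

/-- Every valuation of the rule that fits a solution of the configuration extends it to a solution
of the resulting configuration. -/
theorem exists_sat_total_fire {r : AnnRule L Q} {ρ : Equiv.Perm ℕ} {σ : Config L Q}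
    {K1 K2 : List (IdAtom L Q)} {S : Multiset (IdAtom L Q)} (hchr : σ.chr = ↑K1 + ↑K2 + S)
    (h : (chrOf (K1 ++ K2)).map UAtom.sym = (r.H1 ++ r.H2).map UAtom.sym)
    (hρ : Disjoint (r.rename ρ).vars σ.vars) {ν μ : ℕ → M} (hν : Sat σ.total ν)
    (hK : (chrOf (K1 ++ K2)).map (UAtom.eval ν) = (r.H1 ++ r.H2).map (UAtom.eval μ))
    (hg : Sat r.guard μ) (hb : Sat r.bodyB μ) :
    ∃ ν' : ℕ → M, Sat (fire r ρ σ K1 K2 S).total ν' ∧ (∀ x ∈ σ.vars, ν' x = ν x) ∧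
      ∀ x ∈ r.vars, (ν' ∘ ρ) x = μ x := by
  rw [AnnRule.vars_rename] at hρ
  obtain ⟨ν', h1, h2, -⟩ := exists_merge_rename hρ ν μ
  refine ⟨ν', (sat_total_fire h).2 ⟨?_, ?_, ?_, ?_⟩, h1, h2⟩
  · rw [map_eval_congr (ν' := ν), hK]
    · exact map_eval_congr fun x hx => (h2 x (r.headVars_subset hx)).symm
    · refine fun x hx => h1 x (atomsVars_chrOf_subset (fun k hk => ?_) hx)
      rw [hchr]
      exact Multiset.mem_add.2 (Or.inl (by simpa using hk))
  · exact (sat_congr fun x hx => h2 x (r.conjVars_guard_subset hx)).2 hg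
  · exact (sat_congr fun x hx => h2 x (r.conjVars_bodyB_subset hx)).2 hb
  · exact (sat_congr fun x hx => h1 x (σ.conjVars_total_subset hx)).2 hν

end Valuation

/-- **Apply'** in terms of `fire`. -/
theorem apply_iff {CT : L.Theory} {P : Set (AnnRule L Q)} {σ σ' : Config L Q} :
    Apply CT P σ σ' ↔ ∃ r ∈ P, ∃ ρ K1 K2 S, CanFire CT r σ K1 K2 S ∧
      Disjoint (r.rename ρ).vars σ.vars ∧ σ' = fire r ρ σ K1 K2 S := by
  constructor
  · rintro ⟨r, _, ρ, K1, K2, S, B, C, T, n, hs, hr, rfl, hf, h1, h2, hg, ht⟩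
    have hsym : (chrOf (K1 ++ K2)).map UAtom.sym =
        ((r.rename ρ).H1 ++ (r.rename ρ).H2).map UAtom.sym := by
      simp only [chrOf, List.map_append] at *
      rw [← h1, ← h2]
    refine ⟨r, hr, ρ, K1, K2, S, ⟨rfl, hs, ?_, ?_, fun M ν hν => ?_, ht⟩, hf, rfl⟩
    · rw [h1]; simp [AnnRule.rename]
    · rw [h2]; simp [AnnRule.rename]
    · obtain ⟨ν', e1, e2⟩ := hg M ν hν
      rw [sat_add, sat_matchEqs hsym, eval_rename_heads, sat_rename_guard] at e2
      refine ⟨ν' ∘ ρ, ?_, e2.2⟩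
      rw [← e2.1]
      refine map_eval_congr fun x hx => (e1 x fun hx' => Set.disjoint_left.1 hf hx' ?_).symm
      exact atomsVars_chrOf_subset (fun k hk => Multiset.mem_add.2 (Or.inl (by simpa using hk))) hx
  · rintro ⟨r, hr, ρ, K1, K2, S, h, hf, rfl⟩
    have hsym := h.sym
    obtain ⟨hchr, hs, h1, h2, hg, ht⟩ := h
    obtain ⟨A, B, C, T, n⟩ := σ
    subst hchr
    rw [← sym_rename_heads ρ] at hsym
    refine Apply.mk r _ ρ K1 K2 S B C T n hs hr rfl hf ?_ ?_ (fun M ν hν => ?_) ht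
    · rw [h1]; simp [AnnRule.rename]
    · rw [h2]; simp [AnnRule.rename]
    · obtain ⟨μ, e1, e2⟩ := hg M ν hν
      have hf' := hf
      rw [AnnRule.vars_rename] at hf'
      obtain ⟨ν', f1, f2, f3⟩ := exists_merge_rename hf' ν μ
      refine ⟨ν', fun x hx => f3 x (by rwa [AnnRule.vars_rename] at hx), ?_⟩
      rw [sat_add, sat_matchEqs hsym, eval_rename_heads, sat_rename_guard]
      constructor
      · rw [map_eval_congr (ν' := ν), e1]
        · exact map_eval_congr fun x hx => (f2 x (r.headVars_subset hx)).symm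
        · refine fun x hx => f1 x (atomsVars_chrOf_subset (fun k hk => ?_) hx)
          exact Multiset.mem_add.2 (Or.inl (by simpa using hk))
      · exact (sat_congr fun x hx => f2 x (r.conjVars_guard_subset hx)).2 e2

/-! The invariants of derivations. -/

/-- The identifiers of a rule are positive, so after the shift by the counter they exceed all
identifiers in use. -/
theorem Config.WF.fire {r : AnnRule L Q} {ρ : Equiv.Perm ℕ} {σ : Config L Q}
    {K1 K2 : List (IdAtom L Q)} {S : Multiset (IdAtom L Q)} (hσ : σ.WF) (hr : r.WF)
    (hchr : σ.chr = ↑K1 + ↑K2 + S) : (fire r ρ σ K1 K2 S).WF := by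
  obtain ⟨h1, h2, h3⟩ := hσ
  obtain ⟨-, g1, g2, g3⟩ := hr.rename ρ
  rw [hchr] at h1 h2
  simp only [Multiset.map_add, Multiset.nodup_add] at h1
  have hold : ∀ k ∈ (K1 : Multiset (IdAtom L Q)) + S, 0 < k.id ∧ k.id ≤ σ.counter := by
    intro k hk
    refine h2 k ?_
    rcases Multiset.mem_add.1 hk with hk | hk
    · exact Multiset.mem_add.2 (Or.inl (Multiset.mem_add.2 (Or.inl hk)))
    · exact Multiset.mem_add.2 (Or.inr hk)
  refine ⟨?_, ?_, ?_⟩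
  · simp only [CHR.fire, inst, add_assoc, Multiset.map_add]
    rw [← Multiset.map_add IdAtom.id (K1 : Multiset (IdAtom L Q)) S]
    refine Multiset.nodup_add.2 ⟨?_, ?_, Multiset.disjoint_left.2 ?_⟩
    · rw [Multiset.map_map]
      have : (IdAtom.id ∘ IdAtom.mapId (fun i => i + σ.counter) : IdAtom L Q → ℕ) =
        (fun i => i + σ.counter) ∘ IdAtom.id := rfl
      rw [this, ← Multiset.map_map]
      exact g1.map (add_left_injective _)
    · rw [Multiset.map_add]
      refine Multiset.nodup_add.2 ⟨h1.1.1, h1.2.1, ?_⟩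
      refine Multiset.disjoint_left.2 fun hi => ?_
      intro hi'
      exact Multiset.disjoint_left.1 h1.2.2 (Multiset.mem_add.2 (Or.inl hi)) hi'
    · intro i hi hi'
      simp only [Multiset.map_map, Multiset.mem_map, Function.comp] at hi hi'
      obtain ⟨k, hk, rfl⟩ := hi
      obtain ⟨k', hk', he⟩ := hi'
      have := g2 k hk
      have := (hold k' hk').2
      simp only [IdAtom.mapId] at he
      omega
  · intro k hk
    simp only [CHR.fire, inst, add_assoc] at hk ⊢
    rcases Multiset.mem_add.1 hk with hk | hk
    · obtain ⟨b, hb, rfl⟩ := Multiset.mem_map.1 hk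
      have := g2 b hb
      have := id_le_maxId (T := (r.rename ρ).tokens) hb
      simp only [IdAtom.mapId]
      omega
    · have := hold k hk
      omega
  · intro t ht
    simp only [CHR.fire, inst, Finset.mem_union, Finset.mem_singleton, Finset.mem_image] at ht ⊢
    rcases ht with (ht | rfl) | ⟨t, ht, rfl⟩
    · exact ⟨(h3 t ht).1, fun i hi => ((h3 t ht).2 i hi).trans (by omega)⟩
    · have hmem : ∀ k ∈ K1 ++ K2, 0 < k.id ∧ k.id ≤ σ.counter := fun k hk =>
        h2 k (Multiset.mem_add.2 (Or.inl (by simpa using hk)))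
      refine ⟨⟨?_, ?_⟩, ?_⟩
      · have : (Multiset.map IdAtom.id (↑(K1 ++ K2) : Multiset (IdAtom L Q))).Nodup := by
          rw [← Multiset.coe_add, Multiset.map_add]
          exact Multiset.nodup_add.2 h1.1
        simpa [idsOf] using this
      · intro i hi
        obtain ⟨k, hk, rfl⟩ := List.mem_map.1 hi
        exact (hmem k hk).1
      · intro i hi
        obtain ⟨k, hk, rfl⟩ := List.mem_map.1 hi
        exact (hmem k hk).2.trans (by omega)
    · refine ⟨⟨(g3 t ht).1.map (add_left_injective _), ?_⟩, ?_⟩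
      · intro i hi
        obtain ⟨j, hj, rfl⟩ := List.mem_map.1 hi
        have := (g3 t ht).2 j hj
        omega
      · intro i hi
        obtain ⟨j, hj, rfl⟩ := List.mem_map.1 hi
        have := token_id_le_maxId (B := (r.rename ρ).body) ht hj
        omega

/-- The inclusion `V ⊆ σ.vars` thus persists along a derivation, which keeps fresh variants away
from `V`. -/
theorem vars_subset_fire {r : AnnRule L Q} {ρ : Equiv.Perm ℕ} {σ : Config L Q}
    {K1 K2 : List (IdAtom L Q)} {S : Multiset (IdAtom L Q)} (hchr : σ.chr = ↑K1 + ↑K2 + S)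
    (h : (chrOf (K1 ++ K2)).map UAtom.sym = (r.H1 ++ r.H2).map UAtom.sym) :
    σ.vars ⊆ (fire r ρ σ K1 K2 S).vars := by
  rw [← sym_rename_heads ρ] at h
  have hK := atomsVars_subset_matchEqs h
  rintro x ((⟨k, hk, hx⟩ | ⟨c, hc, hx⟩) | ⟨c, hc, hx⟩)
  · rw [hchr] at hk
    rcases Multiset.mem_add.1 hk with hk | hk
    · obtain ⟨c, hc, hx⟩ := hK ⟨k.atom, List.mem_map_of_mem (by simpa using hk), hx⟩
      exact Or.inr ⟨c, Multiset.mem_add.2 (Or.inl (Multiset.mem_add.2 (Or.inl hc))), hx⟩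
    · exact Or.inl (Or.inl ⟨k, Multiset.mem_add.2 (Or.inr hk), hx⟩)
  · exact Or.inl (Or.inr ⟨c, Multiset.mem_add.2 (Or.inr hc), hx⟩)
  · exact Or.inr ⟨c, Multiset.mem_add.2 (Or.inr hc), hx⟩

theorem Solve.eq {CT : L.Theory} {σ τ : Config L Q} (h : Solve CT σ τ) :
    τ.chr = σ.chr ∧ τ.total = σ.total ∧ τ.tokens = σ.tokens ∧ τ.counter = σ.counter := by
  obtain ⟨c, S, B, C, T, n, -⟩ := h
  refine ⟨rfl, ?_, rfl, rfl⟩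
  simp [Config.total, Multiset.cons_add, Multiset.add_cons]

theorem Config.vars_eq (σ : Config L Q) : σ.vars = idAtomsVars σ.chr ∪ conjVars σ.total := by
  ext x
  simp only [Config.vars, Config.goalVars, Config.total, conjVars, Set.mem_union,
    Set.mem_ofPred_eq, Multiset.mem_add]
  grind

/-- Every configuration can be solved, unless its built-in store becomes inconsistent. -/
theorem exists_solved (CT : L.Theory) (σ : Config L Q) :
    ∃ τ, Relation.ReflTransGen (Solve CT) σ τ ∧ τ.chr = σ.chr ∧ τ.total = σ.total ∧
      τ.tokens = σ.tokens ∧ τ.counter = σ.counter ∧ (τ.pend = 0 ∨ ¬ Satisfiable CT τ.store) := by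
  obtain ⟨S, B, C, T, n⟩ := σ
  induction B using Multiset.induction_on generalizing C with
  | empty => exact ⟨_, .refl, rfl, rfl, rfl, rfl, Or.inl rfl⟩
  | cons c B ih =>
    by_cases hC : Satisfiable CT C
    · have hstep := Solve.mk c S B C T n hC
      obtain ⟨τ, h1, h2, h3, h4, h5, h6⟩ := ih (c ::ₘ C)
      obtain ⟨e1, e2, e3, e4⟩ := hstep.eq
      exact ⟨τ, .head hstep h1, h2.trans e1, h3.trans e2, h4.trans e3, h5.trans e4, h6⟩
    -- A failed store blocks `Solve'`, possibly with constraints still pending; hence the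
    -- alternative in the conclusion.
    · exact ⟨_, .refl, rfl, rfl, rfl, rfl, Or.inr hC⟩

theorem Config.WF.of_eq {σ τ : Config L Q} (h : σ.WF) (h1 : τ.chr = σ.chr)
    (h2 : τ.tokens = σ.tokens) (h3 : τ.counter = σ.counter) : τ.WF := by
  unfold Config.WF
  rw [h1, h2, h3]
  exact h

end Firing
-- Similarity of configurations and its compatibility with rule application
section Simulation

variable {L : FirstOrder.Language.{u, v}} {Q : ℕ → Type w}

/-! Lifting lists and multisets along maps. -/

theorem exists_list_lift {α β : Type*} {f : α → β} {p : α → Prop} {l : List β}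
    (h : ∀ b ∈ l, ∃ a, p a ∧ f a = b) : ∃ l' : List α, (∀ a ∈ l', p a) ∧ l'.map f = l := by
  induction l with
  | nil => exact ⟨[], by simp, rfl⟩
  | cons b l ih =>
    obtain ⟨a, ha, rfl⟩ := h b (by simp)
    obtain ⟨l', h1, rfl⟩ := ih fun c hc => h c (by simp [hc])
    exact ⟨a :: l', by simpa [ha] using h1, rfl⟩

/-- This carries the constraints selected by a rule head, as an ordered list, along a pairing of
multisets. -/
theorem exists_split_coe {α β : Type*} {f : α → β} {K : List β} {S : Multiset β}
    {l : Multiset α} (h : l.map f = ↑K + S) :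
    ∃ (p : List α) (ls : Multiset α), l = ↑p + ls ∧ p.map f = K ∧ ls.map f = S := by
  classical
  induction K generalizing l with
  | nil => exact ⟨[], l, by simp, rfl, by simpa using h⟩
  | cons b K ih =>
    rw [← Multiset.cons_coe, Multiset.cons_add] at h
    have hb : b ∈ l.map f := h ▸ Multiset.mem_cons_self _ _
    obtain ⟨a, ha, rfl⟩ := Multiset.mem_map.1 hb
    obtain ⟨l', rfl⟩ := Multiset.exists_cons_of_mem ha
    rw [Multiset.map_cons] at h
    obtain ⟨p, ls, rfl, rfl, rfl⟩ := ih ((Multiset.cons_inj_right _).1 h)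
    exact ⟨a :: p, ls, by rw [← Multiset.cons_coe, Multiset.cons_add], rfl, rfl⟩

theorem exists_split {α β : Type*} {f : α → β} {K1 K2 : List β} {S : Multiset β}
    {l : Multiset α} (h : l.map f = ↑K1 + ↑K2 + S) :
    ∃ (p1 p2 : List α) (ls : Multiset α),
      l = ↑p1 + ↑p2 + ls ∧ p1.map f = K1 ∧ p2.map f = K2 ∧ ls.map f = S := by
  rw [add_assoc] at h
  obtain ⟨p1, l', rfl, h1, h'⟩ := exists_split_coe h
  obtain ⟨p2, ls, rfl, h2, h3⟩ := exists_split_coe h'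
  exact ⟨p1, p2, ls, (add_assoc _ _ _).symm, h1, h2, h3⟩

theorem eq_of_map_eq_of_injOn {α β : Type*} {f : α → β} {p : α → Prop}
    (hf : ∀ a b, p a → p b → f a = f b → a = b) {l l' : List α} (hl : ∀ a ∈ l, p a)
    (hl' : ∀ a ∈ l', p a) (h : l.map f = l'.map f) : l = l' := by
  induction l generalizing l' with
  | nil => cases l' <;> simp_all
  | cons a l ih =>
    cases l' with
    | nil => simp at h
    | cons b l' =>
      simp only [List.map_cons, List.cons.injEq] at h
      rw [hf a b (hl a (by simp)) (hl' b (by simp)) h.1,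
        ih (fun c hc => hl c (by simp [hc])) (fun c hc => hl' c (by simp [hc])) h.2]

/-- One half of the simulation relation, for a given pairing `l` of the CHR constraints: tokens
of live constraints are preserved, and every solution of the built-in constraints of `σ` is matched
by one of `τ` with the same values of `V` and of the paired constraints. -/
def Forth (CT : L.Theory) (V : Set ℕ) (l : Multiset (IdAtom L Q × IdAtom L Q))
    (σ τ : Config L Q) : Prop :=
  (∀ (name : ℕ) (ps : List (IdAtom L Q × IdAtom L Q)), (∀ p ∈ ps, p ∈ l) →
    (⟨name, ps.map fun p => p.1.id⟩ : Token) ∈ σ.tokens →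
      (⟨name, ps.map fun p => p.2.id⟩ : Token) ∈ τ.tokens) ∧
  ∀ (M : FirstOrder.Language.Theory.ModelType.{u, v, max u v} CT) (ν : ℕ → M), Sat σ.total ν →
    ∃ ν' : ℕ → M, (∀ x ∈ V, ν' x = ν x) ∧ Sat τ.total ν' ∧
      ∀ p ∈ l, p.1.atom.eval ν = p.2.atom.eval ν'

/-- The simulation relation for a given pairing of the CHR constraints. -/
structure SimBy (CT : L.Theory) (V : Set ℕ) (l : Multiset (IdAtom L Q × IdAtom L Q))
    (σ τ : Config L Q) : Prop where
  fst : l.map Prod.fst = σ.chr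
  snd : l.map Prod.snd = τ.chr
  sym : ∀ p ∈ l, p.1.atom.sym = p.2.atom.sym
  forth : Forth CT V l σ τ
  back : Forth CT V (l.map Prod.swap) τ σ

/-- Configurations that cannot be distinguished by rules, up to the solving of constraints. -/
def Sim (CT : L.Theory) (V : Set ℕ) (σ τ : Config L Q) : Prop :=
  ∃ l, SimBy CT V l σ τ

variable {CT : L.Theory} {V : Set ℕ}

theorem SimBy.symm {l : Multiset (IdAtom L Q × IdAtom L Q)} {σ τ : Config L Q}
    (h : SimBy CT V l σ τ) : SimBy CT V (l.map Prod.swap) τ σ where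
  fst := by simp [← h.snd]
  snd := by simp [← h.fst]
  sym := by
    intro p hp
    obtain ⟨q, hq, rfl⟩ := Multiset.mem_map.1 hp
    exact (h.sym q hq).symm
  forth := h.back
  back := by simpa using h.forth

theorem Sim.symm {σ τ : Config L Q} (h : Sim CT V σ τ) : Sim CT V τ σ :=
  let ⟨_, h⟩ := h
  ⟨_, h.symm⟩

/-- Similarity sees the stored and the pending constraints only through their sum, so `Solve'` does
not affect it. -/
theorem Sim.of_eq {σ τ : Config L Q} (h1 : τ.chr = σ.chr) (h2 : τ.total = σ.total)
    (h3 : τ.tokens = σ.tokens) : Sim CT V σ τ := by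
  refine ⟨σ.chr.map fun k => (k, k), by simp, by simp [h1], ?_, ⟨?_, ?_⟩, ?_, ?_⟩
  · intro p hp
    obtain ⟨k, -, rfl⟩ := Multiset.mem_map.1 hp
    rfl
  · intro name ps hps ht
    rw [h3]
    suffices ∀ p ∈ ps, p.2.id = p.1.id by
      rwa [List.map_congr_left this]
    intro p hp
    obtain ⟨k, -, rfl⟩ := Multiset.mem_map.1 (hps p hp)
    rfl
  · intro M ν hν
    refine ⟨ν, fun _ _ => rfl, h2 ▸ hν, fun p hp => ?_⟩
    obtain ⟨k, -, rfl⟩ := Multiset.mem_map.1 hp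
    rfl
  · intro name ps hps ht
    rw [← h3]
    suffices ∀ p ∈ ps, p.2.id = p.1.id by
      rwa [List.map_congr_left this]
    intro p hp
    have := hps p hp
    rw [Multiset.map_map] at this
    obtain ⟨k, -, rfl⟩ := Multiset.mem_map.1 this
    rfl
  · intro M ν hν
    refine ⟨ν, fun _ _ => rfl, h2 ▸ hν, fun p hp => ?_⟩
    rw [Multiset.map_map] at hp
    obtain ⟨k, -, rfl⟩ := Multiset.mem_map.1 hp
    rfl

theorem Forth.trans {t : Multiset (IdAtom L Q × IdAtom L Q × IdAtom L Q)} {σ τ υ : Config L Q}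
    (h : Forth CT V (t.map fun p => (p.1, p.2.1)) σ τ) (h' : Forth CT V (t.map Prod.snd) τ υ) :
    Forth CT V (t.map fun p => (p.1, p.2.2)) σ υ := by
  refine ⟨fun name ps hps ht => ?_, fun M ν hν => ?_⟩
  · obtain ⟨qs, hqs, rfl⟩ := exists_list_lift fun p hp => Multiset.mem_map.1 (hps p hp)
    have h1 := h.1 name (qs.map fun p => (p.1, p.2.1)) ?_ ?_
    · have h2 := h'.1 name (qs.map Prod.snd) ?_ ?_
      · simpa [Function.comp_def] using h2
      · simp only [List.mem_map]
        rintro _ ⟨q, hq, rfl⟩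
        exact Multiset.mem_map_of_mem _ (hqs q hq)
      · simpa [Function.comp_def] using h1
    · simp only [List.mem_map]
      rintro _ ⟨q, hq, rfl⟩
      exact Multiset.mem_map_of_mem (fun p => (p.1, p.2.1)) (hqs q hq)
    · simpa [Function.comp_def] using ht
  · obtain ⟨ν₁, e1, e2, e3⟩ := h.2 M ν hν
    obtain ⟨ν₂, f1, f2, f3⟩ := h'.2 M ν₁ e2
    refine ⟨ν₂, fun x hx => (f1 x hx).trans (e1 x hx), f2, fun p hp => ?_⟩
    obtain ⟨q, hq, rfl⟩ := Multiset.mem_map.1 hp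
    exact (e3 _ (Multiset.mem_map_of_mem _ hq)).trans (f3 _ (Multiset.mem_map_of_mem _ hq))

theorem Sim.trans {σ τ υ : Config L Q} (h : Sim CT V σ τ) (h' : Sim CT V τ υ) :
    Sim CT V σ υ := by
  obtain ⟨l, h⟩ := h
  obtain ⟨l', h'⟩ := h'
  obtain ⟨t, rfl, rfl⟩ := exists_glue l l' (h.snd.trans h'.fst.symm)
  refine ⟨t.map fun p => (p.1, p.2.2), ?_, ?_, ?_, h.forth.trans h'.forth, ?_⟩
  · simpa [Function.comp_def] using h.fst
  · simpa [Function.comp_def] using h'.snd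
  · intro p hp
    obtain ⟨q, hq, rfl⟩ := Multiset.mem_map.1 hp
    exact (h.sym _ (Multiset.mem_map_of_mem _ hq)).trans (h'.sym _ (Multiset.mem_map_of_mem _ hq))
  -- The backward half is the same composition, applied to the reversed triples.
  · have := Forth.trans (t := t.map fun p => (p.2.2, p.2.1, p.1)) (CT := CT) (V := V)
      (σ := υ) (τ := τ) (υ := σ) ?_ ?_
    · simpa [Function.comp_def] using this
    · simpa [Function.comp_def, Prod.swap] using h'.back
    · simpa [Function.comp_def, Prod.swap] using h.back

/-- The pairing of the CHR constraints after the application of a rule to paired constraints. -/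
def newPairs (r : AnnRule L Q) (ρ ρ' : Equiv.Perm ℕ) (n n' : ℕ)
    (p1 : List (IdAtom L Q × IdAtom L Q)) (ls : Multiset (IdAtom L Q × IdAtom L Q)) :
    Multiset (IdAtom L Q × IdAtom L Q) :=
  r.body.map (fun b =>
    ((b.subst fun x => FirstOrder.Language.Term.var (ρ x)).mapId (fun i => i + n),
      (b.subst fun x => FirstOrder.Language.Term.var (ρ' x)).mapId (fun i => i + n'))) + ↑p1 + ls

theorem map_swap_newPairs (r : AnnRule L Q) (ρ ρ' : Equiv.Perm ℕ) (n n' : ℕ)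
    (p1 : List (IdAtom L Q × IdAtom L Q)) (ls : Multiset (IdAtom L Q × IdAtom L Q)) :
    (newPairs r ρ ρ' n n' p1 ls).map Prod.swap =
      newPairs r ρ' ρ n' n (p1.map Prod.swap) (ls.map Prod.swap) := by
  simp [newPairs]

theorem mem_newPairs {r : AnnRule L Q} (hr : r.WF) {ρ ρ' : Equiv.Perm ℕ} {n n' : ℕ}
    {p1 : List (IdAtom L Q × IdAtom L Q)} {ls : Multiset (IdAtom L Q × IdAtom L Q)}
    {p : IdAtom L Q × IdAtom L Q} (hp : p ∈ newPairs r ρ ρ' n n' p1 ls) :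
    (∃ j, 0 < j ∧ p.1.id = j + n ∧ p.2.id = j + n') ∨ p ∈ (p1 : Multiset _) + ls := by
  rw [newPairs, add_assoc] at hp
  rcases Multiset.mem_add.1 hp with hp | hp
  · obtain ⟨b, hb, rfl⟩ := Multiset.mem_map.1 hp
    exact Or.inl ⟨b.id, hr.2.2.1 b hb, rfl, rfl⟩
  · exact Or.inr hp

theorem chrOf_map_eval {M : Type*} [L.Structure M] {p : List (IdAtom L Q × IdAtom L Q)}
    {ν ν' : ℕ → M} (h : ∀ q ∈ p, q.1.atom.eval ν = q.2.atom.eval ν') :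
    (chrOf (p.map Prod.fst)).map (UAtom.eval ν) =
      (chrOf (p.map Prod.snd)).map (UAtom.eval ν') := by
  simpa [chrOf] using h

/-- A solution after the application restricts to one of `σ`, transfers to `τ`, and extends again
with the rule valuation `ν ∘ ρ`, since the variables of the second variant are fresh. For tokens,
the counter separates old identifiers from new ones, so that old tokens, the token of this
application and the tokens of the body can be treated separately. -/
theorem Forth.fire {r : AnnRule L Q} (hr : r.WF) {ρ ρ' : Equiv.Perm ℕ} {σ τ : Config L Q}
    {p1 p2 : List (IdAtom L Q × IdAtom L Q)} {ls : Multiset (IdAtom L Q × IdAtom L Q)}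
    (h : Forth CT V ((p1 : Multiset _) + (p2 : Multiset _) + ls) σ τ) (hσ : σ.WF)
    (hfst : ((p1 : Multiset _) + (p2 : Multiset _) + ls).map Prod.fst = σ.chr)
    (hsnd : ((p1 : Multiset _) + (p2 : Multiset _) + ls).map Prod.snd = τ.chr) (hV : V ⊆ τ.vars)
    (hsym : (chrOf (p1.map Prod.fst ++ p2.map Prod.fst)).map UAtom.sym =
      (r.H1 ++ r.H2).map UAtom.sym)
    (hsym' : (chrOf (p1.map Prod.snd ++ p2.map Prod.snd)).map UAtom.sym =
      (r.H1 ++ r.H2).map UAtom.sym)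
    (hρ' : Disjoint (r.rename ρ').vars τ.vars) :
    Forth CT V (newPairs r ρ ρ' σ.counter τ.counter p1 ls)
      (fire r ρ σ (p1.map Prod.fst) (p2.map Prod.fst) (ls.map Prod.fst))
      (fire r ρ' τ (p1.map Prod.snd) (p2.map Prod.snd) (ls.map Prod.snd)) := by
  have hmem : ∀ p ∈ (p1 : Multiset _) + ls, p ∈ ((p1 : Multiset _) + (p2 : Multiset _) + ls) := by
    intro p hp
    simp only [Multiset.mem_add] at hp ⊢
    tauto
  have hold : ∀ p ∈ (p1 : Multiset _) + ls, p.1.id ≤ σ.counter := fun p hp =>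
    (hσ.2.1 p.1 (hfst ▸ Multiset.mem_map_of_mem _ (hmem p hp))).2
  refine ⟨fun name ps hps ht => ?_, fun M ν hν => ?_⟩
  -- New constraints have identifiers above the counter, so a token bounded by the counter concerns
  -- old constraints only.
  · have key : (∀ i ∈ ps.map (fun p => p.1.id), i ≤ σ.counter) →
        ∀ p ∈ ps, p ∈ ((p1 : Multiset _) + (p2 : Multiset _) + ls) := by
      intro hle p hp
      rcases mem_newPairs hr (hps p hp) with ⟨j, hj, hj1, -⟩ | hp'
      · have := hle _ (List.mem_map_of_mem hp)
        omega
      · exact hmem p hp'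
    simp only [CHR.fire, Finset.mem_union, Finset.mem_singleton, inst, Finset.mem_image] at ht ⊢
    rcases ht with (ht | ht) | ⟨t, ht, he⟩
    · exact Or.inl (Or.inl (h.1 name ps (key (hσ.2.2 _ ht).2) ht))
    · refine Or.inl (Or.inr ?_)
      simp only [Token.mk.injEq] at ht ⊢
      refine ⟨ht.1, ?_⟩
      have hps' : ∀ p ∈ ps, p ∈ ((p1 : Multiset _) + (p2 : Multiset _) + ls) := by
        refine key fun i hi => ?_
        rw [ht.2, idsOf] at hi
        obtain ⟨k, hk, rfl⟩ := List.mem_map.1 hi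
        refine (hσ.2.1 k ?_).2
        rw [← List.map_append] at hk
        obtain ⟨p, hp, rfl⟩ := List.mem_map.1 hk
        rw [← hfst]
        exact Multiset.mem_map_of_mem _ (Multiset.mem_add.2 (Or.inl (by simpa using hp)))
      have hnd : (((p1 : Multiset _) + (p2 : Multiset _) + ls).map
          fun p : IdAtom L Q × IdAtom L Q => p.1.id).Nodup := by
        have := hσ.1
        rw [← hfst, Multiset.map_map] at this
        exact this
      -- Identifiers in `σ` are distinct, so the token of this application determines the pairs it
      -- refers to, including their order.
      have : ps = p1 ++ p2 := by
        refine eq_of_map_eq_of_injOn (f := fun p => p.1.id) (p := fun p => p ∈ ((p1 : Multiset _) + (p2 : Multiset _) + ls))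
          (fun a b ha hb hab => Multiset.inj_on_of_nodup_map hnd a ha b hb hab) hps' ?_ ?_
        · intro p hp
          exact Multiset.mem_add.2 (Or.inl (by simpa using hp))
        · rw [ht.2]
          simp [idsOf, Function.comp_def]
      rw [this]
      simp [idsOf, Function.comp_def]
    · refine Or.inr ⟨t, ht, ?_⟩
      simp only [Token.mapId, Token.mk.injEq] at he ⊢
      refine ⟨he.1, ?_⟩
      -- A token from the body has identifiers above the counter only, hence all its pairs are new
      -- and the truncated subtraction undoes the shift exactly.
      have hnew : ∀ p ∈ ps, p.2.id = p.1.id - σ.counter + τ.counter := by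
        intro p hp
        rcases mem_newPairs hr (hps p hp) with ⟨j, hj, hj1, hj2⟩ | hp'
        · omega
        · have h1 : p.1.id ∈ ps.map fun p => p.1.id := List.mem_map_of_mem hp
          rw [← he.2] at h1
          obtain ⟨j, hj, hje⟩ := List.mem_map.1 h1
          have := (hr.2.2.2 t ht).2 j hj
          have := hold p hp'
          omega
      rw [List.map_congr_left hnew]
      have : (ps.map fun p => p.1.id - σ.counter + τ.counter) =
          (ps.map fun p => p.1.id).map fun i => i - σ.counter + τ.counter := by simp
      rw [this, ← he.2, List.map_map]
      refine List.map_congr_left fun i _ => ?_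
      simp
  · obtain ⟨e1, e2, e3, e4⟩ := (sat_total_fire hsym).1 hν
    obtain ⟨ν₁, f1, f2, f3⟩ := h.2 M ν e4
    have hK : (chrOf (p1.map Prod.snd ++ p2.map Prod.snd)).map (UAtom.eval ν₁) =
        (r.H1 ++ r.H2).map (UAtom.eval (ν ∘ ρ)) := by
      rw [← e1, ← List.map_append, ← List.map_append]
      refine (chrOf_map_eval fun q hq => f3 q ?_).symm
      exact Multiset.mem_add.2 (Or.inl (by simpa using hq))
    obtain ⟨ν₂, g1, g2, g3⟩ := exists_sat_total_fire (S := ls.map Prod.snd)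
      (by rw [← hsnd]; simp) hsym' hρ' f2 hK e2 e3
    refine ⟨ν₂, fun x hx => (g2 x (hV hx)).trans (f1 x hx), g1, fun p hp => ?_⟩
    rw [newPairs, add_assoc] at hp
    rcases Multiset.mem_add.1 hp with hp | hp
    · obtain ⟨b, hb, rfl⟩ := Multiset.mem_map.1 hp
      simp only [IdAtom.mapId, IdAtom.subst, eval_rename]
      exact UAtom.eval_congr fun x hx => (g3 x (r.idAtomsVars_body_subset ⟨b, hb, hx⟩)).symm
    · rw [f3 p (hmem p hp)]
      refine UAtom.eval_congr fun x hx => (g2 x ?_).symm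
      exact Config.atomVars_subset (hsnd ▸ Multiset.mem_map_of_mem _ (hmem p hp)) hx

theorem chrOf_map_sym {p : List (IdAtom L Q × IdAtom L Q)}
    (h : ∀ q ∈ p, q.1.atom.sym = q.2.atom.sym) :
    (chrOf (p.map Prod.fst)).map UAtom.sym = (chrOf (p.map Prod.snd)).map UAtom.sym := by
  simpa [chrOf] using h

/-- Rules are applicable to both of two similar configurations, with similar results. -/
theorem Sim.fire {r : AnnRule L Q} (hr : r.WF) {σ τ : Config L Q} (h : Sim CT V σ τ)
    (hσ : σ.WF) (hτ : τ.WF) (hVσ : V ⊆ σ.vars) (hVτ : V ⊆ τ.vars) (hpend : τ.pend = 0)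
    (hsat : Satisfiable CT τ.store) {K1 K2 : List (IdAtom L Q)} {S : Multiset (IdAtom L Q)}
    (hK : CanFire CT r σ K1 K2 S) :
    ∃ K1' K2' S', CanFire CT r τ K1' K2' S' ∧
      ∀ ρ ρ', Disjoint (r.rename ρ).vars σ.vars → Disjoint (r.rename ρ').vars τ.vars →
        Sim CT V (fire r ρ σ K1 K2 S) (fire r ρ' τ K1' K2' S') := by
  obtain ⟨l, h⟩ := h
  have hfst := h.fst
  rw [hK.chr] at hfst
  obtain ⟨p1, p2, ls, rfl, rfl, rfl, rfl⟩ := exists_split hfst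
  have hmem1 : ∀ q ∈ p1 ++ p2, q ∈ ((p1 : Multiset _) + (p2 : Multiset _) + ls) := fun q hq =>
    Multiset.mem_add.2 (Or.inl (by simpa using hq))
  have hs := fun q hq => h.sym q (hmem1 q hq)
  have hsym' : (chrOf (p1.map Prod.snd ++ p2.map Prod.snd)).map UAtom.sym =
      (r.H1 ++ r.H2).map UAtom.sym := by
    rw [← hK.sym, ← List.map_append, ← List.map_append, chrOf_map_sym hs]
  have htotal : τ.total = τ.store := by simp [Config.total, hpend]
  refine ⟨p1.map Prod.snd, p2.map Prod.snd, ls.map Prod.snd,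
    ⟨by rw [← h.snd]; simp, hsat, ?_, ?_, ?_, ?_⟩, fun ρ ρ' hρ hρ' => ?_⟩
  · rw [← hK.sym1, chrOf_map_sym fun q hq => hs q (by simp [hq])]
  · rw [← hK.sym2, chrOf_map_sym fun q hq => hs q (by simp [hq])]
  -- The guard is tested against the store alone. As `τ` is solved, a solution of its store solves
  -- all its built-in constraints and transfers to `σ`, in particular to the store of `σ`, where the
  -- guard is known to hold.
  · intro M ν' hν'
    obtain ⟨ν, -, e2, e3⟩ := h.back.2 M ν' (htotal ▸ hν')
    obtain ⟨μ, f1, f2⟩ := hK.guard M ν (sat_add.1 e2).1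
    refine ⟨μ, ?_, f2⟩
    rw [← f1, ← List.map_append, ← List.map_append]
    exact (chrOf_map_eval fun q hq =>
      (e3 q.swap (Multiset.mem_map_of_mem _ (hmem1 q hq))).symm).symm
  -- A token blocking the rule in `τ` would, by the backward half, block it in `σ`.
  · intro ht
    refine hK.token ?_
    have := h.back.1 r.name ((p1 ++ p2).map Prod.swap) ?_ ?_
    · simpa [idsOf, Function.comp_def] using this
    · intro q hq
      obtain ⟨q, hq', rfl⟩ := List.mem_map.1 hq
      exact Multiset.mem_map_of_mem _ (hmem1 q hq')
    · simpa [idsOf, Function.comp_def] using ht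
  · refine ⟨newPairs r ρ ρ' σ.counter τ.counter p1 ls, ?_, ?_, ?_, ?_, ?_⟩
    · simp [newPairs, CHR.fire, inst, AnnRule.rename]
    · simp [newPairs, CHR.fire, inst, AnnRule.rename]
    · intro p hp
      rw [newPairs, add_assoc] at hp
      rcases Multiset.mem_add.1 hp with hp | hp
      · obtain ⟨b, hb, rfl⟩ := Multiset.mem_map.1 hp
        rfl
      · refine h.sym p ?_
        simp only [Multiset.mem_add] at hp ⊢
        tauto
    · exact h.forth.fire hr hσ h.fst h.snd hVτ hK.sym hsym' hρ'
    · rw [map_swap_newPairs]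
      have hback := h.back
      simp only [Multiset.map_add, Multiset.map_coe] at hback
      have hs1 : ∀ p : List (IdAtom L Q × IdAtom L Q),
        (p.map Prod.swap).map Prod.fst = p.map Prod.snd := by simp [Function.comp_def]
      have hs2 : ∀ p : List (IdAtom L Q × IdAtom L Q),
        (p.map Prod.swap).map Prod.snd = p.map Prod.fst := by simp [Function.comp_def]
      have := hback.fire hr (ρ := ρ') (ρ' := ρ) hτ
        (by rw [← h.snd]; simp [Function.comp_def]) (by rw [← h.fst]; simp [Function.comp_def])
        hVσ (by simpa only [hs1] using hsym') (by simpa only [hs2] using hK.sym) hρ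
      simpa only [hs1, hs2, Multiset.map_map, Function.comp_def, Prod.fst_swap,
        Prod.snd_swap] using this

end Simulation
-- The meaning of an unfolded rule
section UnfoldedRules

variable {L : FirstOrder.Language.{u, v}} {Q : ℕ → Type w}

theorem mem_residualGuard {CT : L.Theory} {E D : Multiset (Builtin L)} {θ : ℕ → L.Term ℕ}
    {d : Builtin L} : d ∈ residualGuard CT E θ D ↔ d ∈ D ∧ ¬ Entails CT E {d.subst θ} := by
  classical exact Multiset.mem_filter

/-- The conditions on an unfolding of `cl` with the variant of `v₀` under `ρ` by which its
application can be simulated. -/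
structure UnfoldingData (CT : L.Theory) (cl v₀ : AnnRule L Q) (S1 S2 : List (IdAtom L Q))
    (ρ : Equiv.Perm ℕ) (θ : ℕ → L.Term ℕ) (K : Multiset (IdAtom L Q)) : Prop where
  disjoint : Disjoint cl.vars (v₀.rename ρ).vars
  body : cl.body = K + ↑S1 + ↑S2
  sym1 : (chrOf S1).map UAtom.sym = v₀.H1.map UAtom.sym
  sym2 : (chrOf S2).map UAtom.sym = v₀.H2.map UAtom.sym
  dom : ∀ x, θ x ≠ FirstOrder.Language.Term.var x → x ∈ (v₀.rename ρ).headVars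
  matching : Entails CT (cl.bodyB + cl.guard)
    (matchEqs (chrOf (S1 ++ S2))
      (((v₀.rename ρ).H1 ++ (v₀.rename ρ).H2).map (UAtom.subst θ)))
  token : (⟨v₀.name, idsOf (S1 ++ S2)⟩ : Token) ∉ cl.tokens
  vars : conjVars (conjSubst θ
      (residualGuard CT (cl.bodyB + cl.guard) θ (v₀.rename ρ).guard)) ∩
    atomsVars (((v₀.rename ρ).H1 ++ (v₀.rename ρ).H2).map (UAtom.subst θ)) ⊆ cl.headVars

theorem IsUnfolding.exists_data {CT : L.Theory} {cl v₀ r : AnnRule L Q}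
    {S1 S2 : List (IdAtom L Q)} (h : IsUnfolding CT cl v₀ S1 S2 r) :
    ∃ ρ θ K, UnfoldingData CT cl v₀ S1 S2 ρ θ K ∧
      r = unfoldedRule CT cl (v₀.rename ρ) θ K S1 S2 := by
  obtain ⟨ρ, _, θ, K, rfl, h1, h2, h3, h4, -, h5, h6, h7, h8, -, h9⟩ := h
  refine ⟨ρ, θ, K, ⟨h1, h2, ?_, ?_, h5, h6, h7, h8⟩, h9⟩
  · rw [h3]; simp [AnnRule.rename, Function.comp_def]
  · rw [h4]; simp [AnnRule.rename, Function.comp_def]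

namespace UnfoldingData

variable {CT : L.Theory} {cl v₀ : AnnRule L Q} {S1 S2 : List (IdAtom L Q)} {ρ : Equiv.Perm ℕ}
  {θ : ℕ → L.Term ℕ} {K : Multiset (IdAtom L Q)}

theorem sym (h : UnfoldingData CT cl v₀ S1 S2 ρ θ K) :
    (chrOf (S1 ++ S2)).map UAtom.sym = (v₀.H1 ++ v₀.H2).map UAtom.sym := by
  have h1 := h.sym1
  have h2 := h.sym2
  simp only [chrOf, List.map_append] at *
  rw [← h1, ← h2]

theorem mem_body (h : UnfoldingData CT cl v₀ S1 S2 ρ θ K) {k : IdAtom L Q} (hk : k ∈ S1 ++ S2) :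
    k ∈ cl.body := by
  rw [h.body]
  simp only [Multiset.mem_add, Multiset.mem_coe]
  rcases List.mem_append.1 hk with hk | hk <;> tauto

theorem mem_body' (h : UnfoldingData CT cl v₀ S1 S2 ρ θ K) {k : IdAtom L Q}
    (hk : k ∈ K + (S1 : Multiset _)) : k ∈ cl.body := by
  rw [h.body]
  exact Multiset.mem_add.2 (Or.inl hk)

theorem atomsVars_subset (h : UnfoldingData CT cl v₀ S1 S2 ρ θ K) :
    atomsVars (chrOf (S1 ++ S2)) ⊆ cl.vars := by
  rintro x ⟨a, ha, hx⟩
  obtain ⟨k, hk, rfl⟩ := List.mem_map.1 ha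
  exact cl.idAtomsVars_body_subset ⟨k, h.mem_body hk, hx⟩

variable {M : FirstOrder.Language.Theory.ModelType.{u, v, max u v} CT}

theorem eval_matching (h : UnfoldingData CT cl v₀ S1 S2 ρ θ K) {μ : ℕ → M}
    (hb : Sat cl.bodyB μ) (hg : Sat cl.guard μ) :
    (chrOf (S1 ++ S2)).map (UAtom.eval μ) =
      ((v₀.rename ρ).H1 ++ (v₀.rename ρ).H2).map (UAtom.eval fun x => (θ x).realize μ) := by
  have := h.matching M μ (sat_add.2 ⟨hb, hg⟩)
  rwa [sat_matchEqs (by rw [map_sym_subst, sym_rename_heads, h.sym]), map_eval_subst] at this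

/-- The selected constraints have the values of both the instantiated and the plain head of `v₀`, so
Clark's axioms equate `θ x` and `x` for each head variable `x`. All other variables are fixed by
`θ`. -/
theorem realize_eq (hCT : ContainsClarkEquality CT) (h : UnfoldingData CT cl v₀ S1 S2 ρ θ K)
    {μ : ℕ → M} (hb : Sat cl.bodyB μ) (hg : Sat cl.guard μ)
    (hS : (chrOf (S1 ++ S2)).map (UAtom.eval μ) =
      ((v₀.rename ρ).H1 ++ (v₀.rename ρ).H2).map (UAtom.eval μ)) :
    (fun x => (θ x).realize μ) = μ := by
  funext x
  by_cases hx : θ x = FirstOrder.Language.Term.var x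
  · rw [hx]; rfl
  · exact hCT.eq_of_eval_eq M ((h.eval_matching hb hg).symm.trans hS) x (h.dom x hx)

/-- Each instantiated guard constraint is either entailed by the built-in constraints of `cl` or
kept in the residual guard. -/
theorem sat_guard (_h : UnfoldingData CT cl v₀ S1 S2 ρ θ K) {μ : ℕ → M}
    (hb : Sat cl.bodyB μ) (hg : Sat cl.guard μ)
    (hr : Sat (conjSubst θ
      (residualGuard CT (cl.bodyB + cl.guard) θ (v₀.rename ρ).guard)) μ) :
    Sat (v₀.rename ρ).guard fun x => (θ x).realize μ := by
  intro d hd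
  rw [← Builtin.holds_subst]
  by_cases he : Entails CT (cl.bodyB + cl.guard) {d.subst θ}
  · exact sat_singleton.1 (he M μ (sat_add.2 ⟨hb, hg⟩))
  · exact hr _ (Multiset.mem_map_of_mem _ (mem_residualGuard.2 ⟨hd, he⟩))

/-- The built-in constraints of the unfolded rule amount to those of the two rules together with
the matching of the selected constraints. -/
theorem sat_unfoldedRule (hCT : ContainsClarkEquality CT)
    (h : UnfoldingData CT cl v₀ S1 S2 ρ θ K) {μ : ℕ → M} :
    Sat (unfoldedRule CT cl (v₀.rename ρ) θ K S1 S2).guard μ ∧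
        Sat (unfoldedRule CT cl (v₀.rename ρ) θ K S1 S2).bodyB μ ↔
      Sat cl.guard μ ∧ Sat cl.bodyB μ ∧
        (chrOf (S1 ++ S2)).map (UAtom.eval μ) = (v₀.H1 ++ v₀.H2).map (UAtom.eval (μ ∘ ρ)) ∧
        Sat v₀.guard (μ ∘ ρ) ∧ Sat v₀.bodyB (μ ∘ ρ) := by
  have hsym : (chrOf (S1 ++ S2)).map UAtom.sym =
      ((v₀.rename ρ).H1 ++ (v₀.rename ρ).H2).map UAtom.sym := by rw [sym_rename_heads, h.sym]
  simp only [unfoldedRule, sat_add, sat_matchEqs hsym]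
  rw [← eval_rename_heads, ← sat_rename_guard, ← sat_rename_bodyB]
  constructor
  · rintro ⟨⟨g1, g2⟩, ⟨b1, b2⟩, b3⟩
    have := sat_guard h b2 g1 g2
    rw [h.realize_eq hCT b2 g1 b3] at this
    exact ⟨g1, b2, b3, this, b1⟩
  · rintro ⟨g1, b2, b3, g2, b1⟩
    refine ⟨⟨g1, ?_⟩, ⟨b1, b2⟩, b3⟩
    rw [sat_subst, h.realize_eq hCT b2 g1 b3]
    exact fun d hd => g2 d (mem_residualGuard.1 hd).1

/-- After `cl` has been applied with a valuation that can be modified to one that also satisfies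
the residual guard, the rule `v₀` is applicable. -/
theorem exists_sat_guard (hCT : ContainsClarkEquality CT)
    (h : UnfoldingData CT cl v₀ S1 S2 ρ θ K) {μ μ' : ℕ → M}
    (hb : Sat cl.bodyB μ) (hg : Sat cl.guard μ)
    (hH : (cl.H1 ++ cl.H2).map (UAtom.eval μ) = (cl.H1 ++ cl.H2).map (UAtom.eval μ'))
    (hr : Sat (conjSubst θ
      (residualGuard CT (cl.bodyB + cl.guard) θ (v₀.rename ρ).guard)) μ') :
    ∃ η : ℕ → M, (chrOf (S1 ++ S2)).map (UAtom.eval μ) =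
      (v₀.H1 ++ v₀.H2).map (UAtom.eval η) ∧ Sat v₀.guard η := by
  -- The merged valuation keeps the values with which `cl` was applied, including its local
  -- variables, and takes all others from `μ'`, for which the residual guard holds.
  have hagree : ∀ x ∈ cl.vars, merge cl.vars μ μ' x = μ x := fun x hx => merge_of_mem hx
  have hb' : Sat cl.bodyB (merge cl.vars μ μ') :=
    (sat_congr fun x hx => hagree x (cl.conjVars_bodyB_subset hx)).2 hb
  have hg' : Sat cl.guard (merge cl.vars μ μ') :=
    (sat_congr fun x hx => hagree x (cl.conjVars_guard_subset hx)).2 hg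
  have hr' : Sat (conjSubst θ
      (residualGuard CT (cl.bodyB + cl.guard) θ (v₀.rename ρ).guard)) (merge cl.vars μ μ') := by
    refine (sat_congr fun z hz => ?_).2 hr
    -- It remains to see that a variable of the residual guard that occurs in `cl` is a head
    -- variable of `cl`; there `μ` and `μ'` agree by Clark's axioms.
    by_cases hzc : z ∈ cl.vars
    · rw [hagree z hzc]
      refine hCT.eq_of_eval_eq M hH z ?_
      obtain ⟨x, hx, hzx⟩ := mem_conjVars_subst.1 hz
      by_cases hxh : x ∈ (v₀.rename ρ).headVars
      · exact h.vars ⟨hz, mem_atomsVars_subst.2 ⟨x, hxh, hzx⟩⟩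
      -- Outside the head of the variant `θ` is the identity, so `z` would itself be a guard
      -- variable of the variant, which shares no variable with `cl`.
      · have hθ : θ x = FirstOrder.Language.Term.var x := by
          by_contra hne
          exact hxh (h.dom x hne)
        rw [hθ, mem_termVars_var] at hzx
        subst hzx
        obtain ⟨d, hd, hx⟩ := hx
        exact absurd ((v₀.rename ρ).conjVars_guard_subset ⟨d, (mem_residualGuard.1 hd).1, hx⟩)
          (Set.disjoint_left.1 h.disjoint hzc)
    · exact merge_of_notMem hzc
  refine ⟨(fun x => (θ x).realize (merge cl.vars μ μ')) ∘ ρ, ?_, ?_⟩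
  · rw [← eval_rename_heads, ← h.eval_matching hb' hg']
    exact map_eval_congr fun x hx => (hagree x (h.atomsVars_subset hx)).symm
  · rw [← sat_rename_guard]
    exact sat_guard h hb' hg' hr'

theorem ids_S2_notMem (h : UnfoldingData CT cl v₀ S1 S2 ρ θ K) (hcl : cl.WF) {s k : IdAtom L Q}
    (hs : s ∈ S2) (hk : k ∈ K + (S1 : Multiset _)) : k.id ≠ s.id := by
  have hnd := hcl.2.1
  rw [h.body, Multiset.map_add] at hnd
  intro he
  refine Multiset.disjoint_left.1 (Multiset.nodup_add.1 hnd).2.2 (Multiset.mem_map_of_mem _ hk) ?_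
  rw [he]
  exact Multiset.mem_map_of_mem _ (by simpa using hs)

theorem wf_unfoldedRule (h : UnfoldingData CT cl v₀ S1 S2 ρ θ K) (hcl : cl.WF) (hv : v₀.WF) :
    (unfoldedRule CT cl (v₀.rename ρ) θ K S1 S2).WF := by
  have hv' := hv.rename ρ
  have hnd := hcl.2.1
  rw [h.body, Multiset.map_add] at hnd
  have hpos : ∀ k ∈ K + (S1 : Multiset _), 0 < k.id := fun k hk => hcl.2.2.1 k (h.mem_body' hk)
  have hinst : ∀ t ∈ (inst (v₀.rename ρ).body (v₀.rename ρ).tokens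
      (maxId cl.body cl.tokens)).2.1, t.WF := by
    intro t ht
    obtain ⟨t, ht', rfl⟩ := Finset.mem_image.1 ht
    refine ⟨(hv'.2.2.2 t ht').1.map (add_left_injective _), fun i hi => ?_⟩
    obtain ⟨j, hj, rfl⟩ := List.mem_map.1 hi
    have := (hv'.2.2.2 t ht').2 j hj
    omega
  refine ⟨hcl.1, ?_, ?_, ?_⟩
  · simp only [unfoldedRule]
    rw [Multiset.map_add]
    refine Multiset.nodup_add.2 ⟨(Multiset.nodup_add.1 hnd).1, ?_, Multiset.disjoint_left.2 ?_⟩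
    · simp only [inst, Multiset.map_map]
      have : (IdAtom.id ∘ IdAtom.mapId (fun i => i + maxId cl.body cl.tokens) :
        IdAtom L Q → ℕ) = (fun i => i + maxId cl.body cl.tokens) ∘ IdAtom.id := rfl
      rw [this, ← Multiset.map_map]
      exact hv'.2.1.map (add_left_injective _)
    · intro i hi hi'
      obtain ⟨k, hk, rfl⟩ := Multiset.mem_map.1 hi
      obtain ⟨k', hk', he⟩ := Multiset.mem_map.1 hi'
      obtain ⟨b, hb, rfl⟩ := Multiset.mem_map.1 hk'
      have h1 := hv'.2.2.1 b hb
      have h2 := id_le_maxId (T := cl.tokens) (h.mem_body' hk)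
      simp only [IdAtom.mapId] at he
      omega
  · intro k hk
    rcases Multiset.mem_add.1 hk with hk | hk
    · exact hpos k hk
    · obtain ⟨b, hb, rfl⟩ := Multiset.mem_map.1 hk
      have := hv'.2.2.1 b hb
      simp only [IdAtom.mapId]
      omega
  · intro t ht
    simp only [unfoldedRule] at ht
    split_ifs at ht with hH
    · rcases Finset.mem_union.1 ht with ht | ht
      · rcases Finset.mem_union.1 ht with ht | ht
        · exact hcl.2.2.2 t ht
        · exact hinst t ht
      · rw [Finset.mem_singleton] at ht
        subst ht
        constructor
        · have := (Multiset.nodup_add.1 hnd).1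
          rw [Multiset.map_add] at this
          simpa [idsOf] using (Multiset.nodup_add.1 this).2.1
        · intro i hi
          obtain ⟨k, hk, rfl⟩ := List.mem_map.1 hi
          exact hpos k (Multiset.mem_add.2 (Or.inr (by simpa using hk)))
    · rcases Finset.mem_union.1 ht with ht | ht
      · exact hcl.2.2.2 t (Finset.mem_filter.1 ht).1
      · exact hinst t ht

/-- The tokens of the unfolded rule that concern constraints of its body. -/
theorem mem_tokens_unfoldedRule (h : UnfoldingData CT cl v₀ S1 S2 ρ θ K) (hcl : cl.WF)
    {t : Token} (ht : ∀ i ∈ t.ids, i ∈ (K + (S1 : Multiset _)).map IdAtom.id ∨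
      maxId cl.body cl.tokens < i) :
    t ∈ (unfoldedRule CT cl (v₀.rename ρ) θ K S1 S2).tokens ↔
      t ∈ cl.tokens ∨ t = ⟨v₀.name, idsOf (S1 ++ S2)⟩ ∨
        ∃ t' ∈ v₀.tokens, t'.mapId (fun i => i + maxId cl.body cl.tokens) = t := by
  have hlen : S2.length = v₀.H2.length := by
    simpa [chrOf] using congrArg List.length h.sym2
  by_cases hH : v₀.H2 = []
  -- If `v₀` removes nothing, `S2` is empty and the recorded token is exactly the one left by
  -- applying `v₀`.
  · have hS : S2 = [] := List.length_eq_zero_iff.1 (by rw [hlen, hH]; rfl)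
    simp only [unfoldedRule, AnnRule.rename, hH, List.map_nil, List.isEmpty_nil, if_true,
      Finset.mem_union, Finset.mem_singleton, inst, Finset.mem_image, hS, List.append_nil]
    exact or_assoc.trans (or_congr_right or_comm)
  · have hH' : ¬ ((v₀.rename ρ).H2.isEmpty = true) := by simpa [AnnRule.rename] using hH
    have htok : (unfoldedRule CT cl (v₀.rename ρ) θ K S1 S2).tokens =
        clean (K + (S1 : Multiset _)) cl.tokens ∪
          (inst (v₀.rename ρ).body (v₀.rename ρ).tokens (maxId cl.body cl.tokens)).2.1 :=
      if_neg hH'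
    rw [htok]
    simp only [Finset.mem_union, inst, Finset.mem_image]
    -- Identifiers in tokens of `cl` are at most `maxId`, so the assumption on `t` places them all
    -- in `K, S1`, and `clean` keeps `t`.
    have h1 : t ∈ clean (K + (S1 : Multiset _)) cl.tokens ↔ t ∈ cl.tokens := by
      refine ⟨fun h => (Finset.mem_filter.1 h).1, fun hm => Finset.mem_filter.2 ⟨hm, ?_⟩⟩
      intro i hi
      have := token_id_le_maxId (B := cl.body) hm hi
      rcases ht i hi with h | h
      · exact h
      · omega
    -- The token of the application of `v₀` names a removed constraint of `S2`, which `t` cannot do;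
    -- omitting it from the unfolded rule is harmless.
    have h2 : t ≠ ⟨v₀.name, idsOf (S1 ++ S2)⟩ := by
      rintro rfl
      obtain ⟨s, hs⟩ := List.exists_mem_of_length_pos (l := S2)
        (by rw [hlen]; exact List.length_pos_iff.2 hH)
      rcases ht s.id (List.mem_map_of_mem (by simp [hs])) with hi | hi
      · obtain ⟨k, hk, he⟩ := Multiset.mem_map.1 hi
        exact h.ids_S2_notMem hcl hs hk he
      · have := id_le_maxId (T := cl.tokens) (h.mem_body (k := s) (by simp [hs]))
        omega
    rw [h1]
    simp [h2, AnnRule.rename]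

/-- If all of the guard of `v₀` is entailed for one choice of the renaming and of the matching
substitution, then it is for every choice. -/
theorem residualGuard_eq_zero (hCT : ContainsClarkEquality CT)
    {ρ' : Equiv.Perm ℕ} {θ' : ℕ → L.Term ℕ} {K' : Multiset (IdAtom L Q)}
    (h : UnfoldingData CT cl v₀ S1 S2 ρ θ K) (h' : UnfoldingData CT cl v₀ S1 S2 ρ' θ' K')
    (hent : Entails CT cl.guard
      (conjSubst θ (residualGuard CT (cl.bodyB + cl.guard) θ (v₀.rename ρ).guard))) :
    residualGuard CT (cl.bodyB + cl.guard) θ' (v₀.rename ρ').guard = 0 := by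
  refine Multiset.eq_zero_of_forall_notMem fun d' hd'' => ?_
  obtain ⟨hd', hne⟩ := mem_residualGuard.1 hd''
  refine hne fun M ν hν => ?_
  obtain ⟨d, hd, rfl⟩ := Multiset.mem_map.1 hd'
  rw [sat_add] at hν
  rw [sat_singleton, Builtin.holds_subst, Builtin.holds_subst]
  -- `η` agrees with `ν` on `cl` and gives the variables of the first variant the values of the
  -- corresponding variables of the second.
  let η : ℕ → M := merge cl.vars ν fun z => ν (ρ' (ρ.symm z))
  have hagree : ∀ x ∈ cl.vars, η x = ν x := fun x hx => merge_of_mem hx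
  have hb : Sat cl.bodyB η :=
    (sat_congr fun x hx => hagree x (cl.conjVars_bodyB_subset hx)).2 hν.1
  have hg : Sat cl.guard η :=
    (sat_congr fun x hx => hagree x (cl.conjVars_guard_subset hx)).2 hν.2
  have h1 := sat_guard h hb hg (hent M η hg) _ (Multiset.mem_map_of_mem _ hd)
  rw [Builtin.holds_subst] at h1
  refine (Builtin.holds_congr fun x hx => ?_).1 h1
  -- Both substitutions match the same constraints with the same head, so by Clark's axioms they
  -- give its variables equal values. The other guard variables are fixed by both and agree by the
  -- choice of `η`.
  have hev := h.eval_matching hb hg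
  rw [map_eval_congr fun x hx => hagree x (h.atomsVars_subset hx), h'.eval_matching hν.1 hν.2,
    eval_rename_heads, eval_rename_heads] at hev
  by_cases hxh : x ∈ v₀.headVars
  · exact (hCT.eq_of_eval_eq M hev x hxh).symm
  · have hθ : ∀ (π : Equiv.Perm ℕ) (θ : ℕ → L.Term ℕ),
        (∀ x, θ x ≠ FirstOrder.Language.Term.var x → x ∈ (v₀.rename π).headVars) →
          θ (π x) = FirstOrder.Language.Term.var (π x) := by
      intro π θ hdom
      by_contra hne
      have := hdom _ hne
      rw [AnnRule.headVars_rename] at this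
      obtain ⟨y, hy, hyx⟩ := this
      exact hxh (π.injective hyx ▸ hy)
    simp only [FirstOrder.Language.Term.realize]
    rw [hθ ρ θ h.dom, hθ ρ' θ' h'.dom]
    simp only [FirstOrder.Language.Term.realize]
    have hxv : ρ x ∈ (v₀.rename ρ).vars := by
      rw [AnnRule.vars_rename]
      exact Set.mem_image_of_mem _ (v₀.conjVars_guard_subset ⟨d, hd, hx⟩)
    have : η (ρ x) = ν (ρ' (ρ.symm (ρ x))) :=
      merge_of_notMem (Set.disjoint_right.1 h.disjoint hxv)
    simpa using this

end UnfoldingData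

end UnfoldedRules
-- One unfolded step against two original steps
section UnfoldingStep

variable {L : FirstOrder.Language.{u, v}} {Q : ℕ → Type w}

/-- The identified constraint that a rule application produces from `b`. -/
def IdAtom.place (ρ : Equiv.Perm ℕ) (n : ℕ) (b : IdAtom L Q) : IdAtom L Q :=
  (b.subst fun x => FirstOrder.Language.Term.var (ρ x)).mapId fun i => i + n

@[simp] theorem IdAtom.place_id (ρ : Equiv.Perm ℕ) (n : ℕ) (b : IdAtom L Q) :
    (b.place ρ n).id = b.id + n := rfl

@[simp] theorem IdAtom.place_sym (ρ : Equiv.Perm ℕ) (n : ℕ) (b : IdAtom L Q) :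
    (b.place ρ n).atom.sym = b.atom.sym := rfl

theorem IdAtom.eval_place {M : Type*} [L.Structure M] (ρ : Equiv.Perm ℕ) (n : ℕ)
    (b : IdAtom L Q) (ν : ℕ → M) : (b.place ρ n).atom.eval ν = b.atom.eval (ν ∘ ρ) :=
  eval_rename

theorem map_eval_place {M : Type*} [L.Structure M] (ρ : Equiv.Perm ℕ) (n : ℕ)
    (S : List (IdAtom L Q)) (ν : ℕ → M) :
    (chrOf (S.map (IdAtom.place ρ n))).map (UAtom.eval ν) =
      (chrOf S).map (UAtom.eval (ν ∘ ρ)) := by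
  simp [chrOf, IdAtom.eval_place]

theorem map_sym_place (ρ : Equiv.Perm ℕ) (n : ℕ) (S : List (IdAtom L Q)) :
    (chrOf (S.map (IdAtom.place ρ n))).map UAtom.sym = (chrOf S).map UAtom.sym := by
  simp [chrOf]

theorem inst_rename_body (r : AnnRule L Q) (ρ : Equiv.Perm ℕ) (n : ℕ) :
    (inst (r.rename ρ).body (r.rename ρ).tokens n).1 = r.body.map (IdAtom.place ρ n) := by
  simp only [inst, AnnRule.rename, Multiset.map_map]
  rfl

theorem idsOf_place (ρ : Equiv.Perm ℕ) (n : ℕ) (S : List (IdAtom L Q)) :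
    idsOf (S.map (IdAtom.place ρ n)) = (idsOf S).map fun i => i + n := by
  simp [idsOf]

theorem Token.mapId_add_injective (n : ℕ) : Function.Injective (Token.mapId fun i => i + n) := by
  rintro ⟨a, l⟩ ⟨b, l'⟩ h
  simp only [Token.mapId, Token.mk.injEq] at h
  rw [h.1, (List.map_injective_iff.2 (add_left_injective n)) h.2]

variable {CT : L.Theory} {V : Set ℕ} {cl v₀ : AnnRule L Q} {S1 S2 : List (IdAtom L Q)}
  {ρ : Equiv.Perm ℕ} {θ : ℕ → L.Term ℕ} {K : Multiset (IdAtom L Q)}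

/-- The pairing of the constraints produced by the unfolded rule with those produced by `cl` and
`v₀`. -/
def unfoldPairs (v₀ : AnnRule L Q) (S1 : List (IdAtom L Q)) (ρ : Equiv.Perm ℕ)
    (K : Multiset (IdAtom L Q)) (m n : ℕ) (ρ' ρ1 ρ2 : Equiv.Perm ℕ)
    (K1 : List (IdAtom L Q)) (S : Multiset (IdAtom L Q)) :
    Multiset (IdAtom L Q × IdAtom L Q) :=
  (K + ↑S1).map (fun b => (b.place ρ' n, b.place ρ1 n)) +
    v₀.body.map (fun b => ((b.place ρ m).place ρ' n, b.place ρ2 (m + n))) +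
    (↑K1 + S).map fun k => (k, k)

theorem UnfoldingData.body_unfoldedRule :
    (unfoldedRule CT cl (v₀.rename ρ) θ K S1 S2).body =
      K + ↑S1 + v₀.body.map (IdAtom.place ρ (maxId cl.body cl.tokens)) := by
  simp only [unfoldedRule, inst_rename_body]

theorem mem_unfoldPairs {m n : ℕ} {ρ' ρ1 ρ2 : Equiv.Perm ℕ} {K1 : List (IdAtom L Q)}
    {S : Multiset (IdAtom L Q)} {p : IdAtom L Q × IdAtom L Q} :
    p ∈ unfoldPairs v₀ S1 ρ K m n ρ' ρ1 ρ2 K1 S ↔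
      (∃ b ∈ K + (S1 : Multiset _), (b.place ρ' n, b.place ρ1 n) = p) ∨
      (∃ b ∈ v₀.body, ((b.place ρ m).place ρ' n, b.place ρ2 (m + n)) = p) ∨
      ∃ k ∈ (K1 : Multiset _) + S, (k, k) = p := by
  simp only [unfoldPairs, Multiset.mem_add, Multiset.mem_map, or_assoc]

/-- Shifting by `m` during the unfolding and by `n` at application equals shifting by the counter `m
+ n` reached after `cl`. Paired constraints thus carry the same identifier, and tokens can be
compared literally. -/
theorem id_eq_of_mem_unfoldPairs {m n : ℕ} {ρ' ρ1 ρ2 : Equiv.Perm ℕ} {K1 : List (IdAtom L Q)}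
    {S : Multiset (IdAtom L Q)} {p : IdAtom L Q × IdAtom L Q}
    (hp : p ∈ unfoldPairs v₀ S1 ρ K m n ρ' ρ1 ρ2 K1 S) : p.1.id = p.2.id := by
  rcases mem_unfoldPairs.1 hp with ⟨b, -, rfl⟩ | ⟨b, -, rfl⟩ | ⟨k, -, rfl⟩
  · rfl
  · simp [add_assoc]
  · rfl

/-- The tokens of live constraints after the application of the unfolded rule, and after that of
`cl` and `v₀`. -/
theorem UnfoldingData.mem_tokens_fire (h : UnfoldingData CT cl v₀ S1 S2 ρ θ K) (hcl : cl.WF)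
    (hv : v₀.WF) {τ τ2 : Config L Q} {K1 K2 : List (IdAtom L Q)} {S S' : Multiset (IdAtom L Q)}
    {ρ' ρ1 ρ2 : Equiv.Perm ℕ} (hτ : τ.WF) (hchr : τ.chr = ↑K1 + ↑K2 + S)
    (htok : τ2.tokens = (fire cl ρ1 τ K1 K2 S).tokens)
    (hcount : τ2.counter = (fire cl ρ1 τ K1 K2 S).counter) {t : Token}
    (ht : ∀ i ∈ t.ids, ∃ p ∈ unfoldPairs v₀ S1 ρ K (maxId cl.body cl.tokens) τ.counter ρ' ρ1 ρ2 K1 S,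
      p.2.id = i) :
    t ∈ (fire (unfoldedRule CT cl (v₀.rename ρ) θ K S1 S2) ρ' τ K1 K2 S).tokens ↔
      t ∈ (fire v₀ ρ2 τ2 (S1.map (IdAtom.place ρ1 τ.counter))
        (S2.map (IdAtom.place ρ1 τ.counter)) S').tokens := by
  have hcount' : τ2.counter = maxId cl.body cl.tokens + τ.counter := by
    rw [hcount]
    simp [fire, inst]
  have hids : ∀ i ∈ t.ids, i ≤ τ.counter ∨
      ∃ j, i = j + τ.counter ∧
        (j ∈ (K + (S1 : Multiset _)).map IdAtom.id ∨ maxId cl.body cl.tokens < j) := by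
    intro i hi
    obtain ⟨p, hp, rfl⟩ := ht i hi
    rcases mem_unfoldPairs.1 hp with ⟨b, hb, rfl⟩ | ⟨b, hb, rfl⟩ | ⟨k, hk, rfl⟩
    · exact Or.inr ⟨b.id, rfl, Or.inl (Multiset.mem_map_of_mem _ hb)⟩
    · have := hv.2.2.1 b hb
      exact Or.inr ⟨b.id + maxId cl.body cl.tokens, by simp [add_assoc], Or.inr (by omega)⟩
    · refine Or.inl (hτ.2.1 k ?_).2
      rw [hchr]
      simp only [Multiset.mem_add] at hk ⊢
      tauto
  have key : (∃ t₀ ∈ (unfoldedRule CT cl (v₀.rename ρ) θ K S1 S2).tokens,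
        t₀.mapId (fun i => i + τ.counter) = t) ↔
      (∃ t₀ ∈ cl.tokens, t₀.mapId (fun i => i + τ.counter) = t) ∨
      t = ⟨v₀.name, (idsOf (S1 ++ S2)).map fun i => i + τ.counter⟩ ∨
      ∃ t₀ ∈ v₀.tokens, t₀.mapId (fun i => i + (maxId cl.body cl.tokens + τ.counter)) = t := by
    have aux : ∀ t₀ : Token, (∀ i ∈ t₀.ids, 0 < i) → t₀.mapId (fun i => i + τ.counter) = t →
        (t₀ ∈ (unfoldedRule CT cl (v₀.rename ρ) θ K S1 S2).tokens ↔
          t₀ ∈ cl.tokens ∨ t₀ = ⟨v₀.name, idsOf (S1 ++ S2)⟩ ∨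
        ∃ t' ∈ v₀.tokens, t'.mapId (fun i => i + maxId cl.body cl.tokens) = t₀) := by
      -- Positive identifiers exceed `τ.counter` after the shift, so those of `t₀` refer to
      -- constraints of the unfolded body.
      rintro t₀ hpos rfl
      refine h.mem_tokens_unfoldedRule hcl fun i hi => ?_
      have := hpos i hi
      rcases hids (i + τ.counter) (List.mem_map_of_mem hi) with hle | ⟨j, hj, hj'⟩
      · omega
      · obtain rfl : i = j := by omega
        exact hj'
    have hcomp : ∀ t' : Token, (t'.mapId (fun i => i + maxId cl.body cl.tokens)).mapId
        (fun i => i + τ.counter) =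
          t'.mapId (fun i => i + (maxId cl.body cl.tokens + τ.counter)) := by
      intro t'
      simp [Token.mapId]
    constructor
    · rintro ⟨t₀, h0, he⟩
      rcases (aux t₀ ((h.wf_unfoldedRule hcl hv).2.2.2 t₀ h0).2 he).1 h0 with h1 | rfl | ⟨t', h1, rfl⟩
      · exact Or.inl ⟨t₀, h1, he⟩
      · exact Or.inr (Or.inl he.symm)
      · exact Or.inr (Or.inr ⟨t', h1, (hcomp t').symm.trans he⟩)
    · rintro (⟨t₀, h0, he⟩ | rfl | ⟨t', h1, he⟩)
      · exact ⟨t₀, (aux t₀ (hcl.2.2.2 t₀ h0).2 he).2 (Or.inl h0), he⟩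
      · refine ⟨⟨v₀.name, idsOf (S1 ++ S2)⟩, (aux _ ?_ rfl).2 (Or.inr (Or.inl rfl)), rfl⟩
        intro i hi
        obtain ⟨k, hk, rfl⟩ := List.mem_map.1 hi
        exact hcl.2.2.1 k (h.mem_body hk)
      · rw [← hcomp] at he
        refine ⟨_, (aux _ ?_ he).2 (Or.inr (Or.inr ⟨t', h1, rfl⟩)), he⟩
        intro i hi
        obtain ⟨j, hj, rfl⟩ := List.mem_map.1 hi
        have := (hv.2.2.2 t' h1).2 j hj
        omega
  have e1 : t ∈ (fire (unfoldedRule CT cl (v₀.rename ρ) θ K S1 S2) ρ' τ K1 K2 S).tokens ↔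
      (t ∈ τ.tokens ∨ t = ⟨cl.name, idsOf (K1 ++ K2)⟩) ∨
        ∃ t₀ ∈ (unfoldedRule CT cl (v₀.rename ρ) θ K S1 S2).tokens,
          t₀.mapId (fun i => i + τ.counter) = t := by
    simp only [fire, inst, Finset.mem_union, Finset.mem_singleton, Finset.mem_image]
    rfl
  have e2 : t ∈ (fire v₀ ρ2 τ2 (S1.map (IdAtom.place ρ1 τ.counter))
        (S2.map (IdAtom.place ρ1 τ.counter)) S').tokens ↔
      (((t ∈ τ.tokens ∨ t = ⟨cl.name, idsOf (K1 ++ K2)⟩) ∨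
        ∃ t₀ ∈ cl.tokens, t₀.mapId (fun i => i + τ.counter) = t) ∨
        t = ⟨v₀.name, (idsOf (S1 ++ S2)).map fun i => i + τ.counter⟩) ∨
      ∃ t₀ ∈ v₀.tokens, t₀.mapId (fun i => i + (maxId cl.body cl.tokens + τ.counter)) = t := by
    rw [← hcount', ← idsOf_place ρ1]
    simp only [fire, htok, inst, Finset.mem_union, Finset.mem_singleton, Finset.mem_image,
      List.map_append]
    rfl
  rw [e1, e2, key]
  simp only [or_assoc]

theorem fire_chr_place (r : AnnRule L Q) (ρ : Equiv.Perm ℕ) (σ : Config L Q)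
    (K1 K2 : List (IdAtom L Q)) (S : Multiset (IdAtom L Q)) :
    (fire r ρ σ K1 K2 S).chr = r.body.map (IdAtom.place ρ σ.counter) + ↑K1 + S := by
  simp only [fire, inst_rename_body]

/-- By `sat_unfoldedRule` the valuation of the unfolded rule satisfies the constraints of `cl`, the
matching and the constraints of `v₀`. The solution therefore extends first along the variant of
`cl`, then along that of `v₀`. -/
theorem UnfoldingData.forth_fire (hCT : ContainsClarkEquality CT)
    (h : UnfoldingData CT cl v₀ S1 S2 ρ θ K) (hcl : cl.WF) (hv : v₀.WF) {τ τ2 : Config L Q}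
    {K1 K2 : List (IdAtom L Q)} {S : Multiset (IdAtom L Q)}
    {ρ' ρ1 ρ2 : Equiv.Perm ℕ} (hτ : τ.WF) (hVτ : V ⊆ τ.vars) (hchr : τ.chr = ↑K1 + ↑K2 + S)
    (hsym : (chrOf (K1 ++ K2)).map UAtom.sym = (cl.H1 ++ cl.H2).map UAtom.sym)
    (hρ1 : Disjoint (cl.rename ρ1).vars τ.vars) (hρ2 : Disjoint (v₀.rename ρ2).vars τ2.vars)
    (hc : τ2.chr = (fire cl ρ1 τ K1 K2 S).chr)
    (htot : τ2.total = (fire cl ρ1 τ K1 K2 S).total)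
    (htok : τ2.tokens = (fire cl ρ1 τ K1 K2 S).tokens)
    (hcount : τ2.counter = (fire cl ρ1 τ K1 K2 S).counter) :
    Forth CT V (unfoldPairs v₀ S1 ρ K (maxId cl.body cl.tokens) τ.counter ρ' ρ1 ρ2 K1 S)
      (fire (unfoldedRule CT cl (v₀.rename ρ) θ K S1 S2) ρ' τ K1 K2 S)
      (fire v₀ ρ2 τ2 (S1.map (IdAtom.place ρ1 τ.counter)) (S2.map (IdAtom.place ρ1 τ.counter))
        (K.map (IdAtom.place ρ1 τ.counter) + ↑K1 + S)) := by
  have hvars : τ.vars ⊆ τ2.vars := by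
    rw [Config.vars_eq τ2, hc, htot, ← Config.vars_eq]
    exact vars_subset_fire hchr hsym
  have hchr2 : τ2.chr = ↑(S1.map (IdAtom.place ρ1 τ.counter)) +
      ↑(S2.map (IdAtom.place ρ1 τ.counter)) + (K.map (IdAtom.place ρ1 τ.counter) + ↑K1 + S) := by
    rw [hc, fire_chr_place, h.body]
    simp only [Multiset.map_add, Multiset.map_coe]
    abel
  have hsym2 : (chrOf (S1.map (IdAtom.place ρ1 τ.counter) ++
      S2.map (IdAtom.place ρ1 τ.counter))).map UAtom.sym = (v₀.H1 ++ v₀.H2).map UAtom.sym := by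
    rw [← List.map_append, map_sym_place, h.sym]
  refine ⟨fun name ps hps ht => ?_, fun M ν hν => ?_⟩
  · have hid : ∀ p ∈ ps, p.2.id = p.1.id := fun p hp => (id_eq_of_mem_unfoldPairs (hps p hp)).symm
    refine (h.mem_tokens_fire hcl hv hτ hchr htok hcount (ρ' := ρ') fun i hi => ?_).1 ?_
    · obtain ⟨p, hp, rfl⟩ := List.mem_map.1 hi
      exact ⟨p, hps p hp, rfl⟩
    · rwa [List.map_congr_left hid]
  · obtain ⟨e1, e2, e3, e4⟩ := (sat_total_fire (r := unfoldedRule CT cl (v₀.rename ρ) θ K S1 S2)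
      hsym).1 hν
    obtain ⟨f1, f2, f3, f4, f5⟩ := (h.sat_unfoldedRule hCT).1 ⟨e2, e3⟩
    obtain ⟨ν₁, g1, g2, g3⟩ := exists_sat_total_fire hchr hsym hρ1 e4 e1 f1 f2
    rw [← htot] at g1
    obtain ⟨ν₂, i1, i2, i3⟩ := exists_sat_total_fire (r := v₀) (μ := (ν ∘ ρ') ∘ ρ)
      hchr2 hsym2 hρ2 g1 (by
        rw [← f3, ← List.map_append, map_eval_place]
        exact map_eval_congr fun x hx => g3 x (h.atomsVars_subset hx)) f4 f5
    refine ⟨ν₂, fun x hx => (i2 x (hvars (hVτ hx))).trans (g2 x (hVτ hx)), i1, fun p hp => ?_⟩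
    rcases mem_unfoldPairs.1 hp with ⟨b, hb, rfl⟩ | ⟨b, hb, rfl⟩ | ⟨k, hk, rfl⟩
    · have hmem : b.place ρ1 τ.counter ∈ τ2.chr := by
        rw [hc, fire_chr_place]
        exact Multiset.mem_add.2 (Or.inl (Multiset.mem_add.2 (Or.inl
          (Multiset.mem_map_of_mem _ (h.mem_body' hb)))))
      rw [UAtom.eval_congr fun x hx => i2 x (Config.atomVars_subset hmem hx)]
      simp only [IdAtom.eval_place]
      exact UAtom.eval_congr fun x hx =>
        (g3 x (cl.idAtomsVars_body_subset ⟨b, h.mem_body' hb, hx⟩)).symm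
    · simp only [IdAtom.eval_place]
      exact UAtom.eval_congr fun x hx => (i3 x (v₀.idAtomsVars_body_subset ⟨b, hb, hx⟩)).symm
    · have hmem : k ∈ τ.chr := by
        rw [hchr]
        simp only [Multiset.mem_add] at hk ⊢
        tauto
      refine UAtom.eval_congr fun x hx => ?_
      have hx := Config.atomVars_subset hmem hx
      exact ((i2 x (hvars hx)).trans (g2 x hx)).symm

/-- The two applications give values to the variables of `cl` and of `v₀` separately. As the rules
were renamed apart for the unfolding, these values combine into one valuation `μ` of the unfolded
rule. -/
theorem UnfoldingData.back_fire (hCT : ContainsClarkEquality CT)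
    (h : UnfoldingData CT cl v₀ S1 S2 ρ θ K) (hcl : cl.WF) (hv : v₀.WF) {τ τ2 : Config L Q}
    {K1 K2 : List (IdAtom L Q)} {S : Multiset (IdAtom L Q)}
    {ρ' ρ1 ρ2 : Equiv.Perm ℕ} (hτ : τ.WF) (hVτ : V ⊆ τ.vars) (hchr : τ.chr = ↑K1 + ↑K2 + S)
    (hsym : (chrOf (K1 ++ K2)).map UAtom.sym = (cl.H1 ++ cl.H2).map UAtom.sym)
    (hρ' : Disjoint ((unfoldedRule CT cl (v₀.rename ρ) θ K S1 S2).rename ρ').vars τ.vars)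
    (htot : τ2.total = (fire cl ρ1 τ K1 K2 S).total)
    (htok : τ2.tokens = (fire cl ρ1 τ K1 K2 S).tokens)
    (hcount : τ2.counter = (fire cl ρ1 τ K1 K2 S).counter) :
    Forth CT V ((unfoldPairs v₀ S1 ρ K (maxId cl.body cl.tokens) τ.counter ρ' ρ1 ρ2 K1 S).map
        Prod.swap)
      (fire v₀ ρ2 τ2 (S1.map (IdAtom.place ρ1 τ.counter)) (S2.map (IdAtom.place ρ1 τ.counter))
        (K.map (IdAtom.place ρ1 τ.counter) + ↑K1 + S))
      (fire (unfoldedRule CT cl (v₀.rename ρ) θ K S1 S2) ρ' τ K1 K2 S) := by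
  have hsym2 : (chrOf (S1.map (IdAtom.place ρ1 τ.counter) ++
      S2.map (IdAtom.place ρ1 τ.counter))).map UAtom.sym = (v₀.H1 ++ v₀.H2).map UAtom.sym := by
    rw [← List.map_append, map_sym_place, h.sym]
  refine ⟨fun name ps hps ht => ?_, fun M ν hν => ?_⟩
  · have hps' : ∀ p ∈ ps, p.swap ∈
        unfoldPairs v₀ S1 ρ K (maxId cl.body cl.tokens) τ.counter ρ' ρ1 ρ2 K1 S := by
      intro p hp
      obtain ⟨q, hq, rfl⟩ := Multiset.mem_map.1 (hps p hp)
      simpa using hq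
    have hid : ∀ p ∈ ps, p.2.id = p.1.id := fun p hp => id_eq_of_mem_unfoldPairs (hps' p hp)
    rw [List.map_congr_left hid]
    refine (h.mem_tokens_fire hcl hv hτ hchr htok hcount (ρ' := ρ') fun i hi => ?_).2 ht
    obtain ⟨p, hp, rfl⟩ := List.mem_map.1 hi
    exact ⟨p.swap, hps' p hp, rfl⟩
  · obtain ⟨e1, e2, e3, e4⟩ := (sat_total_fire hsym2).1 hν
    rw [htot] at e4
    obtain ⟨f1, f2, f3, f4⟩ := (sat_total_fire hsym).1 e4
    rw [← List.map_append, map_eval_place] at e1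
    let μ : ℕ → M := merge cl.vars (ν ∘ ρ1) ((ν ∘ ρ2) ∘ ρ.symm)
    have h1 : ∀ x ∈ cl.vars, μ x = (ν ∘ ρ1) x := fun x hx => merge_of_mem hx
    have h2 : ∀ x ∈ v₀.vars, (μ ∘ ρ) x = (ν ∘ ρ2) x := by
      intro x hx
      have hxv : ρ x ∈ (v₀.rename ρ).vars := by
        rw [AnnRule.vars_rename]
        exact Set.mem_image_of_mem _ hx
      have : μ (ρ x) = ((ν ∘ ρ2) ∘ ρ.symm) (ρ x) :=
        merge_of_notMem (Set.disjoint_right.1 h.disjoint hxv)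
      simpa using this
    obtain ⟨g1, g2⟩ := (h.sat_unfoldedRule hCT (μ := μ)).2
      ⟨(sat_congr fun x hx => h1 x (cl.conjVars_guard_subset hx)).2 f2,
        (sat_congr fun x hx => h1 x (cl.conjVars_bodyB_subset hx)).2 f3,
        by
          rw [map_eval_congr fun x hx => h1 x (h.atomsVars_subset hx), e1]
          exact map_eval_congr fun x hx => (h2 x (v₀.headVars_subset hx)).symm,
        (sat_congr fun x hx => h2 x (v₀.conjVars_guard_subset hx)).2 e2,
        (sat_congr fun x hx => h2 x (v₀.conjVars_bodyB_subset hx)).2 e3⟩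
    obtain ⟨ν', i1, i2, i3⟩ := exists_sat_total_fire
      (r := unfoldedRule CT cl (v₀.rename ρ) θ K S1 S2) hchr hsym hρ' f4 (f1.trans
        (map_eval_congr fun x hx => (h1 x (cl.headVars_subset hx)).symm)) g1 g2
    refine ⟨ν', fun x hx => i2 x (hVτ hx), i1, fun p hp => ?_⟩
    obtain ⟨q, hq, rfl⟩ := Multiset.mem_map.1 hp
    have hbody : ∀ b ∈ (unfoldedRule CT cl (v₀.rename ρ) θ K S1 S2).body,
        b.atom.eval (ν' ∘ ρ') = b.atom.eval μ := fun b hb =>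
      UAtom.eval_congr fun x hx => i3 x (AnnRule.idAtomsVars_body_subset _ ⟨b, hb, hx⟩)
    rcases mem_unfoldPairs.1 hq with ⟨b, hb, rfl⟩ | ⟨b, hb, rfl⟩ | ⟨k, hk, rfl⟩
    · simp only [Prod.swap, IdAtom.eval_place]
      rw [hbody b (by rw [UnfoldingData.body_unfoldedRule]; exact Multiset.mem_add.2 (Or.inl hb))]
      exact UAtom.eval_congr fun x hx =>
        (h1 x (cl.idAtomsVars_body_subset ⟨b, h.mem_body' hb, hx⟩)).symm
    · simp only [Prod.swap]
      rw [IdAtom.eval_place, IdAtom.eval_place, hbody _ (by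
        rw [UnfoldingData.body_unfoldedRule]
        exact Multiset.mem_add.2 (Or.inr (Multiset.mem_map_of_mem _ hb))), IdAtom.eval_place]
      exact UAtom.eval_congr fun x hx => (h2 x (v₀.idAtomsVars_body_subset ⟨b, hb, hx⟩)).symm
    · have hmem : k ∈ τ.chr := by
        rw [hchr]
        simp only [Multiset.mem_add] at hk ⊢
        tauto
      exact UAtom.eval_congr fun x hx => (i2 x (Config.atomVars_subset hmem hx)).symm

/-- Applying the unfolded rule amounts to applying `cl`, solving, and applying `v₀`. -/
theorem UnfoldingData.sim_fire (hCT : ContainsClarkEquality CT)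
    (h : UnfoldingData CT cl v₀ S1 S2 ρ θ K) (hcl : cl.WF) (hv : v₀.WF) {τ τ2 : Config L Q}
    {K1 K2 : List (IdAtom L Q)} {S : Multiset (IdAtom L Q)}
    {ρ' ρ1 ρ2 : Equiv.Perm ℕ} (hτ : τ.WF) (hVτ : V ⊆ τ.vars) (hchr : τ.chr = ↑K1 + ↑K2 + S)
    (hsym : (chrOf (K1 ++ K2)).map UAtom.sym = (cl.H1 ++ cl.H2).map UAtom.sym)
    (hρ' : Disjoint ((unfoldedRule CT cl (v₀.rename ρ) θ K S1 S2).rename ρ').vars τ.vars)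
    (hρ1 : Disjoint (cl.rename ρ1).vars τ.vars) (hρ2 : Disjoint (v₀.rename ρ2).vars τ2.vars)
    (hc : τ2.chr = (fire cl ρ1 τ K1 K2 S).chr)
    (htot : τ2.total = (fire cl ρ1 τ K1 K2 S).total)
    (htok : τ2.tokens = (fire cl ρ1 τ K1 K2 S).tokens)
    (hcount : τ2.counter = (fire cl ρ1 τ K1 K2 S).counter) :
    Sim CT V (fire (unfoldedRule CT cl (v₀.rename ρ) θ K S1 S2) ρ' τ K1 K2 S)
      (fire v₀ ρ2 τ2 (S1.map (IdAtom.place ρ1 τ.counter)) (S2.map (IdAtom.place ρ1 τ.counter))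
        (K.map (IdAtom.place ρ1 τ.counter) + ↑K1 + S)) := by
  have hcount' : τ2.counter = maxId cl.body cl.tokens + τ.counter := by
    rw [hcount]
    simp [fire, inst]
  refine ⟨_, ?_, ?_, ?_, h.forth_fire hCT hcl hv hτ hVτ hchr hsym hρ1 hρ2 hc htot htok hcount,
    h.back_fire hCT hcl hv hτ hVτ hchr hsym hρ' htot htok hcount⟩
  · rw [fire_chr_place, UnfoldingData.body_unfoldedRule, unfoldPairs]
    simp only [Multiset.map_add, Multiset.map_map, Multiset.map_coe, Function.comp_def,
      Multiset.map_id', List.map_map, List.map_id']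
    abel
  · rw [fire_chr_place, unfoldPairs, hcount']
    simp only [Multiset.map_add, Multiset.map_map, Multiset.map_coe, Function.comp_def,
      Multiset.map_id', List.map_map, List.map_id']
    abel
  · intro p hp
    rcases mem_unfoldPairs.1 hp with ⟨b, -, rfl⟩ | ⟨b, -, rfl⟩ | ⟨k, -, rfl⟩ <;> simp

end UnfoldingStep
-- Answers are invariant under the equivalence of configurations
section Answers

variable {L : FirstOrder.Language.{u, v}} {Q : ℕ → Type w} {CT : L.Theory} {V : Set ℕ}

/-! The equivalence of configurations preserves answers. -/

/-- The answer that a configuration represents when all its built-in constraints are solved. -/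
def Config.answer (σ : Config L Q) : Answer L Q := ⟨σ.chr.map IdAtom.atom, σ.total⟩

theorem Answer.Equiv.mono {W : Set ℕ} (hW : W ⊆ V) {a b : Answer L Q}
    (h : Answer.Equiv CT V a b) : Answer.Equiv CT W a b := by
  obtain ⟨l, h1, h2, h3, h4⟩ := h
  refine ⟨l, h1, h2, h3, fun M => ⟨fun ν hν => ?_, fun ν hν => ?_⟩⟩
  · obtain ⟨ν', e1, e2⟩ := (h4 M).1 ν hν
    exact ⟨ν', fun x hx => e1 x (hW hx), e2⟩
  · obtain ⟨ν', e1, e2⟩ := (h4 M).2 ν hν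
    exact ⟨ν', fun x hx => e1 x (hW hx), e2⟩

theorem Answer.Equiv.satisfiable {a b : Answer L Q} (h : Answer.Equiv CT V a b)
    (ha : Satisfiable CT a.store) : Satisfiable CT b.store := by
  obtain ⟨l, -, -, -, h4⟩ := h
  obtain ⟨M, ν, hν⟩ := ha
  obtain ⟨ν', -, h, -⟩ := (h4 M).1 ν hν
  exact ⟨M, ν', h⟩

theorem Answer.Equiv.of_map (f : UAtom L Q → UAtom L Q) (hf : ∀ h, (f h).sym = h.sym)
    {B : Multiset (UAtom L Q)} {C D : Multiset (Builtin L)}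
    (h1 : ∀ (M : FirstOrder.Language.Theory.ModelType.{u, v, max u v} CT) (ν : ℕ → M), Sat C ν →
      ∃ ν' : ℕ → M, (∀ x ∈ V, ν' x = ν x) ∧ Sat D ν' ∧ ∀ h ∈ B, h.eval ν = (f h).eval ν')
    (h2 : ∀ (M : FirstOrder.Language.Theory.ModelType.{u, v, max u v} CT) (ν' : ℕ → M), Sat D ν' →
      ∃ ν : ℕ → M, (∀ x ∈ V, ν x = ν' x) ∧ Sat C ν ∧ ∀ h ∈ B, h.eval ν = (f h).eval ν') :
    Answer.Equiv CT V ⟨B, C⟩ ⟨B.map f, D⟩ := by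
  refine ⟨B.map fun h => (h, f h), by simp, by simp, ?_, fun M => ⟨fun ν hν => ?_, fun ν hν => ?_⟩⟩
  · intro p hp
    obtain ⟨h, -, rfl⟩ := Multiset.mem_map.1 hp
    exact (hf h).symm
  · obtain ⟨ν', e1, e2, e3⟩ := h1 M ν hν
    refine ⟨ν', e1, e2, fun p hp => ?_⟩
    obtain ⟨h, hh, rfl⟩ := Multiset.mem_map.1 hp
    exact e3 h hh
  · obtain ⟨ν', e1, e2, e3⟩ := h2 M ν hν
    refine ⟨ν', e1, e2, fun p hp => ?_⟩
    obtain ⟨h, hh, rfl⟩ := Multiset.mem_map.1 hp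
    exact e3 h hh

theorem realize_single {M : Type*} [L.Structure M] (X : ℕ) (t : L.Term ℕ) (ν : ℕ → M) :
    (fun x => (single X t x).realize ν) = Function.update ν X (t.realize ν) := by
  funext x
  by_cases hx : x = X
  · subst hx; simp [single]
  · simp [single, hx]

theorem map_atom_subst (θ : ℕ → L.Term ℕ) (B : Multiset (IdAtom L Q)) :
    (B.map (IdAtom.subst θ)).map IdAtom.atom = (B.map IdAtom.atom).map (UAtom.subst θ) := by
  simp only [Multiset.map_map]
  rfl

/-- Configurations with inconsistent constraints, and configurations with equivalent answers. -/
def AnswerEqv (CT : L.Theory) (V : Set ℕ) (σ τ : Config L Q) : Prop :=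
  (¬ Satisfiable CT σ.total ∧ ¬ Satisfiable CT τ.total) ∨ Answer.Equiv CT V σ.answer τ.answer

/-- Only `failed` relates unrelated constraints, and it requires both sides to be inconsistent;
every other generator pairs each constraint with its own image. -/
theorem EqvGenerator.answerEqv {σ τ : Config L Q} (h : EqvGenerator CT V σ τ) :
    AnswerEqv CT V σ τ := by
  cases h with
  | solve d S B C T n =>
    right
    have : (⟨S, d ::ₘ B, C, T, n⟩ : Config L Q).answer = (⟨S, B, d ::ₘ C, T, n⟩ : Config L Q).answer := by
      simp [Config.answer, Config.total, Multiset.cons_add, Multiset.add_cons]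
    rw [this]
    exact Answer.Equiv.refl _ _ _
  | bind X t S B C T n =>
    right
    have key : ∀ (M : FirstOrder.Language.Theory.ModelType.{u, v, max u v} CT) (ν : ℕ → M),
        ν X = t.realize ν → (fun x => (single X t x).realize ν) = ν := by
      intro M ν hν
      rw [realize_single, ← hν, Function.update_eq_self]
    simp only [Config.answer, map_atom_subst]
    refine Answer.Equiv.of_map (UAtom.subst (single X t)) (fun h => rfl) ?_ ?_
    · intro M ν hν
      simp only [Config.total, sat_add, sat_cons, Builtin.Holds,
        FirstOrder.Language.Term.realize] at hν
      refine ⟨ν, fun _ _ => rfl, ?_, fun h _ => ?_⟩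
      · simp only [Config.total, sat_add, sat_cons, Builtin.Holds,
          FirstOrder.Language.Term.realize, sat_subst, key M ν hν.1.1]
        exact hν
      · rw [UAtom.eval_subst, key M ν hν.1.1]
    · intro M ν hν
      simp only [Config.total, sat_add, sat_cons, Builtin.Holds,
        FirstOrder.Language.Term.realize, sat_subst] at hν
      refine ⟨ν, fun _ _ => rfl, ?_, fun h _ => ?_⟩
      · rw [key M ν hν.1.1] at hν
        simp only [Config.total, sat_add, sat_cons, Builtin.Holds,
          FirstOrder.Language.Term.realize]
        exact hν
      · rw [UAtom.eval_subst, key M ν hν.1.1]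
  | renameVar X Y σ hX hY hYσ =>
    right
    have htot : Config.total ⟨σ.chr.map (IdAtom.subst (single X (FirstOrder.Language.Term.var Y))),
          conjSubst (single X (FirstOrder.Language.Term.var Y)) σ.pend,
          conjSubst (single X (FirstOrder.Language.Term.var Y)) σ.store, σ.tokens, σ.counter⟩ =
        conjSubst (single X (FirstOrder.Language.Term.var Y)) σ.total := by
      simp [Config.total, conjSubst]
    simp only [Config.answer, map_atom_subst, htot]
    refine Answer.Equiv.of_map (UAtom.subst (single X (.var Y))) (fun h => rfl) ?_ ?_
    · intro M ν hν
      have hagree : ∀ x ∈ σ.vars, (single X (FirstOrder.Language.Term.var Y) x : L.Term ℕ).realize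
          (Function.update ν Y (ν X)) = ν x := by
        intro x hx
        have hxY : x ≠ Y := fun h => hYσ (h ▸ hx)
        by_cases hxX : x = X
        · subst hxX; simp [single]
        · simp [single, hxX, hxY]
      -- `Y` is fresh and outside `V`, so it may take over the value of `X`.
      refine ⟨Function.update ν Y (ν X), fun x hx => ?_, ?_, fun h hh => ?_⟩
      · rw [Function.update_of_ne]
        rintro rfl
        exact hY hx
      · rw [sat_subst]
        exact (sat_congr fun x hx => hagree x (σ.conjVars_total_subset hx)).2 hν
      · obtain ⟨k, hk, rfl⟩ := Multiset.mem_map.1 hh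
        rw [UAtom.eval_subst]
        exact UAtom.eval_congr fun x hx => (hagree x (Config.atomVars_subset hk hx)).symm
    · intro M ν hν
      rw [sat_subst] at hν
      refine ⟨_, fun x hx => ?_, hν, fun h _ => (UAtom.eval_subst).symm⟩
      have hxX : x ≠ X := by
        rintro rfl
        exact hX hx
      simp [single, hxX]
  | store σ C' hC =>
    right
    have key : ∀ (M : FirstOrder.Language.Theory.ModelType.{u, v, max u v} CT)
        (D E : Multiset (Builtin L)),
        (∀ ν : ℕ → M, (∃ ν' : ℕ → M, (∀ x, x ∉ conjVars D \ (σ.goalVars ∪ V) → ν' x = ν x) ∧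
          Sat D ν') → ∃ ν' : ℕ → M, (∀ x, x ∉ conjVars E \ (σ.goalVars ∪ V) → ν' x = ν x) ∧
          Sat E ν') → ∀ ν : ℕ → M, Sat (D + σ.pend) ν → ∃ ν' : ℕ → M, (∀ x ∈ V, ν' x = ν x) ∧
            Sat (E + σ.pend) ν' ∧ ∀ h ∈ σ.chr.map IdAtom.atom, h.eval ν = h.eval ν' := by
      -- The quantified variables lie outside `V` and outside the goal part, so changing them
      -- affects neither the pending nor the CHR constraints.
      intro M D E hDE ν hν
      rw [sat_add] at hν
      obtain ⟨ν', e1, e2⟩ := hDE ν ⟨ν, fun _ _ => rfl, hν.1⟩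
      refine ⟨ν', fun x hx => e1 x fun h => h.2 (Or.inr hx), sat_add.2 ⟨e2, ?_⟩, fun h hh => ?_⟩
      · exact (sat_congr fun x hx => e1 x fun h => h.2 (Or.inl (Or.inr hx))).2 hν.2
      · obtain ⟨k, hk, rfl⟩ := Multiset.mem_map.1 hh
        exact UAtom.eval_congr fun x hx =>
          (e1 x fun h => h.2 (Or.inl (Or.inl ⟨k, hk, hx⟩))).symm
    have := Answer.Equiv.of_map (CT := CT) (V := V) (B := σ.chr.map IdAtom.atom)
      (C := σ.store + σ.pend) (D := C' + σ.pend) id (fun _ => rfl)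
      (fun M ν hν => key M _ _ (fun ν => (hC M ν).1) ν hν) (fun M ν hν => by
        obtain ⟨ν', e1, e2, e3⟩ := key M _ _ (fun ν => (hC M ν).2) ν hν
        exact ⟨ν', e1, e2, fun h hh => (e3 h hh).symm⟩)
    simpa [Config.answer, Config.total] using this
  | failed S S' B B' T T' n m =>
    left
    constructor <;>
    · rintro ⟨M, ν, hν⟩
      simp [Config.total, Builtin.Holds] at hν
  | renameId σ ρ m hS hT =>
    right
    have : (⟨σ.chr.map (IdAtom.mapId ρ), σ.pend, σ.store, σ.tokens.image (Token.mapId ρ), m⟩ :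
        Config L Q).answer = σ.answer := by
      simp [Config.answer, Config.total, Function.comp_def, IdAtom.mapId]
    rw [this]
    exact Answer.Equiv.refl _ _ _
  | clean => exact Or.inr (Answer.Equiv.refl _ _ _)

theorem Eqv.answerEqv {σ τ : Config L Q} (h : Eqv CT V σ τ) : AnswerEqv CT V σ τ := by
  induction h with
  | rel _ _ h => exact h.answerEqv
  | refl _ => exact Or.inr (Answer.Equiv.refl _ _ _)
  | symm _ _ _ ih => exact ih.imp And.symm Answer.Equiv.symm
  | trans _ _ _ _ _ ih1 ih2 =>
    rcases ih1 with ⟨h1, h2⟩ | h1 <;> rcases ih2 with ⟨h3, h4⟩ | h3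
    · exact Or.inl ⟨h1, h4⟩
    · exact Or.inl ⟨h1, fun h => h2 (h3.symm.satisfiable h)⟩
    · exact Or.inl ⟨fun h => h3 (h1.satisfiable h), h4⟩
    · exact Or.inr (h1.trans h3)

theorem Sim.answer {σ τ : Config L Q} (h : Sim CT V σ τ) :
    Answer.Equiv CT V σ.answer τ.answer := by
  obtain ⟨l, h⟩ := h
  refine ⟨l.map fun p => (p.1.atom, p.2.atom), ?_, ?_, ?_, fun M => ⟨fun ν hν => ?_, fun ν hν => ?_⟩⟩
  · simp [Config.answer, ← h.fst]
  · simp [Config.answer, ← h.snd]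
  · intro p hp
    obtain ⟨q, hq, rfl⟩ := Multiset.mem_map.1 hp
    exact h.sym q hq
  · obtain ⟨ν', e1, e2, e3⟩ := h.forth.2 M ν hν
    refine ⟨ν', e1, e2, fun p hp => ?_⟩
    obtain ⟨q, hq, rfl⟩ := Multiset.mem_map.1 hp
    exact e3 q hq
  · obtain ⟨ν', e1, e2, e3⟩ := h.back.2 M ν hν
    refine ⟨ν', e1, e2, fun p hp => ?_⟩
    obtain ⟨q, hq, rfl⟩ := Multiset.mem_map.1 hp
    exact (e3 q.swap (Multiset.mem_map_of_mem _ hq)).symm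

theorem Satisfiable.mono {C D : Multiset (Builtin L)} (h : C ≤ D) (hD : Satisfiable CT D) :
    Satisfiable CT C :=
  let ⟨M, ν, hν⟩ := hD
  ⟨M, ν, fun c hc => hν c (Multiset.mem_of_le h hc)⟩

theorem Config.satisfiable_store {σ : Config L Q} (h : Satisfiable CT σ.total) :
    Satisfiable CT σ.store :=
  h.mono (Multiset.le_add_right _ _)

/-- Transitions never drop built-in constraints, so every configuration on the way to an answer is
satisfiable. -/
theorem Step.satisfiable {P : Set (AnnRule L Q)} {σ τ : Config L Q} (h : Step CT P σ τ)
    (hτ : Satisfiable CT τ.total) : Satisfiable CT σ.total := by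
  rcases h with h | h
  · rwa [← h.eq.2.1]
  · obtain ⟨r, -, ρ, K1, K2, S, hK, -, rfl⟩ := apply_iff.1 h
    obtain ⟨M, ν, hν⟩ := hτ
    exact ⟨M, ν, ((sat_total_fire hK.sym).1 hν).2.2.2⟩

end Answers
-- Simulation of derivations and preservation of final configurations
section Replacement

variable {L : FirstOrder.Language.{u, v}} {Q : ℕ → Type w} {CT : L.Theory} {V : Set ℕ}
  {P : Set (AnnRule L Q)}

theorem reflTransGen_normalStep_of_solve {σ τ : Config L Q}
    (h : Relation.ReflTransGen (Solve CT) σ τ) :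
    Relation.ReflTransGen (NormalStep CT P) σ τ :=
  Relation.ReflTransGen.mono (fun _ _ h => Or.inl h) _ _ h

theorem NormalStep.step {σ τ : Config L Q} (h : NormalStep CT P σ τ) : Step CT P σ τ :=
  h.imp id And.right

/-- A rule application in a normal derivation, followed by solving. -/
theorem CanFire.exists_normal {r : AnnRule L Q} (hrP : r ∈ P) (hr : r.WF) {σ : Config L Q}
    {K1 K2 : List (IdAtom L Q)} {S : Multiset (IdAtom L Q)} (h : CanFire CT r σ K1 K2 S)
    (hpend : σ.pend = 0) (hσ : σ.WF) {ρ : Equiv.Perm ℕ}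
    (hρ : Disjoint (r.rename ρ).vars σ.vars) :
    ∃ τ, Relation.TransGen (NormalStep CT P) σ τ ∧ τ.WF ∧ σ.vars ⊆ τ.vars ∧
      τ.chr = (fire r ρ σ K1 K2 S).chr ∧ τ.total = (fire r ρ σ K1 K2 S).total ∧
      τ.tokens = (fire r ρ σ K1 K2 S).tokens ∧ τ.counter = (fire r ρ σ K1 K2 S).counter ∧
      (τ.pend = 0 ∨ ¬ Satisfiable CT τ.store) := by
  obtain ⟨τ, h1, h2, h3, h4, h5, h6⟩ := exists_solved CT (fire r ρ σ K1 K2 S)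
  refine ⟨τ, Relation.TransGen.trans_left (.single (Or.inr ⟨hpend, ?_⟩))
    (reflTransGen_normalStep_of_solve h1), (hσ.fire hr h.chr).of_eq h2 h4 h5, ?_, h2, h3, h4, h5, h6⟩
  · exact apply_iff.2 ⟨r, hrP, ρ, K1, K2, S, h, hρ, rfl⟩
  · rw [Config.vars_eq τ, h2, h3, ← Config.vars_eq]
    exact vars_subset_fire h.chr h.sym

/-- The relation between the configurations of a derivation and those of the derivation by which
it is simulated. -/
structure Simulates (CT : L.Theory) (V : Set ℕ) (σ τ : Config L Q) : Prop where
  sim : Sim CT V σ τ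
  wf_left : σ.WF
  wf_right : τ.WF
  subset_left : V ⊆ σ.vars
  subset_right : V ⊆ τ.vars
  pend : τ.pend = 0

theorem Simulates.total_eq {σ τ : Config L Q} (h : Simulates CT V σ τ) : τ.total = τ.store := by
  simp [Config.total, h.pend]

theorem Simulates.satisfiable_iff {σ τ : Config L Q} (h : Simulates CT V σ τ) :
    Satisfiable CT σ.total ↔ Satisfiable CT τ.store := by
  rw [← h.total_eq]
  exact ⟨h.sim.answer.satisfiable, h.sim.answer.symm.satisfiable⟩

/-- The simulating configuration is already solved and does not move. -/
theorem Simulates.solve {σ σ' τ : Config L Q} (h : Simulates CT V σ τ) (hs : Solve CT σ σ') :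
    Simulates CT V σ' τ := by
  obtain ⟨e1, e2, e3, e4⟩ := hs.eq
  refine ⟨(Sim.of_eq e1 e2 e3).symm.trans h.sim, h.wf_left.of_eq e1 e3 e4, h.wf_right, ?_,
    h.subset_right, h.pend⟩
  rw [Config.vars_eq, e1, e2, ← Config.vars_eq]
  exact h.subset_left

/-- A configuration that is similar to the result of a rule application, and its solved form. -/
theorem simulates_of_sim {σ τ₀ τ : Config L Q} (h : Sim CT V σ τ₀) (hσ : σ.WF) (hτ : τ.WF)
    (hVσ : V ⊆ σ.vars) (hVτ : V ⊆ τ.vars) (e1 : τ.chr = τ₀.chr) (e2 : τ.total = τ₀.total)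
    (e3 : τ.tokens = τ₀.tokens) (hpend : τ.pend = 0 ∨ ¬ Satisfiable CT τ.store) :
    Simulates CT V σ τ ∨ (¬ Satisfiable CT τ.store ∧ ¬ Satisfiable CT σ.total) := by
  have hsim := h.trans (Sim.of_eq e1 e2 e3)
  rcases hpend with hp | hp
  · exact Or.inl ⟨hsim, hσ, hτ, hVσ, hVτ, hp⟩
  · exact Or.inr ⟨hp, fun hs => hp (Config.satisfiable_store (hsim.answer.satisfiable hs))⟩

/-- The application of a rule of `P` is simulated by the application of the same rule. -/
theorem Simulates.fire {r : AnnRule L Q} (hrP : r ∈ P) (hr : r.WF) {σ τ : Config L Q}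
    (h : Simulates CT V σ τ) (hsat : Satisfiable CT τ.store) {ρ : Equiv.Perm ℕ}
    {K1 K2 : List (IdAtom L Q)} {S : Multiset (IdAtom L Q)} (hK : CanFire CT r σ K1 K2 S)
    (hρ : Disjoint (r.rename ρ).vars σ.vars) :
    ∃ τ', Relation.TransGen (NormalStep CT P) τ τ' ∧
      (Simulates CT V (fire r ρ σ K1 K2 S) τ' ∨
        (¬ Satisfiable CT τ'.store ∧ ¬ Satisfiable CT (CHR.fire r ρ σ K1 K2 S).total)) := by
  obtain ⟨K1', K2', S', hK', hsim⟩ := h.sim.fire hr h.wf_left h.wf_right h.subset_left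
    h.subset_right h.pend hsat hK
  obtain ⟨ρ', hρ'⟩ := r.exists_fresh τ
  obtain ⟨τ', h1, h2, h3, e1, e2, e3, -, h4⟩ := hK'.exists_normal hrP hr h.pend h.wf_right hρ'
  exact ⟨τ', h1, simulates_of_sim (hsim ρ ρ' hρ hρ') (h.wf_left.fire hr hK.chr) h2
    (h.subset_left.trans (vars_subset_fire hK.chr hK.sym)) (h.subset_right.trans h3) e1 e2 e3 h4⟩

/-- The application of the unfolded rule in a solved configuration is simulated by the application
of the two rules from which it originates. -/
theorem UnfoldingData.exists_normal {cl v₀ : AnnRule L Q} {S1 S2 : List (IdAtom L Q)}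
    {ρ : Equiv.Perm ℕ} {θ : ℕ → L.Term ℕ} {K : Multiset (IdAtom L Q)}
    (hCT : ContainsClarkEquality CT) (h : UnfoldingData CT cl v₀ S1 S2 ρ θ K)
    (hclP : cl ∈ P) (hvP : v₀ ∈ P) (hcl : cl.WF) (hv : v₀.WF) {τ : Config L Q} (hτ : τ.WF)
    (hpend : τ.pend = 0) (hVτ : V ⊆ τ.vars)
    {K1 K2 : List (IdAtom L Q)} {S : Multiset (IdAtom L Q)}
    (hK : CanFire CT (unfoldedRule CT cl (v₀.rename ρ) θ K S1 S2) τ K1 K2 S) {ρ' : Equiv.Perm ℕ}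
    (hρ' : Disjoint ((unfoldedRule CT cl (v₀.rename ρ) θ K S1 S2).rename ρ').vars τ.vars) :
    ∃ τ', Relation.TransGen (NormalStep CT P) τ τ' ∧
      (Simulates CT V (fire (unfoldedRule CT cl (v₀.rename ρ) θ K S1 S2) ρ' τ K1 K2 S) τ' ∨
        (¬ Satisfiable CT τ'.store ∧
          ¬ Satisfiable CT (fire (unfoldedRule CT cl (v₀.rename ρ) θ K S1 S2) ρ' τ K1 K2 S).total)) := by
  have hKcl : CanFire CT cl τ K1 K2 S := by
    refine ⟨hK.chr, hK.sat, hK.sym1, hK.sym2, fun M ν hν => ?_, hK.token⟩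
    obtain ⟨μ, e1, e2⟩ := hK.guard M ν hν
    exact ⟨μ, e1, (sat_add.1 e2).1⟩
  obtain ⟨ρ1, hρ1⟩ := cl.exists_fresh τ
  obtain ⟨τ2, h1, h2, h3, e1, e2, e3, e4, h4⟩ := hKcl.exists_normal hclP hcl hpend hτ hρ1
  by_cases hsat : Satisfiable CT τ2.store
  swap
  -- If solving fails after `cl`, the unfolded rule also leads to inconsistency, since a solution of
  -- its result would provide one of the result of `cl`.
  · refine ⟨τ2, h1, Or.inr ⟨hsat, ?_⟩⟩
    rintro ⟨M, ν, hν⟩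
    obtain ⟨f1, f2, f3, f4⟩ := (sat_total_fire hK.sym).1 hν
    obtain ⟨g1, g2, -⟩ := (h.sat_unfoldedRule hCT).1 ⟨f2, f3⟩
    obtain ⟨ν', hν', -⟩ := exists_sat_total_fire hKcl.chr hKcl.sym hρ1 f4 f1 g1 g2
    rw [← e2] at hν'
    exact hsat (Config.satisfiable_store ⟨M, ν', hν'⟩)
  have hp2 : τ2.pend = 0 := h4.resolve_right (not_not.2 hsat)
  have ht2 : τ2.total = τ2.store := by simp [Config.total, hp2]
  have hKv : CanFire CT v₀ τ2 (S1.map (IdAtom.place ρ1 τ.counter))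
      (S2.map (IdAtom.place ρ1 τ.counter)) (K.map (IdAtom.place ρ1 τ.counter) + ↑K1 + S) := by
    refine ⟨?_, hsat, ?_, ?_, fun M ν hν => ?_, ?_⟩
    · rw [e1, fire_chr_place, h.body]
      simp only [Multiset.map_add, Multiset.map_coe]
      abel
    · rw [map_sym_place, h.sym1]
    · rw [map_sym_place, h.sym2]
    · rw [← ht2, e2] at hν
      obtain ⟨f1, f2, f3, f4⟩ := (sat_total_fire hKcl.sym).1 hν
      -- This `μ` satisfies the unfolded guard, but `cl` was applied with `ν ∘ ρ1`. Both match the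
      -- same head constraints, which is what `exists_sat_guard` needs.
      obtain ⟨μ, g1, g2⟩ := hK.guard M ν (sat_add.1 f4).1
      rw [← List.map_append, map_eval_place]
      exact h.exists_sat_guard hCT f3 f2 (f1.symm.trans g1) (sat_add.1 g2).2
    · rw [← List.map_append, idsOf_place, e3]
      -- Heads are non-empty, so the token of `v₀` contains some shifted identifier above
      -- `τ.counter`. This rules out the old tokens and the token of `cl`; a body token of `cl` is
      -- excluded by the token condition of the unfolding.
      have hne : idsOf (S1 ++ S2) ≠ [] := by
        have hlen := congrArg List.length h.sym
        simp only [chrOf, List.length_map] at hlen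
        intro he
        have h0 : (S1 ++ S2).length = 0 := by
          simpa [idsOf] using congrArg List.length he
        rw [h0] at hlen
        exact hv.1 (List.length_eq_zero_iff.1 hlen.symm)
      obtain ⟨i, hi⟩ := List.exists_mem_of_ne_nil _ hne
      have hpos : 0 < i := by
        obtain ⟨k, hk, rfl⟩ := List.mem_map.1 hi
        exact hcl.2.2.1 k (h.mem_body hk)
      have hi' := List.mem_map_of_mem (f := fun i => i + τ.counter) hi
      simp only [CHR.fire, inst, Finset.mem_union, Finset.mem_singleton, Finset.mem_image]
      rintro ((ht | ht) | ⟨t, ht, he⟩)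
      · have := (hτ.2.2 _ ht).2 _ hi'
        omega
      · rw [Token.mk.injEq] at ht
        rw [ht.2] at hi'
        obtain ⟨k, hk, hke⟩ := List.mem_map.1 hi'
        have := (hτ.2.1 k (by
          rw [hK.chr]
          exact Multiset.mem_add.2 (Or.inl (by simpa using hk)))).2
        omega
      · have := Token.mapId_add_injective τ.counter
          (a₂ := ⟨v₀.name, idsOf (S1 ++ S2)⟩) (he.trans rfl)
        rw [this] at ht
        exact h.token ht
  obtain ⟨ρ2, hρ2⟩ := v₀.exists_fresh τ2
  obtain ⟨τ4, i1, i2, i3, j1, j2, j3, -, i4⟩ := hKv.exists_normal hvP hv hp2 h2 hρ2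
  exact ⟨τ4, h1.trans i1, simulates_of_sim
    (h.sim_fire hCT hcl hv hτ hVτ hK.chr hKcl.sym hρ' hρ1 hρ2 e1 e2 e3 e4)
    (hτ.fire (h.wf_unfoldedRule hcl hv) hK.chr) i2
    (hVτ.trans (vars_subset_fire hK.chr hK.sym)) (hVτ.trans (h3.trans i3)) j1 j2 j3 i4⟩

/-- Derivations of the program with the unfolded rules are simulated by normal derivations of the
original program. -/
theorem Simulates.apply (hCT : ContainsClarkEquality CT) (hP : ∀ r ∈ P, r.WF) {cl : AnnRule L Q}
    (hcl : cl ∈ P) {U : Set (AnnRule L Q)} (hU : IsUnf CT P cl U) {σ σ' τ : Config L Q}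
    (h : Simulates CT V σ τ) (hsat : Satisfiable CT τ.store)
    (hs : Apply CT ((P \ {cl}) ∪ U) σ σ') :
    ∃ τ', Relation.TransGen (NormalStep CT P) τ τ' ∧
      (Simulates CT V σ' τ' ∨ (¬ Satisfiable CT τ'.store ∧ ¬ Satisfiable CT σ'.total)) := by
  obtain ⟨r, hr, ρ, K1, K2, S, hK, hρ, rfl⟩ := apply_iff.1 hs
  rcases hr with hr | hr
  · exact h.fire hr.1 (hP r hr.1) hsat hK hρ
  obtain ⟨v₀, hv, S1, S2, hunf⟩ := hU.1 r hr
  obtain ⟨ρ₀, θ, K, hd, rfl⟩ := hunf.exists_data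
  have hwf := hd.wf_unfoldedRule (hP cl hcl) (hP v₀ hv)
  obtain ⟨K1', K2', S', hK', hsim⟩ := h.sim.fire hwf h.wf_left h.wf_right h.subset_left
    h.subset_right h.pend hsat hK
  obtain ⟨ρ', hρ'⟩ := AnnRule.exists_fresh (unfoldedRule CT cl (v₀.rename ρ₀) θ K S1 S2) τ
  obtain ⟨τ', h1, h2⟩ := hd.exists_normal hCT hcl hv (hP cl hcl) (hP v₀ hv) h.wf_right h.pend
    h.subset_right hK' hρ'
  have hsim := hsim ρ ρ' hρ hρ'
  refine ⟨τ', h1, h2.imp (fun h2 => ?_) (And.imp_right fun h2 hs =>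
    h2 (hsim.answer.satisfiable hs))⟩
  exact ⟨hsim.trans h2.sim, h.wf_left.fire hwf hK.chr, h2.wf_right,
    h.subset_left.trans (vars_subset_fire hK.chr hK.sym), h2.subset_right, h2.pend⟩

theorem Config.pend_eq_zero {σ : Config L Q} (h : Satisfiable CT σ.store)
    (hf : ∀ τ, ¬ Step CT P σ τ) : σ.pend = 0 := by
  by_contra hne
  obtain ⟨c, hc⟩ := Multiset.exists_mem_of_ne_zero hne
  obtain ⟨B, hB⟩ := Multiset.exists_cons_of_mem hc
  obtain ⟨S, B', C, T, n⟩ := σ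
  obtain rfl : B' = c ::ₘ B := hB
  exact hf _ (Or.inl (Solve.mk c S B C T n h))

/-- Some rule of `U` has the guard of `cl`. -/
theorem WeaklySafelyReplaceable.exists_mem (hCT : ContainsClarkEquality CT) {cl : AnnRule L Q}
    (h : WeaklySafelyReplaceable CT P cl) {U : Set (AnnRule L Q)} (hU : IsUnf CT P cl U) :
    ∃ r ∈ U, r.name = cl.name ∧ r.H1 = cl.H1 ∧ r.H2 = cl.H2 ∧ r.guard = cl.guard := by
  obtain ⟨-, v₀, hv, S1, S2, r, hr, hent, -⟩ := h
  obtain ⟨r', hr'U, hr'⟩ := hU.2 v₀ hv S1 S2 r hr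
  obtain ⟨ρ, θ, K, hd, rfl⟩ := hr.exists_data
  obtain ⟨ρ', θ', K', hd', rfl⟩ := hr'.exists_data
  refine ⟨_, hr'U, rfl, rfl, rfl, ?_⟩
  -- The rule in `U` may come from another variant or substitution than the one witnessing weak
  -- safeness; its residual guard is empty all the same.
  have := hd.residualGuard_eq_zero hCT hd' fun M ν hν => (sat_add.1 (hent M ν hν)).2
  simp [unfoldedRule, this, conjSubst]

/-- Final configurations of the program with the unfolded rules correspond to final configurations
of the original program. -/
theorem Simulates.final (hCT : ContainsClarkEquality CT) (hP : ∀ r ∈ P, r.WF) {cl : AnnRule L Q}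
    (hcl : WeaklySafelyReplaceable CT P cl) {U : Set (AnnRule L Q)} (hU : IsUnf CT P cl U)
    {σ τ : Config L Q} (h : Simulates CT V σ τ) (hsat : Satisfiable CT τ.store)
    (hfin : ∀ σ', ¬ Step CT ((P \ {cl}) ∪ U) σ σ') :
    σ.pend = 0 ∧ ∀ τ', ¬ Step CT P τ τ' := by
  have hsatσ : Satisfiable CT σ.store := Config.satisfiable_store (h.satisfiable_iff.2 hsat)
  have hpend : σ.pend = 0 := Config.pend_eq_zero hsatσ hfin
  refine ⟨hpend, ?_⟩
  rintro τ' (hs | hs)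
  · obtain ⟨c, S, B, C, T, n, -⟩ := hs
    exact Multiset.cons_ne_zero h.pend
  · obtain ⟨r, hr, ρ, K1, K2, S, hK, -, -⟩ := apply_iff.1 hs
    -- Here applicability travels backwards, from `τ` to `σ`, which is possible because `σ` is
    -- solved as well.
    obtain ⟨K1', K2', S', hK', -⟩ := h.sim.symm.fire (hP r hr) h.wf_right h.wf_left h.subset_right
      h.subset_left hpend hsatσ hK
    have hfire : ∃ r' ∈ (P \ {cl}) ∪ U, CanFire CT r' σ K1' K2' S' := by
      -- Applicability depends only on name, head and guard, so the substitute of `cl` in `U` can be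
      -- applied where `cl` could.
      by_cases hrcl : r = cl
      · subst hrcl
        obtain ⟨r', hr', h1, h2, h3, h4⟩ := hcl.exists_mem hCT hU
        refine ⟨r', Or.inr hr', hK'.chr, hK'.sat, ?_, ?_, ?_, ?_⟩
        · rw [h2]; exact hK'.sym1
        · rw [h3]; exact hK'.sym2
        · rw [h2, h3, h4]; exact hK'.guard
        · rw [h1]; exact hK'.token
      · exact ⟨r, Or.inl ⟨hr, hrcl⟩, hK'⟩
    obtain ⟨r', hr', hK'⟩ := hfire
    obtain ⟨ρ', hρ'⟩ := r'.exists_fresh σ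
    exact hfin _ (Or.inr (apply_iff.2 ⟨r', hr', ρ', _, _, _, hK', hρ', rfl⟩))

theorem reflTransGen_step_of_normal {σ τ : Config L Q}
    (h : Relation.ReflTransGen (NormalStep CT P) σ τ) : Relation.ReflTransGen (Step CT P) σ τ :=
  Relation.ReflTransGen.mono (fun _ _ h => h.step) _ _ h

/-- Derivations that do not fail are simulated. -/
theorem Simulates.derivation (hCT : ContainsClarkEquality CT) (hP : ∀ r ∈ P, r.WF)
    {cl : AnnRule L Q} (hcl : cl ∈ P) {U : Set (AnnRule L Q)} (hU : IsUnf CT P cl U)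
    {σ σ' τ : Config L Q} (h : Simulates CT V σ τ)
    (hs : Relation.ReflTransGen (Step CT ((P \ {cl}) ∪ U)) σ σ') (hsat : Satisfiable CT σ'.total) :
    ∃ τ', Relation.ReflTransGen (Step CT P) τ τ' ∧ Simulates CT V σ' τ' := by
  induction hs with
  | refl => exact ⟨τ, .refl, h⟩
  | tail _ hstep ih =>
    have hsat' := hstep.satisfiable hsat
    obtain ⟨τ₁, h1, h2⟩ := ih hsat'
    rcases hstep with hstep | hstep
    · exact ⟨τ₁, h1, h2.solve hstep⟩
    · obtain ⟨τ₂, h3, h4⟩ := h2.apply hCT hP hcl hU (h2.satisfiable_iff.1 hsat') hstep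
      exact ⟨τ₂, h1.trans (reflTransGen_step_of_normal h3.to_reflTransGen),
        h4.resolve_right fun h => h.2 hsat⟩

/-- Unless the original program has a failing derivation, the program with the unfolded rules has
a derivation that ends in a final configuration and is simulated. -/
theorem Simulates.exists_final (hCT : ContainsClarkEquality CT) (hP : ∀ r ∈ P, r.WF)
    {cl : AnnRule L Q} (hcl : cl ∈ P) {U : Set (AnnRule L Q)} (hU : IsUnf CT P cl U)
    {τ : Config L Q}
    (hacc : Acc (fun a b => Relation.TransGen (NormalStep CT P) b a) τ) :
    ∀ σ : Config L Q, Simulates CT V σ τ →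
      ∃ τ', Relation.ReflTransGen (Step CT P) τ τ' ∧ (¬ Satisfiable CT τ'.store ∨
        ∃ σ', Relation.ReflTransGen (Step CT ((P \ {cl}) ∪ U)) σ σ' ∧
          (∀ υ, ¬ Step CT ((P \ {cl}) ∪ U) σ' υ) ∧ Simulates CT V σ' τ') := by
  -- Termination is known for `P` only, so the measure is the simulating configuration: each rule
  -- application on the left advances it by at least one normal step.
  induction hacc with
  | intro τ _ ih =>
    rintro ⟨A, B, C, T, n⟩ h
    by_cases hsat : Satisfiable CT τ.store
    swap
    · exact ⟨τ, .refl, Or.inl hsat⟩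
    -- `Solve'` steps leave the measure unchanged; they are bounded by the number of pending
    -- constraints.
    induction B using Multiset.induction_on generalizing C with
    | cons c B ihB =>
      have hs := Solve.mk c A B C T n (Config.satisfiable_store (h.satisfiable_iff.2 hsat))
      obtain ⟨τ', h1, h2⟩ := ihB _ (h.solve hs)
      refine ⟨τ', h1, h2.imp_right ?_⟩
      rintro ⟨σ', h3, h4⟩
      exact ⟨σ', .head (Or.inl hs) h3, h4⟩
    | empty =>
      by_cases hfin : ∃ σ', Step CT ((P \ {cl}) ∪ U) ⟨A, 0, C, T, n⟩ σ'
      swap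
      · exact ⟨τ, .refl, Or.inr ⟨_, .refl, not_exists.1 hfin, h⟩⟩
      obtain ⟨σ₁, hs⟩ := hfin
      have happ : Apply CT ((P \ {cl}) ∪ U) ⟨A, 0, C, T, n⟩ σ₁ := by
        refine hs.resolve_left fun hs => ?_
        generalize he : (⟨A, 0, C, T, n⟩ : Config L Q) = σ at hs
        obtain ⟨c, S, B, C', T', n', -⟩ := hs
        exact Multiset.cons_ne_zero (congrArg Config.pend he).symm
      obtain ⟨τ₁, h1, h2⟩ := h.apply hCT hP hcl hU hsat happ
      have h1' := reflTransGen_step_of_normal h1.to_reflTransGen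
      rcases h2 with h2 | h2
      · obtain ⟨τ', h3, h4⟩ := ih τ₁ h1 σ₁ h2
        refine ⟨τ', h1'.trans h3, h4.imp_right ?_⟩
        rintro ⟨σ', h5, h6⟩
        exact ⟨σ', .head hs h5, h6⟩
      · exact ⟨τ₁, h1', Or.inl h2.1⟩

theorem NormallyTerminating.acc (h : NormallyTerminating CT P) {σ : Config L Q} (hσ : σ.WF) :
    Acc (fun a b => Relation.TransGen (NormalStep CT P) b a) σ := by
  have : Acc (fun a b => NormalStep CT P b a) σ := by
    by_contra hacc
    obtain ⟨f, hf, hstep⟩ := not_acc_iff_exists_descending_chain.1 hacc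
    exact h ⟨f, hf ▸ hσ, hstep⟩
  have h2 := this.transGen
  convert h2 using 3
  exact Relation.transGen_swap.symm

/-! Initial configurations. -/

theorem Goal.wf_init (G : Goal L Q) : G.init.WF := by
  refine ⟨?_, ?_, ?_⟩
  · have : (G.init.chr.map IdAtom.id) = ↑((List.range G.chr.length).map fun i => i + 1) := by
      simp only [Goal.init, Multiset.map_coe, List.map_map]
      congr 1
      have : (IdAtom.id ∘ fun p : UAtom L Q × ℕ => (⟨p.1, p.2 + 1⟩ : IdAtom L Q)) =
          (fun i => i + 1) ∘ Prod.snd := rfl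
      rw [this, ← List.map_map, List.zipIdx_map_snd, List.range_eq_range']
    rw [this, Multiset.coe_nodup]
    exact List.nodup_range.map (add_left_injective 1)
  · intro k hk
    simp only [Goal.init, Multiset.mem_coe, List.mem_map] at hk ⊢
    obtain ⟨⟨a, i⟩, hp, rfl⟩ := hk
    have := List.snd_lt_of_mem_zipIdx hp
    simp only at this ⊢
    omega
  · intro t ht
    simp [Goal.init] at ht

theorem Goal.vars_subset_init (G : Goal L Q) : G.vars ⊆ G.init.vars := by
  rintro x (⟨a, ha, hx⟩ | hx)
  · obtain ⟨i, hi, rfl⟩ := List.mem_iff_getElem.1 ha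
    refine Or.inl (Or.inl ⟨⟨G.chr[i], i + 1⟩, ?_, hx⟩)
    simp only [Goal.init, Multiset.mem_coe, List.mem_map]
    exact ⟨(G.chr[i], i), by simp [List.mem_zipIdx_iff_getElem?], rfl⟩
  · exact Or.inl (Or.inr hx)

theorem Goal.exists_simulates (CT : L.Theory) (P : Set (AnnRule L Q)) (G : Goal L Q) :
    ∃ τ, Relation.ReflTransGen (Step CT P) G.init τ ∧ τ.WF ∧
      (Simulates CT G.init.vars G.init τ ∨
        (¬ Satisfiable CT τ.store ∧ ¬ Satisfiable CT G.init.total)) := by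
  obtain ⟨τ, h1, h2, h3, h4, h5, h6⟩ := exists_solved CT G.init
  have hwf := G.wf_init.of_eq h2 h4 h5
  refine ⟨τ, Relation.ReflTransGen.mono (fun _ _ h => Or.inl h) _ _ h1, hwf,
    simulates_of_sim (Sim.of_eq rfl rfl rfl) G.wf_init hwf subset_rfl ?_ h2 h3 h4 h6⟩
  rw [Config.vars_eq τ, h2, h3, ← Config.vars_eq]

/-- Two derivations of a confluent program from the same configuration that cannot be continued. -/
theorem Confluent.answerEqv (hconf : Confluent CT P) {σ τ₁ τ₂ : Config L Q} (hσ : σ.WF)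
    (h1 : Relation.ReflTransGen (Step CT P) σ τ₁) (h2 : Relation.ReflTransGen (Step CT P) σ τ₂)
    (hf1 : ∀ υ, ¬ Step CT P τ₁ υ) (hf2 : ∀ υ, ¬ Step CT P τ₂ υ) : AnswerEqv CT σ.vars τ₁ τ₂ := by
  obtain ⟨υ₁, υ₂, e1, e2, h⟩ := hconf σ τ₁ τ₂ hσ h1 h2
  have final : ∀ {τ υ : Config L Q}, Relation.ReflTransGen (Step CT P) τ υ →
      (∀ υ, ¬ Step CT P τ υ) → υ = τ := by
    intro τ υ h hf
    rcases h.cases_head with h | ⟨c, h, -⟩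
    · exact h.symm
    · exact absurd h (hf c)
  rw [final e1 hf1, final e2 hf2] at h
  exact h.answerEqv

theorem not_step_of_failed {σ : Config L Q} (h : ¬ Satisfiable CT σ.store) (τ : Config L Q) :
    ¬ Step CT P σ τ := by
  rintro (hs | hs)
  · obtain ⟨c, S, B, C, T, n, hs⟩ := hs
    exact h hs
  · obtain ⟨r, -, ρ, K1, K2, S, hK, -, -⟩ := apply_iff.1 hs
    exact h hK.sat

theorem Config.answer_eq {σ : Config L Q} (h : σ.pend = 0) :
    σ.answer = ⟨σ.chr.map IdAtom.atom, σ.store⟩ := by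
  simp [Config.answer, Config.total, h]

end Replacement
end CHR

theorem theorem3 {L : FirstOrder.Language.{u, v}} {Q : ℕ → Type w}
    (CT : L.Theory) (hCT : CHR.ContainsClarkEquality CT)
    (P : Set (CHR.AnnRule L Q)) (hP : ∀ r ∈ P, r.WF)
    (hterm : CHR.NormallyTerminating CT P) (hconf : CHR.Confluent CT P)
    (cl : CHR.AnnRule L Q) (hcl : CHR.WeaklySafelyReplaceable CT P cl)
    (U : Set (CHR.AnnRule L Q)) (hU : CHR.IsUnf CT P cl U)
    (G : CHR.Goal L Q) :
    CHR.QualifiedAnswers CT P G = CHR.QualifiedAnswers CT ((P \ {cl}) ∪ U) G := by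
  open CHR in
  obtain ⟨τ₀, h0, hwf0, hinit⟩ := G.exists_simulates CT P
  ext q
  constructor
  · rintro ⟨τ, hτ, hfin, hsat, rfl⟩
    have hpend := Config.pend_eq_zero hsat hfin
    have htotal : τ.total = τ.store := by simp [Config.total, hpend]
    have hsatT : Satisfiable CT τ.total := htotal ▸ hsat
    -- A failed configuration is final, so confluence would make it equivalent to the satisfiable
    -- `τ`.
    have hfail : ∀ υ, Relation.ReflTransGen (Step CT P) G.init υ → ¬ Satisfiable CT υ.store →
        False := by
      intro υ hυ hυf
      rcases hconf.answerEqv G.wf_init hτ hυ hfin (not_step_of_failed hυf) with ⟨h, -⟩ | h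
      · exact h hsatT
      · exact hυf (Config.satisfiable_store (h.satisfiable hsatT))
    have hinit := hinit.resolve_right fun h => hfail τ₀ h0 h.1
    obtain ⟨τ', h1, h2⟩ := hinit.exists_final hCT hP hcl.1 hU (hterm.acc hwf0)
    have hτ' := h0.trans h1
    have hsat' : Satisfiable CT τ'.store := by
      by_contra h
      exact hfail τ' hτ' h
    obtain ⟨σ, h3, hfin', hsim⟩ := h2.resolve_left (not_not.2 hsat')
    obtain ⟨hσp, hfinτ'⟩ := hsim.final hCT hP hcl hU hsat' hfin'
    have hσs := Config.satisfiable_store (hsim.satisfiable_iff.2 hsat')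
    refine ⟨σ, h3, hfin', hσs, Quotient.sound ?_⟩
    -- Both `τ` and `τ'` are final for `P`, so by confluence they represent the same answer.
    have h4 := (hconf.answerEqv G.wf_init hτ hτ' hfin hfinτ').resolve_left
      fun h => h.1 hsatT
    have h5 := (h4.trans hsim.sim.answer.symm).mono G.vars_subset_init
    rwa [Config.answer_eq hpend, Config.answer_eq hσp] at h5
  · rintro ⟨σ, hσ, hfin, hsat, rfl⟩
    have hpend := Config.pend_eq_zero hsat hfin
    have htotal : σ.total = σ.store := by simp [Config.total, hpend]
    have hsat' : Satisfiable CT σ.total := htotal ▸ hsat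
    -- Satisfiability propagates back from the answer to the goal, so the initial solving on the
    -- side of `P` cannot fail.
    have hinit' : Satisfiable CT G.init.total := by
      clear hfin hsat hpend htotal
      induction hσ with
      | refl => exact hsat'
      | tail _ hs ih => exact ih (hs.satisfiable hsat')
    have hinit := hinit.resolve_right fun h => h.2 hinit'
    obtain ⟨τ, h1, hsim⟩ := hinit.derivation hCT hP hcl.1 hU hσ hsat'
    have hτs := hsim.satisfiable_iff.1 hsat'
    refine ⟨τ, h0.trans h1, (hsim.final hCT hP hcl hU hτs hfin).2, hτs, Quotient.sound ?_⟩
    have h2 := hsim.sim.answer.mono G.vars_subset_init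
    rwa [Config.answer_eq hpend, Config.answer_eq hsim.pend] at h2
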